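/- **Setting.** Let $M$ be a complex manifold (Hausdorff, second countable, finite-dimensional), $\mathcal U=\{U_0,U_1\}$ an open covering of $M$, $U_{01}=U_0\cap U_1$, and $p,q,r,s\in\mathbb Z$. Let $\mathcal E^{p,q}(U)$ be the space of $C^\infty$ complex forms of type $(p,q)$ on an open set $U$ (zero if $p<0$ or $q<0$), with $d=\partial+\bar\partial$. Put $$Z_{BC}^{p,q}(U)=\{\sigma\in\mathcal E^{p,q}(U): d\sigma=0\},\quad B_{BC}^{p,q}(U)=\bar\partial\partial\,\mathcal E^{p-1,q-1}(U),$$ $$Z_A^{p,q}(U)=\{\xi\in\mathcal E^{p,q}(U):\bar\partial\partial\xi=0\},\quad B_A^{p,q}(U)=\bar\partial\mathcal E^{p,q-1}(U)+\partial\mathcal E^{p-1,q}(U),$$ and $H_{BC}^{p,q}(U)=Z_{BC}^{p,q}(U)/B_{BC}^{p,q}(U)$, $H_A^{p,q}(U)=Z_A^{p,q}(U)/B_A^{p,q}(U)$. The Čech cochains are $$\mathcal E_{BC}^{p,q}(\mathcal U)=\mathcal E^{p,q}(U_0)\oplus\mathcal E^{p,q}(U_1)\oplus\mathcal E^{p-1,q-1}(U_{01})\ni(\sigma_0,\sigma_1,\sigma_{01}),$$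 $$\mathcal E_A^{p,q}(\mathcal U)=\mathcal E^{p,q}(U_0)\oplus\mathcal E^{p,q}(U_1)\oplus\mathcal E^{p,q-1}(U_{01})\oplus\mathcal E^{p-1,q}(U_{01})\ni(\xi_0,\xi_1,\xi_{01}^{(1)},\xi_{01}^{(2)}).$$ Restrictions to $U_{01}$ being understood, the cocycles and coboundaries are as follows: * $Z_{BC}^{p,q}(\mathcal U)$: $d\sigma_0=d\sigma_1=0$ and $\sigma_1-\sigma_0-\bar\partial\partial\sigma_{01}=0$; * $B_{BC}^{p,q}(\mathcal U)$: $\sigma_i=\bar\partial\partial\tau_i$ $(i=0,1)$, $\sigma_{01}=\tau_1-\tau_0-\bar\partial\tau_{01}^{(1)}-\partial\tau_{01}^{(2)}$ for some $\tau\in\mathcal E_A^{p-1,q-1}(\mathcal U)$; * $Z_A^{p,q}(\mathcal U)$: $\bar\partial\partial\xi_0=\bar\partial\partial\xi_1=0$ and $\xi_1-\xi_0-\bar\partial\xi_{01}^{(1)}-\partial\xi_{01}^{(2)}=0$; * $B_A^{p,q}(\mathcal U)$: $\xi_i=\bar\partial\eta_i^{(1)}+\partial\eta_i^{(2)}$ $(i=0,1)$,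 $\xi_{01}^{(1)}=\eta_1^{(1)}-\eta_0^{(1)}-\partial\eta_{01}$, $\xi_{01}^{(2)}=\eta_1^{(2)}-\eta_0^{(2)}-\bar\partial\eta_{01}$ for some $\eta_i^{(1)}\in\mathcal E^{p,q-1}(U_i)$, $\eta_i^{(2)}\in\mathcal E^{p-1,q}(U_i)$, $\eta_{01}\in\mathcal E^{p-1,q-1}(U_{01})$. Let $H_{BC}^{p,q}(\mathcal U)=Z_{BC}^{p,q}(\mathcal U)/B_{BC}^{p,q}(\mathcal U)$ and $H_A^{p,q}(\mathcal U)=Z_A^{p,q}(\mathcal U)/B_A^{p,q}(\mathcal U)$. The relative groups for $(\mathcal U,U_0)$ are defined by setting the $U_0$-components of cochains equal to $0$: cochains are $(\sigma_1,\sigma_{01})\in\mathcal E^{p,q}(U_1)\oplus\mathcal E^{p-1,q-1}(U_{01})$, respectively $(\xi_1,\xi_{01}^{(1)},\xi_{01}^{(2)})\in\mathcal E^{p,q}(U_1)\oplus\mathcal E^{p,q-1}(U_{01})\oplus\mathcal E^{p-1,q}(U_{01})$, and * $Z_{BC}^{p,q}(\mathcal U,U_0)$: $d\sigma_1=0$,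 $\sigma_1=\bar\partial\partial\sigma_{01}$; * $B_{BC}^{p,q}(\mathcal U,U_0)$: $\sigma_1=\bar\partial\partial\tau_1$, $\sigma_{01}=\tau_1-\bar\partial\tau_{01}^{(1)}-\partial\tau_{01}^{(2)}$ for some $\tau_1\in\mathcal E^{p-1,q-1}(U_1)$, $\tau_{01}^{(1)}\in\mathcal E^{p-1,q-2}(U_{01})$, $\tau_{01}^{(2)}\in\mathcal E^{p-2,q-1}(U_{01})$; * $Z_A^{p,q}(\mathcal U,U_0)$: $\bar\partial\partial\xi_1=0$, $\xi_1=\bar\partial\xi_{01}^{(1)}+\partial\xi_{01}^{(2)}$; * $B_A^{p,q}(\mathcal U,U_0)$: $\xi_1=\bar\partial\eta_1^{(1)}+\partial\eta_1^{(2)}$, $\xi_{01}^{(1)}=\eta_1^{(1)}-\bar\partial\eta_{01}^{(11)}-\partial\eta_{01}^{(12)}$, $\xi_{01}^{(2)}=\eta_1^{(2)}-\bar\partial\eta_{01}^{(12)}-\partial\eta_{01}^{(22)}$ for some $\eta_1^{(1)}\in\mathcal E^{p,q-1}(U_1)$, $\eta_1^{(2)}\in\mathcal E^{p-1,q}(U_1)$,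 $\eta_{01}^{(11)}\in\mathcal E^{p,q-2}(U_{01})$, $\eta_{01}^{(12)}\in\mathcal E^{p-1,q-1}(U_{01})$, $\eta_{01}^{(22)}\in\mathcal E^{p-2,q}(U_{01})$. Let $H_{BC}^{p,q}(\mathcal U,U_0)=Z_{BC}^{p,q}(\mathcal U,U_0)/B_{BC}^{p,q}(\mathcal U,U_0)$ and $H_A^{p,q}(\mathcal U,U_0)=Z_A^{p,q}(\mathcal U,U_0)/B_A^{p,q}(\mathcal U,U_0)$. For a triple $\sigma$ of type $(p,q)$ and a quadruple $\xi$, define $\sigma\smallsmile\xi$ by $$(\sigma\smallsmile\xi)_i=\sigma_i\wedge\xi_i\quad(i=0,1),$$ $$(\sigma\smallsmile\xi)_{01}^{(1)}=(-1)^{p+q}\sigma_0\wedge\xi_{01}^{(1)}+\partial\sigma_{01}\wedge\xi_1-\tfrac12\partial(\sigma_{01}\wedge\xi_1),$$ $$(\sigma\smallsmile\xi)_{01}^{(2)}=(-1)^{p+q}\sigma_0\wedge\xi_{01}^{(2)}-\bar\partial\sigma_{01}\wedge\xi_1+\tfrac12\bar\partial(\sigma_{01}\wedge\xi_1),$$ and,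 for a relative cochain $\sigma=(\sigma_1,\sigma_{01})$ and a form $\xi$ on $U_1$, $$\sigma\smallsmile\xi=\bigl(\sigma_1\wedge\xi,\ \partial\sigma_{01}\wedge\xi-\tfrac12\partial(\sigma_{01}\wedge\xi),\ -\bar\partial\sigma_{01}\wedge\xi+\tfrac12\bar\partial(\sigma_{01}\wedge\xi)\bigr).$$ **Proposition.** 1. The cup product maps $\mathcal E_{BC}^{p,q}(\mathcal U)\times\mathcal E_A^{r,s}(\mathcal U)$ to $\mathcal E_A^{p+r,q+s}(\mathcal U)$, it maps $Z_{BC}^{p,q}(\mathcal U)\times Z_A^{r,s}(\mathcal U)$ to $Z_A^{p+r,q+s}(\mathcal U)$, and it maps both $B_{BC}^{p,q}(\mathcal U)\times Z_A^{r,s}(\mathcal U)$ and $Z_{BC}^{p,q}(\mathcal U)\times B_A^{r,s}(\mathcal U)$ to $B_A^{p+r,q+s}(\mathcal U)$. 2. Hence it induces a $\mathbb C$-bilinear map $H_{BC}^{p,q}(\mathcal U)\times H_A^{r,s}(\mathcal U)\to H_A^{p+r,q+s}(\mathcal U)$, $([\sigma],[\xi])\mapsto[\sigma\smallsmile\xi]$.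 The exterior product induces a $\mathbb C$-bilinear map $H_{BC}^{p,q}(M)\times H_A^{r,s}(M)\to H_A^{p+r,q+s}(M)$, and the two maps correspond to each other via the isomorphisms $H_{BC}^{p,q}(M)\simeq H_{BC}^{p,q}(\mathcal U)$, $[\omega]\mapsto[(\omega|_{U_0},\omega|_{U_1},0)]$, and $H_A^{a,b}(M)\simeq H_A^{a,b}(\mathcal U)$, $[\omega]\mapsto[(\omega|_{U_0},\omega|_{U_1},0,0)]$, for $(a,b)=(r,s)$ and $(a,b)=(p+r,q+s)$. 3. The relative cup product maps $\mathcal E_{BC}^{p,q}(\mathcal U,U_0)\times\mathcal E^{r,s}(U_1)$ to $\mathcal E_A^{p+r,q+s}(\mathcal U,U_0)$, it maps $Z_{BC}^{p,q}(\mathcal U,U_0)\times Z_A^{r,s}(U_1)$ to $Z_A^{p+r,q+s}(\mathcal U,U_0)$, and it maps both $B_{BC}^{p,q}(\mathcal U,U_0)\times Z_A^{r,s}(U_1)$ and $Z_{BC}^{p,q}(\mathcal U,U_0)\times B_A^{r,s}(U_1)$ to $B_A^{p+r,q+s}(\mathcal U,U_0)$. Hence it induces a $\mathbb C$-bilinear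 map $H_{BC}^{p,q}(\mathcal U,U_0)\times H_A^{r,s}(U_1)\to H_A^{p+r,q+s}(\mathcal U,U_0)$, $([\sigma],[\xi])\mapsto[\sigma\smallsmile\xi]$. -/

import Mathlib

open scoped Manifold ContDiff Topology
open TopologicalSpace
noncomputable section
namespace CechBottChern

section Fibre
variable {E : Type*} [NormedAddCommGroup E] [NormedSpace ℂ E]

/-- The exterior product `α ∧ β` of alternating maps with values in `ℂ`: the sum of
`sign σ · α(v_{σ(1)}, …, v_{σ(i)}) · β(v_{σ(i+1)}, …, v_{σ(i+j)})` over the `(i, j)`-shuffles `σ`. -/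
def wedgeAlg {i j k : ℕ} (h : i + j = k) (α : E [⋀^Fin i]→L[ℝ] ℂ) (β : E [⋀^Fin j]→L[ℝ] ℂ) :
    E [⋀^Fin k]→ₗ[ℝ] ℂ :=
  ((LinearMap.mul' ℝ ℂ).compAlternatingMap
    (α.toAlternatingMap.domCoprod β.toAlternatingMap)).domDomCongr
      (finSumFinEquiv.trans (finCongr h))

theorem norm_summand_le {i j : ℕ} (α : E [⋀^Fin i]→L[ℝ] ℂ) (β : E [⋀^Fin j]→L[ℝ] ℂ)
    (σ : Equiv.Perm.ModSumCongr (Fin i) (Fin j)) (v : Fin i ⊕ Fin j → E) :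
    ‖LinearMap.mul' ℝ ℂ (AlternatingMap.domCoprod.summand α.toAlternatingMap β.toAlternatingMap σ v)‖
      ≤ ‖α‖ * ‖β‖ * ∏ l, ‖v l‖ := by
  induction σ using Quotient.inductionOn' with | _ σ
  rw [AlternatingMap.domCoprod.summand_mk'']
  have key : ‖α (fun a => v (σ (Sum.inl a))) * β (fun b => v (σ (Sum.inr b)))‖
      ≤ ‖α‖ * ‖β‖ * ∏ l, ‖v l‖ := by
    rw [norm_mul, ← Equiv.prod_comp σ (fun l => ‖v l‖), Fintype.prod_sum_type]
    calc _ ≤ (‖α‖ * ∏ a, ‖v (σ (Sum.inl a))‖) * (‖β‖ * ∏ b, ‖v (σ (Sum.inr b))‖) :=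
          mul_le_mul (α.le_opNorm _) (β.le_opNorm _) (norm_nonneg _) (by positivity)
      _ = _ := by ring
  rcases Int.units_eq_one_or (Equiv.Perm.sign σ) with h | h <;>
    simpa [h, MultilinearMap.domCoprod_apply] using key

theorem wedgeAlg_bound {i j k : ℕ} (h : i + j = k) (α : E [⋀^Fin i]→L[ℝ] ℂ)
    (β : E [⋀^Fin j]→L[ℝ] ℂ) (v : Fin k → E) :
    ‖wedgeAlg h α β v‖ ≤
      (Fintype.card (Equiv.Perm.ModSumCongr (Fin i) (Fin j)) * (‖α‖ * ‖β‖)) * ∏ l, ‖v l‖ := by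
  subst h
  have : wedgeAlg rfl α β v = ∑ σ : Equiv.Perm.ModSumCongr (Fin i) (Fin j),
      LinearMap.mul' ℝ ℂ (AlternatingMap.domCoprod.summand α.toAlternatingMap β.toAlternatingMap σ
        (fun l => v (finSumFinEquiv l))) := by
    simp [wedgeAlg, AlternatingMap.domCoprod_apply, Function.comp_def]
  rw [this, ← Equiv.prod_comp finSumFinEquiv (fun l => ‖v l‖)]
  refine (norm_sum_le _ _).trans ((Finset.sum_le_sum fun σ _ => norm_summand_le α β σ _).trans ?_)
  simp [mul_assoc]

/-- `wedgeAlg` as a continuous alternating map. -/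
def wedgeAlt {i j k : ℕ} (h : i + j = k) (α : E [⋀^Fin i]→L[ℝ] ℂ) (β : E [⋀^Fin j]→L[ℝ] ℂ) :
    E [⋀^Fin k]→L[ℝ] ℂ :=
  (wedgeAlg h α β).mkContinuous _ (wedgeAlg_bound h α β)

theorem wedgeAlt_apply {i j k : ℕ} (h : i + j = k) (α : E [⋀^Fin i]→L[ℝ] ℂ)
    (β : E [⋀^Fin j]→L[ℝ] ℂ) (v : Fin k → E) : wedgeAlt h α β v =
      LinearMap.mul' ℝ ℂ (α.toAlternatingMap.domCoprod β.toAlternatingMap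
        fun l => v (finCongr h (finSumFinEquiv l))) := rfl

theorem domCoprod_apply' {i j : ℕ} (α : E [⋀^Fin i]→L[ℝ] ℂ)
    (β : E [⋀^Fin j]→L[ℝ] ℂ) (v : Fin i ⊕ Fin j → E) :
    α.toAlternatingMap.domCoprod β.toAlternatingMap v =
      ∑ σ : Equiv.Perm.ModSumCongr (Fin i) (Fin j),
      (AlternatingMap.domCoprod.summand α.toAlternatingMap β.toAlternatingMap σ v) := by
  simp [AlternatingMap.domCoprod_apply]

theorem wedgeAlt_comp {i j k : ℕ} (h : i + j = k) (α : E [⋀^Fin i]→L[ℝ] ℂ)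
    (β : E [⋀^Fin j]→L[ℝ] ℂ) (L : E →L[ℝ] E) :
    (wedgeAlt h α β).compContinuousLinearMap L =
      wedgeAlt h (α.compContinuousLinearMap L) (β.compContinuousLinearMap L) := by
  ext v
  simp only [ContinuousAlternatingMap.compContinuousLinearMap_apply, wedgeAlt_apply,
    domCoprod_apply']
  congr 1
  refine Finset.sum_congr rfl fun σ _ => ?_
  induction σ using Quotient.inductionOn' with | _ σ
  simp [AlternatingMap.domCoprod.summand_mk'', MultilinearMap.domCoprod_apply, Function.comp_def]


theorem wedgeAlt_eq_sum {i j k : ℕ} (h : i + j = k) (α : E [⋀^Fin i]→L[ℝ] ℂ)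
    (β : E [⋀^Fin j]→L[ℝ] ℂ) (v : Fin k → E) : wedgeAlt h α β v =
      ∑ σ : Equiv.Perm.ModSumCongr (Fin i) (Fin j), LinearMap.mul' ℝ ℂ
        (AlternatingMap.domCoprod.summand α.toAlternatingMap β.toAlternatingMap σ
          fun l => v (finCongr h (finSumFinEquiv l))) := by
  rw [wedgeAlt_apply, domCoprod_apply', map_sum]

theorem wedgeAlt_add_left {i j k : ℕ} (h : i + j = k) (α α' : E [⋀^Fin i]→L[ℝ] ℂ)
    (β : E [⋀^Fin j]→L[ℝ] ℂ) :
    wedgeAlt h (α + α') β = wedgeAlt h α β + wedgeAlt h α' β := by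
  ext v
  simp only [ContinuousAlternatingMap.add_apply, wedgeAlt_eq_sum, ← Finset.sum_add_distrib]
  refine Finset.sum_congr rfl fun σ _ => ?_
  induction σ using Quotient.inductionOn' with | _ σ
  simp [AlternatingMap.domCoprod.summand_mk'', MultilinearMap.domCoprod_apply, add_mul]

theorem wedgeAlt_add_right {i j k : ℕ} (h : i + j = k) (α : E [⋀^Fin i]→L[ℝ] ℂ)
    (β β' : E [⋀^Fin j]→L[ℝ] ℂ) :
    wedgeAlt h α (β + β') = wedgeAlt h α β + wedgeAlt h α β' := by
  ext v
  simp only [ContinuousAlternatingMap.add_apply, wedgeAlt_eq_sum, ← Finset.sum_add_distrib]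
  refine Finset.sum_congr rfl fun σ _ => ?_
  induction σ using Quotient.inductionOn' with | _ σ
  simp [AlternatingMap.domCoprod.summand_mk'', MultilinearMap.domCoprod_apply, mul_add]

theorem wedgeAlt_smul_left {i j k : ℕ} (h : i + j = k) (c : ℂ) (α : E [⋀^Fin i]→L[ℝ] ℂ)
    (β : E [⋀^Fin j]→L[ℝ] ℂ) : wedgeAlt h (c • α) β = c • wedgeAlt h α β := by
  ext v
  simp only [ContinuousAlternatingMap.smul_apply, wedgeAlt_eq_sum, Finset.smul_sum]
  refine Finset.sum_congr rfl fun σ _ => ?_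
  induction σ using Quotient.inductionOn' with | _ σ
  simp only [AlternatingMap.domCoprod.summand_mk'']
  rcases Int.units_eq_one_or (Equiv.Perm.sign σ) with h | h <;>
    simp [h, MultilinearMap.domCoprod_apply, mul_assoc]

theorem wedgeAlt_smul_right {i j k : ℕ} (h : i + j = k) (c : ℂ) (α : E [⋀^Fin i]→L[ℝ] ℂ)
    (β : E [⋀^Fin j]→L[ℝ] ℂ) : wedgeAlt h α (c • β) = c • wedgeAlt h α β := by
  ext v
  simp only [ContinuousAlternatingMap.smul_apply, wedgeAlt_eq_sum, Finset.smul_sum]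
  refine Finset.sum_congr rfl fun σ _ => ?_
  induction σ using Quotient.inductionOn' with | _ σ
  simp only [AlternatingMap.domCoprod.summand_mk'']
  rcases Int.units_eq_one_or (Equiv.Perm.sign σ) with h | h <;>
    simp [h, MultilinearMap.domCoprod_apply, mul_left_comm]

theorem isBoundedBilinearMap_wedgeAlt {i j k : ℕ} (h : i + j = k) :
    IsBoundedBilinearMap ℝ (fun p : (E [⋀^Fin i]→L[ℝ] ℂ) × (E [⋀^Fin j]→L[ℝ] ℂ) =>
      wedgeAlt h p.1 p.2) where
  add_left := wedgeAlt_add_left h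
  smul_left c α β := wedgeAlt_smul_left h (c : ℂ) α β
  add_right := wedgeAlt_add_right h
  smul_right c α β := wedgeAlt_smul_right h (c : ℂ) α β
  bound := by
    refine ⟨Fintype.card (Equiv.Perm.ModSumCongr (Fin i) (Fin j)) + 1, by positivity,
      fun α β => ?_⟩
    refine ContinuousAlternatingMap.opNorm_le_bound _ (by positivity) fun v => ?_
    refine (wedgeAlg_bound h α β v).trans ?_
    rw [← mul_assoc]
    gcongr
    linarith

variable (E) in
/-- Families `(α_k)_k` of complex-valued alternating `ℝ`-multilinear `k`-forms on `E`, i.e. values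
of inhomogeneous complex differential forms at a point. -/
abbrev Cov : Type _ := (k : ℕ) → E [⋀^Fin k]→L[ℝ] ℂ

/-- The exterior product, `(a ∧ b)_k = ∑_{i+j=k} a_i ∧ b_j`. -/
def Cov.wedge (a b : Cov E) : Cov E := fun k =>
  ∑ ij : Finset.HasAntidiagonal.antidiagonal k, wedgeAlt (Finset.HasAntidiagonal.mem_antidiagonal.1 ij.2) (a ij.1.1) (b ij.1.2)

theorem Cov.wedge_add_left (a a' b : Cov E) : (a + a').wedge b = a.wedge b + a'.wedge b := by
  funext k
  simp [Cov.wedge, wedgeAlt_add_left, Finset.sum_add_distrib]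

theorem Cov.wedge_add_right (a b b' : Cov E) : a.wedge (b + b') = a.wedge b + a.wedge b' := by
  funext k
  simp [Cov.wedge, wedgeAlt_add_right, Finset.sum_add_distrib]

theorem Cov.wedge_smul_left (c : ℂ) (a b : Cov E) : (c • a).wedge b = c • a.wedge b := by
  funext k
  simp [Cov.wedge, wedgeAlt_smul_left, Finset.smul_sum]

theorem Cov.wedge_smul_right (c : ℂ) (a b : Cov E) : a.wedge (c • b) = c • a.wedge b := by
  funext k
  simp [Cov.wedge, wedgeAlt_smul_right, Finset.smul_sum]

variable (E) in
/-- Multiplication by `c : ℂ`, as an `ℝ`-linear map. -/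
def smulCLM (c : ℂ) : E →L[ℝ] E := (c • ContinuousLinearMap.id ℂ E).restrictScalars ℝ
end Fibre

set_option linter.unusedSectionVars false

section Mfd
variable {E : Type*} [NormedAddCommGroup E] [NormedSpace ℂ E]
  {M : Type*} [TopologicalSpace M] [ChartedSpace E M] {U : Opens M}

/-- The coordinate expression in the chart at `x` of a form `α` on `U` (extended by `0` off `U`):
the pullback of `α` under the inverse of that chart. The value of `α` at `z` is a form on the
tangent space at `z`, which is identified with `E` through the preferred chart at `z`, as in
Mathlib's `TangentSpace`. -/
def localForm (α : U → Cov E) (x : M) (k : ℕ) (y : E) : E [⋀^Fin k]→L[ℝ] ℂ :=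
  (Function.extend Subtype.val α 0 ((chartAt E x).symm y) k).compContinuousLinearMap
    (fderiv ℝ (chartAt E ((chartAt E x).symm y) ∘ (chartAt E x).symm) y)

/-- The image in `E` of the part of `U` covered by the chart at `x`. -/
def chartDomain (U : Opens M) (x : M) : Set E :=
  (chartAt E x).target ∩ (chartAt E x).symm ⁻¹' U

/-- A form on `U` is smooth if its coordinate expressions are `C^∞` (in the real sense). -/
def IsSmoothForm (α : U → Cov E) : Prop :=
  ∀ (x : M) (k : ℕ), ContDiffOn ℝ ∞ (localForm α x k) (chartDomain U x)

theorem isOpen_chartDomain (x : M) : IsOpen (chartDomain (E := E) U x) :=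
  (chartAt E x).symm.isOpen_inter_preimage U.isOpen

theorem extend_apply (α : U → Cov E) (z : M) (hz : z ∈ U) :
    Function.extend Subtype.val α 0 z = α ⟨z, hz⟩ :=
  Subtype.val_injective.extend_apply α 0 ⟨z, hz⟩

theorem localForm_of_mem (α : U → Cov E) (x : M) (k : ℕ) {y : E} (hy : (chartAt E x).symm y ∈ U) :
    localForm α x k y = (α ⟨(chartAt E x).symm y, hy⟩ k).compContinuousLinearMap
    (fderiv ℝ (chartAt E ((chartAt E x).symm y) ∘ (chartAt E x).symm) y) := by
  rw [localForm, extend_apply _ _ hy]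

theorem localForm_add (α β : U → Cov E) (x : M) (k : ℕ) :
    Set.EqOn (localForm (α + β) x k) (localForm α x k + localForm β x k) (chartDomain U x) := by
  intro y hy
  simp only [Pi.add_apply, localForm_of_mem _ x k hy.2]
  ext v; simp

theorem localForm_smul (c : ℂ) (α : U → Cov E) (x : M) (k : ℕ) :
    Set.EqOn (localForm (c • α) x k) (c • localForm α x k) (chartDomain U x) := by
  intro y hy
  simp only [Pi.smul_apply, localForm_of_mem _ x k hy.2]
  ext v; simp

variable (E) in
/-- The smooth complex differential forms of all degrees on `U`. -/
def smoothForms (U : Opens M) : Submodule ℂ (U → Cov E) where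
  carrier := {α | IsSmoothForm α}
  add_mem' {α β} hα hβ x k := ((hα x k).add (hβ x k)).congr (localForm_add α β x k)
  zero_mem' x k := by
    refine (contDiffOn_const (c := (0 : E [⋀^Fin k]→L[ℝ] ℂ))).congr fun y hy => ?_
    rw [localForm_of_mem _ x k hy.2]; ext v; simp
  smul_mem' c α hα x k := ((hα x k).const_smul c).congr (localForm_smul c α x k)

variable (E) in
/-- The `ℂ`-vector space of smooth complex (inhomogeneous) differential forms on `U`. -/
def Forms (U : Opens M) : Type _ := smoothForms E U

instance : AddCommGroup (Forms E U) := inferInstanceAs (AddCommGroup (smoothForms E U))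

instance : Module ℂ (Forms E U) := inferInstanceAs (Module ℂ (smoothForms E U))

theorem contDiffAt_chart_change [IsManifold 𝓘(ℂ, E) ω M] (x z : M) {y : E}
    (hy : y ∈ (chartAt E x).target) (hz : (chartAt E x).symm y ∈ (chartAt E z).source) :
    ContDiffAt ℂ ω (chartAt E z ∘ (chartAt E x).symm) y := by
  have h := (contDiffGroupoid ω 𝓘(ℂ, E)).compatible
    (chart_mem_atlas E x) (chart_mem_atlas E z)
  rw [contDiffGroupoid, mem_groupoid_of_pregroupoid] at h
  have h1 := h.1
  simp only [contDiffPregroupoid, modelWithCornersSelf_coe, modelWithCornersSelf_coe_symm,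
    Function.comp_id, Function.id_comp, Set.range_id, Set.inter_univ, Set.preimage_id] at h1
  exact h1.contDiffAt (((chartAt E x).symm.trans (chartAt E z)).open_source.mem_nhds (by simp [hy, hz]))

theorem localForm_zero_comp (α : U → Cov E) (h : ∀ x, α x 0 = 0) (x : M) :
    Set.EqOn (localForm α x 0) 0 (chartDomain U x) := by
  intro y hy
  rw [localForm_of_mem _ x _ hy.2, h]; ext v; simp

theorem chart_mem_chartDomain (x : U) : chartAt E (x : M) x ∈ chartDomain (E := E) U (x : M) :=
  ⟨mem_chart_target E _, by
    change (chartAt E (x : M)).symm (chartAt E (x : M) x) ∈ U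
    rw [(chartAt E (x : M)).left_inv (mem_chart_source E _)]; exact x.2⟩

theorem IsSmoothForm.differentiableAt {α : U → Cov E} (hα : IsSmoothForm α) (x : M) (k : ℕ)
    {y : E} (hy : y ∈ chartDomain U x) : DifferentiableAt ℝ (localForm α x k) y :=
  ((hα x k).contDiffAt ((isOpen_chartDomain x).mem_nhds hy)).differentiableAt (by simp)

theorem IsSmoothForm.wedge {α β : U → Cov E} (hα : IsSmoothForm α) (hβ : IsSmoothForm β) :
    IsSmoothForm (fun x => (α x).wedge (β x)) := by
  intro x k
  have : Set.EqOn (localForm (fun x => (α x).wedge (β x)) x k)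
      (fun y => ∑ ij : Finset.HasAntidiagonal.antidiagonal k,
        wedgeAlt (Finset.HasAntidiagonal.mem_antidiagonal.1 ij.2) (localForm α x ij.1.1 y)
          (localForm β x ij.1.2 y)) (chartDomain U x) := by
    intro y hy
    simp only [localForm_of_mem _ x _ hy.2, ← wedgeAlt_comp]
    ext v
    simp [Cov.wedge]
  refine ContDiffOn.congr (ContDiffOn.sum fun ij _ => ?_) this
  exact (isBoundedBilinearMap_wedgeAlt _).contDiff.comp_contDiffOn ((hα x _).prodMk (hβ x _))

section Derivative
variable [IsManifold 𝓘(ℂ, E) ω M]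

theorem localForm_change (α : U → Cov E) (x z : M) (k : ℕ) {y : E} (hy : y ∈ chartDomain U x)
    (hz : (chartAt E x).symm y ∈ (chartAt E z).source) :
    localForm α x k y = (localForm α z k ((chartAt E z ∘ (chartAt E x).symm) y)
      ).compContinuousLinearMap (fderiv ℝ (chartAt E z ∘ (chartAt E x).symm) y) := by
  have e : (chartAt E z).symm ((chartAt E z ∘ (chartAt E x).symm) y) = (chartAt E x).symm y :=
    (chartAt E z).left_inv hz
  set w := (chartAt E x).symm y with hw
  have hT : DifferentiableAt ℝ (chartAt E z ∘ (chartAt E x).symm) y :=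
    ((contDiffAt_chart_change x z hy.1 hz).differentiableAt (by simp)).restrictScalars ℝ
  have hS : DifferentiableAt ℝ (chartAt E w ∘ (chartAt E z).symm)
      ((chartAt E z ∘ (chartAt E x).symm) y) :=
    ((contDiffAt_chart_change z w ((chartAt E z).map_source hz)
      (by change (chartAt E z).symm ((chartAt E z ∘ (chartAt E x).symm) y) ∈ _
          rw [e]; exact mem_chart_source E w)).differentiableAt (by simp)).restrictScalars ℝ
  have hc : fderiv ℝ (chartAt E w ∘ (chartAt E x).symm) y =
      (fderiv ℝ (chartAt E w ∘ (chartAt E z).symm) ((chartAt E z ∘ (chartAt E x).symm) y)).comp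
        (fderiv ℝ (chartAt E z ∘ (chartAt E x).symm) y) := by
    rw [← fderiv_comp y hS hT]
    refine Filter.EventuallyEq.fderiv_eq ?_
    have : ((chartAt E x).symm.trans (chartAt E z)).source ∈ 𝓝 y :=
      ((chartAt E x).symm.trans (chartAt E z)).open_source.mem_nhds (by simp [hy.1, hz, ← hw])
    filter_upwards [this] with y' hy'
    simp only [OpenPartialHomeomorph.trans_source, Set.mem_inter_iff, Set.mem_preimage] at hy'
    simp [(chartAt E z).left_inv hy'.2]
  simp only [localForm, ← hw, e, hc]
  rfl

/-- The exterior derivative, computed at `x` in the chart at `x` (by `localForm_dForm` the result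
does not depend on the chart). -/
def dForm (α : U → Cov E) : U → Cov E := fun x k =>
  match k with
  | 0 => 0
  | k + 1 => extDeriv (localForm α x k) (chartAt E (x : M) x)

theorem localForm_dForm {α : U → Cov E} (hα : IsSmoothForm α) (x : M) (k : ℕ) {y : E}
    (hy : y ∈ chartDomain U x) :
    localForm (dForm α) x (k + 1) y = extDeriv (localForm α x k) y := by
  rw [localForm_of_mem _ x _ hy.2]
  set w := (chartAt E x).symm y with hw
  have hwU : w ∈ U := hy.2
  have hT : ContDiffAt ℝ ω (chartAt E w ∘ (chartAt E x).symm) y :=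
    (contDiffAt_chart_change x w hy.1 (mem_chart_source E w)).restrict_scalars ℝ
  have hyw : (chartAt E w ∘ (chartAt E x).symm) y ∈ chartDomain U w := by
    refine ⟨mem_chart_target E w, ?_⟩
    change (chartAt E w).symm (chartAt E w w) ∈ U
    rwa [(chartAt E w).left_inv (mem_chart_source E w)]
  have hd : DifferentiableAt ℝ (localForm α w k) ((chartAt E w ∘ (chartAt E x).symm) y) :=
    ((hα w k).contDiffAt ((isOpen_chartDomain w).mem_nhds hyw)).differentiableAt (by simp)
  refine (extDeriv_pullback hd hT (by simp)).symm.trans ?_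
  refine Filter.EventuallyEq.extDeriv_eq ?_
  have : ((chartAt E x).symm.trans (chartAt E w)).source ∈ 𝓝 y :=
    ((chartAt E x).symm.trans (chartAt E w)).open_source.mem_nhds
      (by simp [hy.1, ← hw])
  filter_upwards [this, (isOpen_chartDomain x).mem_nhds hy] with y' hy' hyU
  simp only [OpenPartialHomeomorph.trans_source, Set.mem_inter_iff, Set.mem_preimage] at hy'
  exact (localForm_change α x w k hyU hy'.2).symm

theorem IsSmoothForm.extDerivative {α : U → Cov E} (hα : IsSmoothForm α) : IsSmoothForm (dForm α) := by
  rintro x (_ | k)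
  · exact contDiffOn_const.congr (localForm_zero_comp _ (fun _ => rfl) x)
  · have h1 : ContDiffOn ℝ ∞ (fderiv ℝ (localForm α x k)) (chartDomain U x) :=
      (hα x k).fderiv_of_isOpen (isOpen_chartDomain x) (by simp)
    have h2 : ContDiffOn ℝ ∞ (fun y => ContinuousAlternatingMap.alternatizeUncurryFinCLM ℝ E ℂ
        (fderiv ℝ (localForm α x k) y)) (chartDomain U x) :=
      ContDiff.comp_contDiffOn (g := fun L => ContinuousAlternatingMap.alternatizeUncurryFinCLM
        ℝ E ℂ L) (ContinuousLinearMap.contDiff _) h1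
    exact h2.congr fun y hy => localForm_dForm hα x k hy

/-- The exterior derivative `d` on smooth forms. -/
def d : Forms E U →ₗ[ℂ] Forms E U where
  toFun α := ⟨dForm α.1, α.2.extDerivative⟩
  map_add' α β := by
    refine Subtype.ext (funext fun x => funext fun k => ?_)
    rcases k with _ | k
    · exact (add_zero _).symm
    · have hx := chart_mem_chartDomain (E := E) x
      refine (Filter.EventuallyEq.extDeriv_eq (Filter.eventuallyEq_of_mem
        ((isOpen_chartDomain (x : M)).mem_nhds hx) (localForm_add α.1 β.1 x k))).trans ?_
      exact extDeriv_add (α.2.differentiableAt _ k hx) (β.2.differentiableAt _ k hx)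
  map_smul' c α := by
    refine Subtype.ext (funext fun x => funext fun k => ?_)
    rcases k with _ | k
    · exact (smul_zero (A := E [⋀^Fin 0]→L[ℝ] ℂ) c).symm
    · have hx := chart_mem_chartDomain (E := E) x
      refine (Filter.EventuallyEq.extDeriv_eq (Filter.eventuallyEq_of_mem
        ((isOpen_chartDomain (x : M)).mem_nhds hx) (localForm_smul c α.1 x k))).trans ?_
      rw [extDeriv, fderiv_const_smul (α.2.differentiableAt _ k hx)]
      exact ContinuousAlternatingMap.alternatizeUncurryFin_smul c _

/-- The form `(v₁, …, v_k) ↦ α(c v₁, …, c v_k)`. -/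
def rotForm (c : ℂ) (α : U → Cov E) : U → Cov E := fun x k =>
  (α x k).compContinuousLinearMap (smulCLM E c)

theorem localForm_rotForm (c : ℂ) (α : U → Cov E) (x : M) (k : ℕ) :
    Set.EqOn (localForm (rotForm c α) x k)
      (fun y => (localForm α x k y).compContinuousLinearMap (smulCLM E c)) (chartDomain U x) := by
  intro y hy
  have hT : DifferentiableAt ℂ (chartAt E ((chartAt E x).symm y) ∘ (chartAt E x).symm) y :=
    (contDiffAt_chart_change x _ hy.1 (mem_chart_source E _)).differentiableAt (by simp)
  simp only [localForm_of_mem _ x _ hy.2, hT.fderiv_restrictScalars ℝ]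
  ext v
  simp [rotForm, smulCLM, Function.comp_def]

theorem IsSmoothForm.rotForm (c : ℂ) {α : U → Cov E} (hα : IsSmoothForm α) :
    IsSmoothForm (rotForm c α) := by
  intro x k
  have h : ContDiffOn ℝ ∞ (fun y => ContinuousAlternatingMap.compContinuousLinearMapCLM
      (F := ℂ) (ι := Fin k) (smulCLM E c) (localForm α x k y)) (chartDomain U x) :=
    ContDiff.comp_contDiffOn (g := fun L => ContinuousAlternatingMap.compContinuousLinearMapCLM
      (F := ℂ) (ι := Fin k) (smulCLM E c) L) (ContinuousLinearMap.contDiff _) (hα x k)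
  exact h.congr (localForm_rotForm c α x k)

/-- `rotForm` on smooth forms. For `c = i` this is the operator that multiplies a form of type
`(p, q)` by `i ^ (p - q)`. -/
def rot (c : ℂ) : Forms E U →ₗ[ℂ] Forms E U where
  toFun α := ⟨rotForm c α.1, α.2.rotForm c⟩
  map_add' _ _ := rfl
  map_smul' _ _ := rfl

/-- `∂ = (d + i dᶜ) / 2`, where `dᶜ = C⁻¹ d C` and `C` is multiplication by `i ^ (p - q)` on forms
of type `(p, q)`. On forms of type `(p, q)` this is the component of type `(p + 1, q)` of `d`,
see `d_eq_del_add_delbar`, `del_mem`, `delbar_mem`. -/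
def del : Forms E U →ₗ[ℂ] Forms E U :=
  (1 / 2 : ℂ) • (d (E := E) (U := U) +
    Complex.I • (rot (-Complex.I) ∘ₗ d (E := E) (U := U) ∘ₗ rot Complex.I))

/-- `∂̄ = (d - i dᶜ) / 2`. On forms of type `(p, q)` this is the component of type `(p, q + 1)` of
`d`. -/
def delbar : Forms E U →ₗ[ℂ] Forms E U :=
  (1 / 2 : ℂ) • (d (E := E) (U := U) -
    Complex.I • (rot (-Complex.I) ∘ₗ d (E := E) (U := U) ∘ₗ rot Complex.I))

/-- The exterior product of smooth forms. -/
def wedge : Forms E U →ₗ[ℂ] Forms E U →ₗ[ℂ] Forms E U :=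
  LinearMap.mk₂ ℂ (fun α β => ⟨fun x => (α.1 x).wedge (β.1 x), α.2.wedge β.2⟩)
    (fun α α' β => Subtype.ext <| funext fun x => Cov.wedge_add_left (α.1 x) (α'.1 x) (β.1 x))
    (fun c α β => Subtype.ext <| funext fun x => Cov.wedge_smul_left c (α.1 x) (β.1 x))
    (fun α β β' => Subtype.ext <| funext fun x => Cov.wedge_add_right (α.1 x) (β.1 x) (β'.1 x))
    (fun c α β => Subtype.ext <| funext fun x => Cov.wedge_smul_right c (α.1 x) (β.1 x))

variable (E) in
/-- `𝓔^{p,q}(U)`: the smooth forms on `U` of type `(p, q)`, that is, those that satisfy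
`α(c v₁, …, c v_k) = c ^ p · c̄ ^ q · α(v₁, …, v_k)` for `c ∈ ℂ \ {0}`. (A sum of terms
`f dz_I ∧ dz̄_J` satisfies this if and only if only terms with `|I| = p` and `|J| = q` occur. So all
components in degrees other than `p + q` vanish, and `𝓔^{p,q}(U) = 0` if `p < 0` or `q < 0`.) -/
def formsOfType (p q : ℤ) (U : Opens M) : Submodule ℂ (Forms E U) where
  carrier := {α | ∀ (x : U) (k : ℕ) (c : ℂ), c ≠ 0 → ∀ v : Fin k → E,
    α.1 x k (fun i => c • v i) = c ^ p * (starRingEnd ℂ c) ^ q * α.1 x k v}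
  add_mem' {α β} hα hβ x k c hc v := by
    change α.1 x k _ + β.1 x k _ = _ * (α.1 x k v + β.1 x k v)
    rw [hα x k c hc v, hβ x k c hc v, mul_add]
  zero_mem' x k c hc v := by
    change (0 : ℂ) = _ * 0
    rw [mul_zero]
  smul_mem' a α hα x k c hc v := by
    change a * α.1 x k _ = _ * (a * α.1 x k v)
    rw [hα x k c hc v, mul_left_comm]

/-- The restriction of forms from `U` to `V ⊆ U`. -/
def res {V U : Opens M} (h : V ≤ U) : Forms E U →ₗ[ℂ] Forms E V where
  toFun α := ⟨fun x => α.1 ⟨x, h x.2⟩, fun y k => ((α.2 y k).mono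
    (fun _ hz => ⟨hz.1, h hz.2⟩)).congr fun z hz => by
      rw [localForm_of_mem _ y k hz.2, localForm_of_mem _ y k (h hz.2)]⟩
  map_add' _ _ := rfl
  map_smul' _ _ := rfl

theorem d_eq_del_add_delbar (α : Forms E U) : d α = del α + delbar α := by
  simp only [del, delbar, LinearMap.smul_apply, LinearMap.add_apply, LinearMap.sub_apply]
  module

/-- The character `c ↦ c ^ p · c̄ ^ q`. -/
def weight (p q : ℤ) (c : ℂ) : ℂ := c ^ p * (starRingEnd ℂ c) ^ q

theorem rotForm_of_mem {p q : ℤ} {α : Forms E U} (hα : α ∈ formsOfType E p q U) {c : ℂ}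
    (hc : c ≠ 0) : rotForm c α.1 = weight p q c • α.1 := by
  funext x k; ext v
  exact hα x k c hc v

theorem fderiv_of_mem {p q : ℤ} {α : Forms E U} (hα : α ∈ formsOfType E p q U) {c : ℂ}
    (hc : c ≠ 0) (x : U) (k : ℕ) (w : E) (v : Fin k → E) :
    fderiv ℝ (localForm α.1 (x : M) k) (chartAt E (x : M) x) w (fun i => c • v i) =
      weight p q c * fderiv ℝ (localForm α.1 (x : M) k) (chartAt E (x : M) x) w v := by
  have hx := chart_mem_chartDomain (E := E) x
  have hd := α.2.differentiableAt (x : M) k hx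
  have h1 : Set.EqOn (fun y => ContinuousAlternatingMap.compContinuousLinearMapCLM
      (F := ℂ) (ι := Fin k) (smulCLM E c) (localForm α.1 (x : M) k y))
      (weight p q c • localForm α.1 (x : M) k) (chartDomain U (x : M)) := by
    intro y hy
    rw [← localForm_smul _ _ _ _ hy, ← rotForm_of_mem hα hc]
    exact (localForm_rotForm c α.1 x k hy).symm
  have h2 := (Filter.eventuallyEq_of_mem
    ((isOpen_chartDomain (x : M)).mem_nhds hx) h1).fderiv_eq (𝕜 := ℝ)
  rw [fderiv_const_smul hd] at h2
  have h3 := (ContinuousAlternatingMap.compContinuousLinearMapCLM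
      (F := ℂ) (ι := Fin k) (smulCLM E c)).hasFDerivAt.comp _ hd.hasFDerivAt
  have h4 := h3.fderiv.symm.trans h2
  exact DFunLike.congr_fun (DFunLike.congr_fun h4 w) v

theorem dForm_apply (α : U → Cov E) (x : U) (k : ℕ) (v : Fin (k + 1) → E) :
    dForm α x (k + 1) v = ∑ i : Fin (k + 1), (-1 : ℂ) ^ (i : ℕ) *
      fderiv ℝ (localForm α (x : M) k) (chartAt E (x : M) x) (v i) (i.removeNth v) := by
  simp [dForm, extDeriv, ContinuousAlternatingMap.alternatizeUncurryFin_apply]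

theorem dolbeault_apply {p q : ℤ} {α : Forms E U} (hα : α ∈ formsOfType E p q U) (s : ℂ)
    (x : U) (k : ℕ) (v : Fin (k + 1) → E) :
    (d α).1 x (k + 1) v + s * Complex.I *
        (d (rot Complex.I α)).1 x (k + 1) (fun i => -Complex.I • v i) =
      ∑ i : Fin (k + 1), (-1 : ℂ) ^ (i : ℕ) *
      (fderiv ℝ (localForm α.1 (x : M) k) (chartAt E (x : M) x) (v i) (i.removeNth v) -
        s * Complex.I * fderiv ℝ (localForm α.1 (x : M) k) (chartAt E (x : M) x)
          (Complex.I • v i) (i.removeNth v)) := by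
  have hr : rot Complex.I α = weight p q Complex.I • α :=
    Subtype.ext (rotForm_of_mem hα Complex.I_ne_zero)
  have hw : weight p q Complex.I * weight p q (-Complex.I) = 1 := by
    simp only [weight, map_neg, Complex.conj_I, neg_neg]
    rw [show ∀ a b c d : ℂ, a * b * (c * d) = (a * c) * (b * d) by intros; ring,
      ← mul_zpow, ← mul_zpow]
    simp
  rw [hr, map_smul]
  change dForm α.1 x (k + 1) v + s * Complex.I *
    (weight p q Complex.I * dForm α.1 x (k + 1) (fun i => -Complex.I • v i)) = _
  rw [dForm_apply, dForm_apply, Finset.mul_sum, Finset.mul_sum, ← Finset.sum_add_distrib]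
  refine Finset.sum_congr rfl fun i _ => ?_
  have h := fderiv_of_mem hα (neg_ne_zero.2 Complex.I_ne_zero) x k (-Complex.I • v i)
    (i.removeNth v)
  change _ + s * Complex.I * (_ * (_ * fderiv ℝ (localForm α.1 (x : M) k) (chartAt E (x : M) x)
    (-Complex.I • v i) (fun j => -Complex.I • (i.removeNth v) j))) = _
  rw [h, neg_smul, map_neg, ContinuousAlternatingMap.neg_apply]
  linear_combination (-(-1 : ℂ) ^ (i : ℕ) * s * Complex.I * fderiv ℝ (localForm α.1 (x : M) k)
    (chartAt E (x : M) x) (Complex.I • v i) (i.removeNth v)) * hw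

theorem dolbeault_smul {p q : ℤ} {α : Forms E U} (hα : α ∈ formsOfType E p q U) {s : ℂ}
    (hs : s * s = 1) (x : U) (k : ℕ) {c : ℂ} (hc : c ≠ 0) (v : Fin (k + 1) → E) :
    (d α).1 x (k + 1) (fun i => c • v i) + s * Complex.I *
        (d (rot Complex.I α)).1 x (k + 1) (fun i => -Complex.I • c • v i) =
      weight p q c * (c.re + s * Complex.I * c.im) * ((d α).1 x (k + 1) v + s * Complex.I *
        (d (rot Complex.I α)).1 x (k + 1) (fun i => -Complex.I • v i)) := by
  rw [dolbeault_apply hα, dolbeault_apply hα, Finset.mul_sum]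
  refine Finset.sum_congr rfl fun i _ => ?_
  have e1 : c • v i = c.re • v i + c.im • (Complex.I • v i) := by
    conv_lhs => rw [← Complex.re_add_im c, add_smul, mul_smul]
    simp
  have e2 : Complex.I • c • v i = c.re • (Complex.I • v i) - c.im • v i := by
    rw [e1, smul_add, smul_comm Complex.I c.re, smul_comm Complex.I c.im, smul_smul,
      Complex.I_mul_I, neg_one_smul, smul_neg, sub_eq_add_neg]
  change _ * (fderiv ℝ (localForm α.1 (x : M) k) (chartAt E (x : M) x) (c • v i)
      (fun j => c • i.removeNth v j) - _ * fderiv ℝ (localForm α.1 (x : M) k)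
      (chartAt E (x : M) x) (Complex.I • c • v i) (fun j => c • i.removeNth v j)) = _
  rw [fderiv_of_mem hα hc, fderiv_of_mem hα hc, e2, e1]
  simp only [map_add, map_sub, map_smul, ContinuousAlternatingMap.add_apply,
    ContinuousAlternatingMap.sub_apply, ContinuousAlternatingMap.smul_apply, Complex.real_smul]
  set a := fderiv ℝ (localForm α.1 (x : M) k) (chartAt E (x : M) x) (v i) (i.removeNth v)
  set b := fderiv ℝ (localForm α.1 (x : M) k) (chartAt E (x : M) x) (Complex.I • v i)
    (i.removeNth v)
  linear_combination ((-1 : ℂ) ^ (i : ℕ) * weight p q c * c.im * b) *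
    (s * s * Complex.I_mul_I - hs)

theorem del_mem {p q : ℤ} {α : Forms E U} (hα : α ∈ formsOfType E p q U) :
    del α ∈ formsOfType E (p + 1) q U := by
  rintro x (_ | k) c hc v
  · have h : (del α).1 x 0 = 0 := by
      change (1 / 2 : ℂ) • ((0 : E [⋀^Fin 0]→L[ℝ] ℂ) + Complex.I •
        (0 : E [⋀^Fin 0]→L[ℝ] ℂ).compContinuousLinearMap (smulCLM E (-Complex.I))) = 0
      ext; simp
    simp [h]
  · have h := dolbeault_smul hα (s := 1) (by norm_num) x k hc v
    rw [one_mul, mul_comm Complex.I (c.im : ℂ), Complex.re_add_im] at h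
    change (1 / 2 : ℂ) * ((d α).1 x (k + 1) (fun i => c • v i) + Complex.I *
        (d (rot Complex.I α)).1 x (k + 1) (fun i => -Complex.I • c • v i)) =
      _ * ((1 / 2 : ℂ) * ((d α).1 x (k + 1) v + Complex.I *
        (d (rot Complex.I α)).1 x (k + 1) (fun i => -Complex.I • v i)))
    rw [h, weight, zpow_add_one₀ hc]
    ring

theorem delbar_mem {p q : ℤ} {α : Forms E U} (hα : α ∈ formsOfType E p q U) :
    delbar α ∈ formsOfType E p (q + 1) U := by
  rintro x (_ | k) c hc v
  · have h : (delbar α).1 x 0 = 0 := by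
      change (1 / 2 : ℂ) • ((0 : E [⋀^Fin 0]→L[ℝ] ℂ) - Complex.I •
        (0 : E [⋀^Fin 0]→L[ℝ] ℂ).compContinuousLinearMap (smulCLM E (-Complex.I))) = 0
      ext; simp
    simp [h]
  · have h := dolbeault_smul hα (s := -1) (by norm_num) x k hc v
    have hconj : (c.re + -1 * Complex.I * c.im : ℂ) = starRingEnd ℂ c := by
      apply Complex.ext <;> simp
    rw [hconj] at h
    change (1 / 2 : ℂ) * ((d α).1 x (k + 1) (fun i => c • v i) - Complex.I *
        (d (rot Complex.I α)).1 x (k + 1) (fun i => -Complex.I • c • v i)) =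
      _ * ((1 / 2 : ℂ) * ((d α).1 x (k + 1) v - Complex.I *
        (d (rot Complex.I α)).1 x (k + 1) (fun i => -Complex.I • v i)))
    rw [neg_one_mul, neg_mul, ← sub_eq_add_neg, neg_mul, ← sub_eq_add_neg] at h
    rw [h, weight, zpow_add_one₀ ((map_ne_zero _).2 hc)]
    ring
end Derivative

end Mfd

section Cohomology
variable {E : Type*} [NormedAddCommGroup E] [NormedSpace ℂ E]
  {M : Type*} [TopologicalSpace M] [ChartedSpace E M]
  [IsManifold 𝓘(ℂ, E) ω M]

variable (E) in
/-- `Z_BC^{p,q}(U)`: the forms `σ ∈ 𝓔^{p,q}(U)` with `dσ = 0`. -/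
def cocyclesBC (p q : ℤ) (U : Opens M) : Submodule ℂ (Forms E U) where
  carrier := {σ | σ ∈ formsOfType E p q U ∧ d σ = 0}
  add_mem' := by
    rintro σ σ' ⟨h, h1⟩ ⟨h', h1'⟩
    exact ⟨add_mem h h', by rw [map_add, h1, h1', add_zero]⟩
  zero_mem' := ⟨zero_mem _, map_zero _⟩
  smul_mem' := by
    rintro c σ ⟨h, h1⟩
    exact ⟨Submodule.smul_mem _ c h, by rw [map_smul, h1, smul_zero]⟩

variable (E) in
/-- `B_BC^{p,q}(U) = ∂̄∂ 𝓔^{p-1,q-1}(U)`. -/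
def coboundariesBC (p q : ℤ) (U : Opens M) : Submodule ℂ (Forms E U) where
  carrier := {σ | ∃ τ ∈ formsOfType E (p - 1) (q - 1) U, σ = delbar (del τ)}
  add_mem' := by
    rintro _ _ ⟨τ, h, rfl⟩ ⟨τ', h', rfl⟩
    exact ⟨τ + τ', add_mem h h', by rw [map_add, map_add]⟩
  zero_mem' := ⟨0, zero_mem _, by rw [map_zero, map_zero]⟩
  smul_mem' := by
    rintro c _ ⟨τ, h, rfl⟩
    exact ⟨c • τ, Submodule.smul_mem _ c h, by rw [map_smul, map_smul]⟩

variable (E) in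
/-- `Z_A^{p,q}(U)`: the forms `ξ ∈ 𝓔^{p,q}(U)` with `∂̄∂ξ = 0`. -/
def cocyclesA (p q : ℤ) (U : Opens M) : Submodule ℂ (Forms E U) where
  carrier := {ξ | ξ ∈ formsOfType E p q U ∧ delbar (del ξ) = 0}
  add_mem' := by
    rintro ξ ξ' ⟨h, h1⟩ ⟨h', h1'⟩
    exact ⟨add_mem h h', by rw [map_add, map_add, h1, h1', add_zero]⟩
  zero_mem' := ⟨zero_mem _, by rw [map_zero, map_zero]⟩
  smul_mem' := by
    rintro c ξ ⟨h, h1⟩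
    exact ⟨Submodule.smul_mem _ c h, by rw [map_smul, map_smul, h1, smul_zero]⟩

variable (E) in
/-- `B_A^{p,q}(U) = ∂̄ 𝓔^{p,q-1}(U) + ∂ 𝓔^{p-1,q}(U)`. -/
def coboundariesA (p q : ℤ) (U : Opens M) : Submodule ℂ (Forms E U) where
  carrier := {ξ | ∃ η₁ ∈ formsOfType E p (q - 1) U, ∃ η₂ ∈ formsOfType E (p - 1) q U,
    ξ = delbar η₁ + del η₂}
  add_mem' := by
    rintro _ _ ⟨η₁, h₁, η₂, h₂, rfl⟩ ⟨η₁', h₁', η₂', h₂', rfl⟩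
    exact ⟨η₁ + η₁', add_mem h₁ h₁', η₂ + η₂', add_mem h₂ h₂', by
      rw [map_add, map_add]; abel⟩
  zero_mem' := ⟨0, zero_mem _, 0, zero_mem _, by rw [map_zero, map_zero, add_zero]⟩
  smul_mem' := by
    rintro c _ ⟨η₁, h₁, η₂, h₂, rfl⟩
    exact ⟨c • η₁, Submodule.smul_mem _ c h₁, c • η₂, Submodule.smul_mem _ c h₂, by
      rw [map_smul, map_smul, smul_add]⟩

variable (E) in
/-- The Bott–Chern cohomology `H_BC^{p,q}(U)` of the complex manifold `U`. -/
abbrev HBC (p q : ℤ) (U : Opens M) : Type _ :=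
  cocyclesBC E p q U ⧸ (coboundariesBC E p q U).submoduleOf (cocyclesBC E p q U)

variable (E) in
/-- The Aeppli cohomology `H_A^{p,q}(U)` of the complex manifold `U`. -/
abbrev HA (p q : ℤ) (U : Opens M) : Type _ :=
  cocyclesA E p q U ⧸ (coboundariesA E p q U).submoduleOf (cocyclesA E p q U)

/-- The class of a cocycle in the quotient of a module of cocycles by coboundaries. -/
abbrev cls {C : Type*} [AddCommGroup C] [Module ℂ C] {Z B : Submodule ℂ C} (z : Z) :
    Z ⧸ B.submoduleOf Z :=
  Submodule.Quotient.mk z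

/-- The restriction of a form from `U₀` to `U₀₁ = U₀ ∩ U₁`. -/
abbrev res₀ {U₀ U₁ : Opens M} : Forms E U₀ →ₗ[ℂ] Forms E (U₀ ⊓ U₁) := res inf_le_left

/-- The restriction of a form from `U₁` to `U₀₁ = U₀ ∩ U₁`. -/
abbrev res₁ {U₀ U₁ : Opens M} : Forms E U₁ →ₗ[ℂ] Forms E (U₀ ⊓ U₁) := res inf_le_right

/-! ### Čech cochains of the pair `𝓤 = {U₀, U₁}` -/

variable (E) in
/-- Triples `σ = (σ₀, σ₁, σ₀₁)`. -/
abbrev Triple (U₀ U₁ : Opens M) : Type _ := Forms E U₀ × Forms E U₁ × Forms E (U₀ ⊓ U₁)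

variable (E) in
/-- Quadruples `ξ = (ξ₀, ξ₁, ξ₀₁⁽¹⁾, ξ₀₁⁽²⁾)`. -/
abbrev Quadruple (U₀ U₁ : Opens M) : Type _ :=
  Forms E U₀ × Forms E U₁ × Forms E (U₀ ⊓ U₁) × Forms E (U₀ ⊓ U₁)

variable (E) in
/-- The Čech–Bott–Chern cochains
`𝓔_BC^{p,q}(𝓤) = 𝓔^{p,q}(U₀) ⊕ 𝓔^{p,q}(U₁) ⊕ 𝓔^{p-1,q-1}(U₀₁)`. -/
def cochainsBC (p q : ℤ) (U₀ U₁ : Opens M) : Submodule ℂ (Triple E U₀ U₁) :=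
  (formsOfType E p q U₀).prod
    ((formsOfType E p q U₁).prod (formsOfType E (p - 1) (q - 1) (U₀ ⊓ U₁)))

variable (E) in
/-- The Čech–Aeppli cochains
`𝓔_A^{p,q}(𝓤) = 𝓔^{p,q}(U₀) ⊕ 𝓔^{p,q}(U₁) ⊕ 𝓔^{p,q-1}(U₀₁) ⊕ 𝓔^{p-1,q}(U₀₁)`. -/
def cochainsA (p q : ℤ) (U₀ U₁ : Opens M) : Submodule ℂ (Quadruple E U₀ U₁) :=
  (formsOfType E p q U₀).prod ((formsOfType E p q U₁).prod
    ((formsOfType E p (q - 1) (U₀ ⊓ U₁)).prod (formsOfType E (p - 1) q (U₀ ⊓ U₁))))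

variable (E) in
/-- `Z_BC^{p,q}(𝓤)`: `dσ₀ = dσ₁ = 0` and `σ₁ - σ₀ - ∂̄∂σ₀₁ = 0`. -/
def cechCocyclesBC (p q : ℤ) (U₀ U₁ : Opens M) : Submodule ℂ (Triple E U₀ U₁) where
  carrier := {σ | σ ∈ cochainsBC E p q U₀ U₁ ∧ d σ.1 = 0 ∧ d σ.2.1 = 0 ∧
    res₁ σ.2.1 - res₀ σ.1 - delbar (del σ.2.2) = 0}
  add_mem' := by
    rintro σ σ' ⟨h, h0, h1, h2⟩ ⟨h', h0', h1', h2'⟩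
    refine ⟨add_mem h h', by simp [h0, h0'], by simp [h1, h1'], ?_⟩
    simp only [Prod.fst_add, Prod.snd_add, map_add]
    refine Eq.trans ?_ ((congrArg₂ (· + ·) h2 h2').trans (add_zero 0))
    abel
  zero_mem' := ⟨zero_mem _, by simp, by simp, by simp⟩
  smul_mem' := by
    rintro c σ ⟨h, h0, h1, h2⟩
    refine ⟨Submodule.smul_mem _ c h, by simp [h0], by simp [h1], ?_⟩
    simp only [Prod.smul_fst, Prod.smul_snd, map_smul, ← smul_sub, h2, smul_zero]

variable (E) in
/-- `B_BC^{p,q}(𝓤)`: `σ₀ = ∂̄∂τ₀`, `σ₁ = ∂̄∂τ₁`, `σ₀₁ = τ₁ - τ₀ - ∂̄τ₀₁⁽¹⁾ - ∂τ₀₁⁽²⁾` for some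
`τ ∈ 𝓔_A^{p-1,q-1}(𝓤)`. -/
def cechCoboundariesBC (p q : ℤ) (U₀ U₁ : Opens M) : Submodule ℂ (Triple E U₀ U₁) where
  carrier := {σ | ∃ τ ∈ cochainsA E (p - 1) (q - 1) U₀ U₁,
    σ.1 = delbar (del τ.1) ∧ σ.2.1 = delbar (del τ.2.1) ∧
    σ.2.2 = res₁ τ.2.1 - res₀ τ.1 - delbar τ.2.2.1 - del τ.2.2.2}
  add_mem' := by
    rintro σ σ' ⟨τ, h, h0, h1, h2⟩ ⟨τ', h', h0', h1', h2'⟩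
    refine ⟨τ + τ', add_mem h h', by simp [h0, h0'], by simp [h1, h1'], ?_⟩
    simp only [Prod.fst_add, Prod.snd_add, map_add, h2, h2']
    abel
  zero_mem' := ⟨0, zero_mem _, by simp, by simp, by simp⟩
  smul_mem' := by
    rintro c σ ⟨τ, h, h0, h1, h2⟩
    refine ⟨c • τ, Submodule.smul_mem _ c h, by simp [h0], by simp [h1], ?_⟩
    simp only [Prod.smul_fst, Prod.smul_snd, map_smul, ← smul_sub, h2]

variable (E) in
/-- `Z_A^{p,q}(𝓤)`: `∂̄∂ξ₀ = ∂̄∂ξ₁ = 0` and `ξ₁ - ξ₀ - ∂̄ξ₀₁⁽¹⁾ - ∂ξ₀₁⁽²⁾ = 0`. -/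
def cechCocyclesA (p q : ℤ) (U₀ U₁ : Opens M) : Submodule ℂ (Quadruple E U₀ U₁) where
  carrier := {ξ | ξ ∈ cochainsA E p q U₀ U₁ ∧
    delbar (del ξ.1) = 0 ∧ delbar (del ξ.2.1) = 0 ∧
    res₁ ξ.2.1 - res₀ ξ.1 - delbar ξ.2.2.1 - del ξ.2.2.2 = 0}
  add_mem' := by
    rintro σ σ' ⟨h, h0, h1, h2⟩ ⟨h', h0', h1', h2'⟩
    refine ⟨add_mem h h', by simp [h0, h0'], by simp [h1, h1'], ?_⟩
    simp only [Prod.fst_add, Prod.snd_add, map_add]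
    refine Eq.trans ?_ ((congrArg₂ (· + ·) h2 h2').trans (add_zero 0))
    abel
  zero_mem' := ⟨zero_mem _, by simp, by simp, by simp⟩
  smul_mem' := by
    rintro c σ ⟨h, h0, h1, h2⟩
    refine ⟨Submodule.smul_mem _ c h, by simp [h0], by simp [h1], ?_⟩
    simp only [Prod.smul_fst, Prod.smul_snd, map_smul, ← smul_sub, h2, smul_zero]

variable (E) in
/-- `B_A^{p,q}(𝓤)`: `ξᵢ = ∂̄ηᵢ⁽¹⁾ + ∂ηᵢ⁽²⁾` for `i = 0, 1`, `ξ₀₁⁽¹⁾ = η₁⁽¹⁾ - η₀⁽¹⁾ - ∂η₀₁` and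
`ξ₀₁⁽²⁾ = η₁⁽²⁾ - η₀⁽²⁾ - ∂̄η₀₁`, with `ηᵢ⁽¹⁾ ∈ 𝓔^{p,q-1}(Uᵢ)`, `ηᵢ⁽²⁾ ∈ 𝓔^{p-1,q}(Uᵢ)` and
`η₀₁ ∈ 𝓔^{p-1,q-1}(U₀₁)`. -/
def cechCoboundariesA (p q : ℤ) (U₀ U₁ : Opens M) : Submodule ℂ (Quadruple E U₀ U₁) where
  carrier := {ξ | ∃ a₀ ∈ formsOfType E p (q - 1) U₀, ∃ b₀ ∈ formsOfType E (p - 1) q U₀,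
    ∃ a₁ ∈ formsOfType E p (q - 1) U₁, ∃ b₁ ∈ formsOfType E (p - 1) q U₁,
    ∃ η ∈ formsOfType E (p - 1) (q - 1) (U₀ ⊓ U₁),
      ξ.1 = delbar a₀ + del b₀ ∧ ξ.2.1 = delbar a₁ + del b₁ ∧
      ξ.2.2.1 = res₁ a₁ - res₀ a₀ - del η ∧ ξ.2.2.2 = res₁ b₁ - res₀ b₀ - delbar η}
  add_mem' := by
    rintro ξ ξ' ⟨a₀, h1, b₀, h2, a₁, h3, b₁, h4, η, h5, e1, e2, e3, e4⟩
      ⟨a₀', h1', b₀', h2', a₁', h3', b₁', h4', η', h5', e1', e2', e3', e4'⟩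
    refine ⟨a₀ + a₀', add_mem h1 h1', b₀ + b₀', add_mem h2 h2', a₁ + a₁', add_mem h3 h3',
      b₁ + b₁', add_mem h4 h4', η + η', add_mem h5 h5', ?_, ?_, ?_, ?_⟩ <;>
    · simp only [Prod.fst_add, Prod.snd_add, map_add, e1, e2, e3, e4, e1', e2', e3', e4']
      abel
  zero_mem' := ⟨0, zero_mem _, 0, zero_mem _, 0, zero_mem _, 0, zero_mem _, 0, zero_mem _,
    by simp, by simp, by simp, by simp⟩
  smul_mem' := by
    rintro c ξ ⟨a₀, h1, b₀, h2, a₁, h3, b₁, h4, η, h5, e1, e2, e3, e4⟩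
    refine ⟨c • a₀, Submodule.smul_mem _ c h1, c • b₀, Submodule.smul_mem _ c h2,
      c • a₁, Submodule.smul_mem _ c h3, c • b₁, Submodule.smul_mem _ c h4,
      c • η, Submodule.smul_mem _ c h5, ?_, ?_, ?_, ?_⟩ <;>
    simp only [Prod.smul_fst, Prod.smul_snd, map_smul, ← smul_sub, ← smul_add, e1, e2, e3, e4]

variable (E) in
/-- The Čech–Bott–Chern cohomology `H_BC^{p,q}(𝓤)`. -/
abbrev CechHBC (p q : ℤ) (U₀ U₁ : Opens M) : Type _ :=
  cechCocyclesBC E p q U₀ U₁ ⧸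
    (cechCoboundariesBC E p q U₀ U₁).submoduleOf (cechCocyclesBC E p q U₀ U₁)

variable (E) in
/-- The Čech–Aeppli cohomology `H_A^{p,q}(𝓤)`. -/
abbrev CechHA (p q : ℤ) (U₀ U₁ : Opens M) : Type _ :=
  cechCocyclesA E p q U₀ U₁ ⧸
    (cechCoboundariesA E p q U₀ U₁).submoduleOf (cechCocyclesA E p q U₀ U₁)

/-- The cup product `σ ⌣ ξ` of a triple `σ`, of type `(p, q)`, and a quadruple `ξ`. -/
def cup (p q : ℤ) {U₀ U₁ : Opens M} (σ : Triple E U₀ U₁) (ξ : Quadruple E U₀ U₁) :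
    Quadruple E U₀ U₁ :=
  ⟨wedge σ.1 ξ.1,
   wedge σ.2.1 ξ.2.1,
   (-1 : ℂ) ^ (p + q) • wedge (res₀ σ.1) ξ.2.2.1 + wedge (del σ.2.2) (res₁ ξ.2.1) -
     (1 / 2 : ℂ) • del (wedge σ.2.2 (res₁ ξ.2.1)),
   (-1 : ℂ) ^ (p + q) • wedge (res₀ σ.1) ξ.2.2.2 - wedge (delbar σ.2.2) (res₁ ξ.2.1) +
     (1 / 2 : ℂ) • delbar (wedge σ.2.2 (res₁ ξ.2.1))⟩

/-! ### Relative cochains of the pair `(𝓤, U₀)` -/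

variable (E) in
/-- Pairs `σ = (σ₁, σ₀₁)`, standing for the triples `(0, σ₁, σ₀₁)`. -/
abbrev RelPair (U₀ U₁ : Opens M) : Type _ := Forms E U₁ × Forms E (U₀ ⊓ U₁)

variable (E) in
/-- Triples `ξ = (ξ₁, ξ₀₁⁽¹⁾, ξ₀₁⁽²⁾)`, standing for the quadruples `(0, ξ₁, ξ₀₁⁽¹⁾, ξ₀₁⁽²⁾)`. -/
abbrev RelTriple (U₀ U₁ : Opens M) : Type _ :=
  Forms E U₁ × Forms E (U₀ ⊓ U₁) × Forms E (U₀ ⊓ U₁)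

variable (E) in
/-- `𝓔_BC^{p,q}(𝓤, U₀) = 𝓔^{p,q}(U₁) ⊕ 𝓔^{p-1,q-1}(U₀₁)`. -/
def relCochainsBC (p q : ℤ) (U₀ U₁ : Opens M) : Submodule ℂ (RelPair E U₀ U₁) :=
  (formsOfType E p q U₁).prod (formsOfType E (p - 1) (q - 1) (U₀ ⊓ U₁))

variable (E) in
/-- `𝓔_A^{p,q}(𝓤, U₀) = 𝓔^{p,q}(U₁) ⊕ 𝓔^{p,q-1}(U₀₁) ⊕ 𝓔^{p-1,q}(U₀₁)`. -/
def relCochainsA (p q : ℤ) (U₀ U₁ : Opens M) : Submodule ℂ (RelTriple E U₀ U₁) :=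
  (formsOfType E p q U₁).prod
    ((formsOfType E p (q - 1) (U₀ ⊓ U₁)).prod (formsOfType E (p - 1) q (U₀ ⊓ U₁)))

variable (E) in
/-- `Z_BC^{p,q}(𝓤, U₀)`: `dσ₁ = 0` and `σ₁ - ∂̄∂σ₀₁ = 0`. -/
def relCocyclesBC (p q : ℤ) (U₀ U₁ : Opens M) : Submodule ℂ (RelPair E U₀ U₁) where
  carrier := {σ | σ ∈ relCochainsBC E p q U₀ U₁ ∧ d σ.1 = 0 ∧
    res₁ σ.1 - delbar (del σ.2) = 0}
  add_mem' := by
    rintro σ σ' ⟨h, h1, h2⟩ ⟨h', h1', h2'⟩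
    refine ⟨add_mem h h', by simp [h1, h1'], ?_⟩
    simp only [Prod.fst_add, Prod.snd_add, map_add]
    refine Eq.trans ?_ ((congrArg₂ (· + ·) h2 h2').trans (add_zero 0))
    abel
  zero_mem' := ⟨zero_mem _, by simp, by simp⟩
  smul_mem' := by
    rintro c σ ⟨h, h1, h2⟩
    refine ⟨Submodule.smul_mem _ c h, by simp [h1], ?_⟩
    simp only [Prod.smul_fst, Prod.smul_snd, map_smul, ← smul_sub, h2, smul_zero]

variable (E) in
/-- `B_BC^{p,q}(𝓤, U₀)`: `σ₁ = ∂̄∂τ₁`, `σ₀₁ = τ₁ - ∂̄τ₀₁⁽¹⁾ - ∂τ₀₁⁽²⁾` for some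
`τ ∈ 𝓔_A^{p-1,q-1}(𝓤, U₀)`. -/
def relCoboundariesBC (p q : ℤ) (U₀ U₁ : Opens M) : Submodule ℂ (RelPair E U₀ U₁) where
  carrier := {σ | ∃ τ ∈ relCochainsA E (p - 1) (q - 1) U₀ U₁,
    σ.1 = delbar (del τ.1) ∧ σ.2 = res₁ τ.1 - delbar τ.2.1 - del τ.2.2}
  add_mem' := by
    rintro σ σ' ⟨τ, h, h1, h2⟩ ⟨τ', h', h1', h2'⟩
    refine ⟨τ + τ', add_mem h h', by simp [h1, h1'], ?_⟩
    simp only [Prod.fst_add, Prod.snd_add, map_add, h2, h2']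
    abel
  zero_mem' := ⟨0, zero_mem _, by simp, by simp⟩
  smul_mem' := by
    rintro c σ ⟨τ, h, h1, h2⟩
    refine ⟨c • τ, Submodule.smul_mem _ c h, by simp [h1], ?_⟩
    simp only [Prod.smul_fst, Prod.smul_snd, map_smul, ← smul_sub, h2]

variable (E) in
/-- `Z_A^{p,q}(𝓤, U₀)`: `∂̄∂ξ₁ = 0` and `ξ₁ - ∂̄ξ₀₁⁽¹⁾ - ∂ξ₀₁⁽²⁾ = 0`. -/
def relCocyclesA (p q : ℤ) (U₀ U₁ : Opens M) : Submodule ℂ (RelTriple E U₀ U₁) where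
  carrier := {ξ | ξ ∈ relCochainsA E p q U₀ U₁ ∧ delbar (del ξ.1) = 0 ∧
    res₁ ξ.1 - delbar ξ.2.1 - del ξ.2.2 = 0}
  add_mem' := by
    rintro σ σ' ⟨h, h1, h2⟩ ⟨h', h1', h2'⟩
    refine ⟨add_mem h h', by simp [h1, h1'], ?_⟩
    simp only [Prod.fst_add, Prod.snd_add, map_add]
    refine Eq.trans ?_ ((congrArg₂ (· + ·) h2 h2').trans (add_zero 0))
    abel
  zero_mem' := ⟨zero_mem _, by simp, by simp⟩
  smul_mem' := by
    rintro c σ ⟨h, h1, h2⟩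
    refine ⟨Submodule.smul_mem _ c h, by simp [h1], ?_⟩
    simp only [Prod.smul_fst, Prod.smul_snd, map_smul, ← smul_sub, h2, smul_zero]

variable (E) in
/-- `B_A^{p,q}(𝓤, U₀)`: `ξ₁ = ∂̄η₁⁽¹⁾ + ∂η₁⁽²⁾`, `ξ₀₁⁽¹⁾ = η₁⁽¹⁾ - ∂̄η₀₁⁽¹¹⁾ - ∂η₀₁⁽¹²⁾` and
`ξ₀₁⁽²⁾ = η₁⁽²⁾ - ∂̄η₀₁⁽²¹⁾ - ∂η₀₁⁽²²⁾`, with `η₁⁽¹⁾ ∈ 𝓔^{p,q-1}(U₁)`, `η₁⁽²⁾ ∈ 𝓔^{p-1,q}(U₁)`,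
`η₀₁⁽¹¹⁾ ∈ 𝓔^{p,q-2}(U₀₁)`, `η₀₁⁽¹²⁾ = η₀₁⁽²¹⁾ ∈ 𝓔^{p-1,q-1}(U₀₁)` and
`η₀₁⁽²²⁾ ∈ 𝓔^{p-2,q}(U₀₁)`. -/
def relCoboundariesA (p q : ℤ) (U₀ U₁ : Opens M) : Submodule ℂ (RelTriple E U₀ U₁) where
  carrier := {ξ | ∃ a ∈ formsOfType E p (q - 1) U₁, ∃ b ∈ formsOfType E (p - 1) q U₁,
    ∃ η₁₁ ∈ formsOfType E p (q - 2) (U₀ ⊓ U₁),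
    ∃ η₁₂ ∈ formsOfType E (p - 1) (q - 1) (U₀ ⊓ U₁),
    ∃ η₂₂ ∈ formsOfType E (p - 2) q (U₀ ⊓ U₁),
      ξ.1 = delbar a + del b ∧
      ξ.2.1 = res₁ a - delbar η₁₁ - del η₁₂ ∧ ξ.2.2 = res₁ b - delbar η₁₂ - del η₂₂}
  add_mem' := by
    rintro ξ ξ' ⟨a, h1, b, h2, u, h3, v, h4, w, h5, e1, e2, e3⟩
      ⟨a', h1', b', h2', u', h3', v', h4', w', h5', e1', e2', e3'⟩
    refine ⟨a + a', add_mem h1 h1', b + b', add_mem h2 h2', u + u', add_mem h3 h3',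
      v + v', add_mem h4 h4', w + w', add_mem h5 h5', ?_, ?_, ?_⟩ <;>
    · simp only [Prod.fst_add, Prod.snd_add, map_add, e1, e2, e3, e1', e2', e3']
      abel
  zero_mem' := ⟨0, zero_mem _, 0, zero_mem _, 0, zero_mem _, 0, zero_mem _, 0, zero_mem _,
    by simp, by simp, by simp⟩
  smul_mem' := by
    rintro c ξ ⟨a, h1, b, h2, u, h3, v, h4, w, h5, e1, e2, e3⟩
    refine ⟨c • a, Submodule.smul_mem _ c h1, c • b, Submodule.smul_mem _ c h2,
      c • u, Submodule.smul_mem _ c h3, c • v, Submodule.smul_mem _ c h4,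
      c • w, Submodule.smul_mem _ c h5, ?_, ?_, ?_⟩ <;>
    simp only [Prod.smul_fst, Prod.smul_snd, map_smul, ← smul_sub, ← smul_add, e1, e2, e3]

variable (E) in
/-- The relative Bott–Chern cohomology `H_BC^{p,q}(𝓤, U₀)`. -/
abbrev RelHBC (p q : ℤ) (U₀ U₁ : Opens M) : Type _ :=
  relCocyclesBC E p q U₀ U₁ ⧸
    (relCoboundariesBC E p q U₀ U₁).submoduleOf (relCocyclesBC E p q U₀ U₁)

variable (E) in
/-- The relative Aeppli cohomology `H_A^{p,q}(𝓤, U₀)`. -/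
abbrev RelHA (p q : ℤ) (U₀ U₁ : Opens M) : Type _ :=
  relCocyclesA E p q U₀ U₁ ⧸
    (relCoboundariesA E p q U₀ U₁).submoduleOf (relCocyclesA E p q U₀ U₁)

/-- The relative cup product of `(0, σ₁, σ₀₁)` and a form `ξ₁` on `U₁`. -/
def relCup {U₀ U₁ : Opens M} (σ : RelPair E U₀ U₁) (ξ : Forms E U₁) : RelTriple E U₀ U₁ :=
  ⟨wedge σ.1 ξ,
   wedge (del σ.2) (res₁ ξ) - (1 / 2 : ℂ) • del (wedge σ.2 (res₁ ξ)),
   -wedge (delbar σ.2) (res₁ ξ) + (1 / 2 : ℂ) • delbar (wedge σ.2 (res₁ ξ))⟩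

end Cohomology
end CechBottChern
end
open CechBottChern

noncomputable section
namespace CechBottChern

/-! ### The Leibniz rule for alternatization, in the fibre. -/

section FibreLeibniz

/-! Everything rests on the calculus of `∂` and `∂̄`. Both are combinations of `d` and `dᶜ = C⁻¹ d
C`, and `C` is multiplicative, so their Leibniz rules (`del_wedge`, `delbar_wedge`) reduce to the
one for `d`, which is an identity between alternating maps (`alternatizeUncurryFin_wedgeLeft`,
`alternatizeUncurryFin_wedgeRight`). The relations `∂² = ∂̄² = ∂∂̄ + ∂̄∂ = 0` hold because they are
the components of `d² = 0`, which have three different types (`del_delbar_relations`).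

The key identity is `delbar_del_wedge_eq`: if `∂̄∂ξ = 0`, then `∂̄∂τ ∧ ξ = ∂̄P + ∂Q` with `P = ∂τ ∧
ξ - ∂(τ ∧ ξ)/2` and `Q = -∂̄τ ∧ ξ + ∂̄(τ ∧ ξ)/2`. For `τ = σ₀₁` and `ξ = ξ₁` these are the terms of
the cup product that involve `σ₀₁`. For cocycles, `σ₁ ∧ ξ₁ - σ₀ ∧ ξ₀ = ∂̄∂σ₀₁ ∧ ξ₁ + σ₀ ∧ (ξ₁ - ξ₀)`
on the overlap; `P` and `Q` account for the first term, and closedness of `σ₀` lets `∂̄` and `∂` be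
pulled out of the second. So the product is a cocycle (`cup_cocycle`).

If `σ` is the coboundary of `τ`, the products on `Uᵢ` have the primitives `P(τᵢ, ξᵢ)`, `Q(τᵢ, ξᵢ)`;
if `ξ` is the coboundary of `η`, they have the primitives `± σᵢ ∧ ηᵢ`. In both cases the overlap
components are the differences of these primitives minus `∂̄u + ∂v` and `∂̄v + ∂w`, with the same
`v` (the four lemmas `cup_coboundaryBC_fst`, `cup_coboundaryBC_snd`, `cup_coboundaryA_fst`,
`cup_coboundaryA_snd`). Relative coboundaries allow such `u`, `v`, `w`. Čech coboundaries allow only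
`v`, but a partition of unity gives `u = u₁ - u₀` and `w = w₁ - w₀`, and subtracting `∂̄uᵢ` and
`∂wᵢ` from the primitives on `Uᵢ` leaves the forms on `Uᵢ` unchanged (`mem_cechCoboundariesA_of`).
The relative statements use the same identities with all `U₀`-parts equal to `0`.

The comparison isomorphisms come from the same splitting (`exists_split`) and from gluing: a cocycle
is changed by a coboundary until its overlap part vanishes, and then its components on `U₀` and `U₁`
agree. Cochains without overlap part are multiplied componentwise, so the two products correspond to
each other. -/

/-- Moving the `a`-th argument to the front is precomposition with the inverse of `Fin.cycleRange
a`, a cycle of sign `(-1) ^ a`; reindexing the sum by it absorbs the sign. Hence all terms of an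
alternatization contribute equally to a signed sum over permutations. -/
theorem sum_perm_cons_removeNth {E : Type*} {n : ℕ} (F : (Fin (n + 1) → E) → ℂ) (v : Fin (n + 1) → E)
    (a : Fin (n + 1)) :
    ∑ σ : Equiv.Perm (Fin (n + 1)), (Equiv.Perm.sign σ : ℂ) *
      ((-1) ^ (a : ℕ) * F (Fin.cons (v (σ a)) (a.removeNth (v ∘ σ)))) =
    ∑ σ : Equiv.Perm (Fin (n + 1)), (Equiv.Perm.sign σ : ℂ) * F (v ∘ σ) := by
  rw [← Equiv.sum_comp (Equiv.mulRight (Fin.cycleRange a)⁻¹)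
    (fun σ : Equiv.Perm (Fin (n + 1)) => (Equiv.Perm.sign σ : ℂ) * F (v ∘ σ))]
  refine Finset.sum_congr rfl fun σ _ => ?_
  have h : Fin.cons (v (σ a)) (a.removeNth (v ∘ σ)) = v ∘ ⇑(σ * (Fin.cycleRange a)⁻¹) := by
    have h1 := Fin.cons_comp_cycleRange (v (σ a)) (a.removeNth (v ∘ σ)) a
    have h2 : Fin.insertNth a (v (σ a)) (a.removeNth (v ∘ σ)) = v ∘ σ :=
      Fin.insertNth_self_removeNth a (v ∘ σ)
    rw [h2] at h1
    rw [Equiv.Perm.coe_mul, ← Function.comp_assoc, ← h1, Function.comp_assoc]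
    simp
  rw [h]
  simp [Fin.sign_cycleRange]
  ring

/-- A sum over permutations does not change when it is averaged over those fixing `0`. -/
theorem sum_perm_succ {E : Type*} {n : ℕ} (F : (Fin (n + 1) → E) → ℂ) (v : Fin (n + 1) → E) :
    ∑ σ : Equiv.Perm (Fin (n + 1)), (Equiv.Perm.sign σ : ℂ) *
      ∑ ρ : Equiv.Perm (Fin n), (Equiv.Perm.sign ρ : ℂ) *
        F (Fin.cons (v (σ 0)) fun b => v (σ (ρ b).succ)) =
    n.factorial * ∑ σ : Equiv.Perm (Fin (n + 1)), (Equiv.Perm.sign σ : ℂ) * F (v ∘ σ) := by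
  simp only [Finset.mul_sum]
  rw [Finset.sum_comm]
  trans ∑ ρ : Equiv.Perm (Fin n), ∑ σ : Equiv.Perm (Fin (n + 1)),
      (Equiv.Perm.sign σ : ℂ) * F (v ∘ σ)
  · refine Finset.sum_congr rfl fun ρ _ => ?_
    rw [← Equiv.sum_comp (Equiv.mulRight (Equiv.Perm.decomposeFin.symm (0, ρ)))
      (fun σ : Equiv.Perm (Fin (n + 1)) => (Equiv.Perm.sign σ : ℂ) * F (v ∘ σ))]
    refine Finset.sum_congr rfl fun σ _ => ?_
    have h : (Fin.cons (v (σ 0)) fun b => v (σ (ρ b).succ)) =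
        v ∘ ⇑(σ * Equiv.Perm.decomposeFin.symm (0, ρ)) := by
      funext b
      refine Fin.cases ?_ (fun b => ?_) b
      · simp
      · simp
    rw [h]
    simp
    ring
  · simp [Fintype.card_perm, Finset.mul_sum]

variable {E : Type*} [NormedAddCommGroup E] [NormedSpace ℂ E]

/-- Each class of shuffles contains `i! j!` permutations, all with the same contribution. Sums over
the whole symmetric group are easier to reindex than sums over shuffles, so the Leibniz rule is
proved after multiplication by these factorials, which are then cancelled. -/
theorem wedgeAlt_eq_sum_perm {i j k : ℕ} (h : i + j = k) (α : E [⋀^Fin i]→L[ℝ] ℂ)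
    (β : E [⋀^Fin j]→L[ℝ] ℂ) (v : Fin k → E) :
    ((i.factorial * j.factorial : ℕ) : ℂ) * wedgeAlt h α β v =
      ∑ σ : Equiv.Perm (Fin k), (Equiv.Perm.sign σ : ℂ) *
        (α (fun a => v (σ (Fin.cast h (Fin.castAdd j a)))) *
          β (fun b => v (σ (Fin.cast h (Fin.natAdd i b))))) := by
  subst h
  have h1 := DFunLike.congr_fun (MultilinearMap.domCoprod_alternization_eq
    α.toAlternatingMap β.toAlternatingMap) (fun l => v (finSumFinEquiv l))
  have h2 := congrArg (LinearMap.mul' ℝ ℂ) h1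
  rw [MultilinearMap.alternatization_apply, map_sum] at h2
  rw [wedgeAlt_apply]
  simp only [Fintype.card_fin, AlternatingMap.smul_apply, map_nsmul] at h2
  refine Eq.trans ?_ (h2.symm.trans ?_)
  · rw [nsmul_eq_mul]; rfl
  · rw [← Equiv.sum_comp (Equiv.permCongr (finSumFinEquiv (m := i) (n := j)))]
    refine Finset.sum_congr rfl fun σ _ => ?_
    rw [Equiv.Perm.sign_permCongr]
    rcases Int.units_eq_one_or (Equiv.Perm.sign σ) with h | h <;>
      simp [h, MultilinearMap.domCoprod_apply, Equiv.permCongr_apply]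

theorem factorial_mul_alternatizeUncurryFin {n : ℕ} (L : E →L[ℝ] E [⋀^Fin n]→L[ℝ] ℂ)
    (v : Fin (n + 1) → E) :
    (n.factorial : ℂ) * ContinuousAlternatingMap.alternatizeUncurryFin L v =
      ∑ σ : Equiv.Perm (Fin (n + 1)), (Equiv.Perm.sign σ : ℂ) *
        L (v (σ 0)) (fun b => v (σ b.succ)) := by
  -- The left side is alternating in `v`, so it equals its own signed average over all permutations.
  -- Afterwards each of the `n + 1` terms of the alternatization gives the same sum, and `n + 1`
  -- cancels.
  have h1 : ((n + 1).factorial : ℂ) * ContinuousAlternatingMap.alternatizeUncurryFin L v =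
      ∑ σ : Equiv.Perm (Fin (n + 1)), (Equiv.Perm.sign σ : ℂ) *
        ContinuousAlternatingMap.alternatizeUncurryFin L (v ∘ σ) := by
    have h : ∀ σ : Equiv.Perm (Fin (n + 1)), (Equiv.Perm.sign σ : ℂ) *
        ContinuousAlternatingMap.alternatizeUncurryFin L (v ∘ σ) =
        ContinuousAlternatingMap.alternatizeUncurryFin L v := fun σ => by
      have := (ContinuousAlternatingMap.alternatizeUncurryFin L).toAlternatingMap.map_perm v σ
      refine (congrArg _ this).trans ?_
      rcases Int.units_eq_one_or (Equiv.Perm.sign σ) with h | h <;> simp [h]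
    simp [h, Fintype.card_perm]
  have h2 : ((n + 1).factorial : ℂ) * ContinuousAlternatingMap.alternatizeUncurryFin L v =
      (n + 1 : ℕ) * ∑ σ : Equiv.Perm (Fin (n + 1)), (Equiv.Perm.sign σ : ℂ) *
        L (v (σ 0)) (fun b => v (σ b.succ)) := by
    rw [h1]
    simp only [ContinuousAlternatingMap.alternatizeUncurryFin_apply, Finset.mul_sum]
    rw [Finset.sum_comm]
    have := fun a => sum_perm_cons_removeNth
      (fun w => L (w 0) (fun b => w b.succ)) v a
    simp only [Fin.cons_zero, Fin.cons_succ, Function.comp_apply] at this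
    calc _ = ∑ a : Fin (n + 1), ∑ σ : Equiv.Perm (Fin (n + 1)), (Equiv.Perm.sign σ : ℂ) *
        L (v (σ 0)) (fun b => v (σ b.succ)) := by
          refine Finset.sum_congr rfl fun a _ => ?_
          rw [← this a]
          refine Finset.sum_congr rfl fun σ _ => ?_
          simp
      _ = _ := by simp [Finset.mul_sum]
  rw [Nat.factorial_succ, Nat.cast_mul, mul_assoc] at h2
  exact mul_left_cancel₀ (Nat.cast_ne_zero.2 n.succ_ne_zero) h2

/-- The form-valued linear map `w ↦ L w ∧ β`. -/
def wedgeLeftCLM {i j k : ℕ} (h : i + j = k) (L : E →L[ℝ] E [⋀^Fin i]→L[ℝ] ℂ)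
    (β : E [⋀^Fin j]→L[ℝ] ℂ) : E →L[ℝ] E [⋀^Fin k]→L[ℝ] ℂ :=
  ((isBoundedBilinearMap_wedgeAlt (E := E) h).toContinuousLinearMap.flip β).comp L

/-- The form-valued linear map `w ↦ α ∧ R w`. -/
def wedgeRightCLM {i j k : ℕ} (h : i + j = k) (α : E [⋀^Fin i]→L[ℝ] ℂ)
    (R : E →L[ℝ] E [⋀^Fin j]→L[ℝ] ℂ) : E →L[ℝ] E [⋀^Fin k]→L[ℝ] ℂ :=
  ((isBoundedBilinearMap_wedgeAlt (E := E) h).toContinuousLinearMap α).comp R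

/-- `L` and `R` are bare functions, so that either may be constant: this covers both halves of the
Leibniz rule. The inner sum over permutations of the `k` later arguments is absorbed by the outer
one at the cost of `k!`, which cancels. -/
theorem alternatizeUncurryFin_wedge_sum {i j k : ℕ} (h : i + j = k)
    (M : E →L[ℝ] E [⋀^Fin k]→L[ℝ] ℂ) (L : E → E [⋀^Fin i]→L[ℝ] ℂ)
    (R : E → E [⋀^Fin j]→L[ℝ] ℂ) (hM : ∀ w, M w = wedgeAlt h (L w) (R w)) (v : Fin (k + 1) → E) :
    ((i.factorial * j.factorial : ℕ) : ℂ) * ContinuousAlternatingMap.alternatizeUncurryFin M v =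
      ∑ σ : Equiv.Perm (Fin (k + 1)), (Equiv.Perm.sign σ : ℂ) *
        (L (v (σ 0)) (fun a => v (σ (Fin.cast h (Fin.castAdd j a)).succ)) *
          R (v (σ 0)) (fun b => v (σ (Fin.cast h (Fin.natAdd i b)).succ))) := by
  have h1 := sum_perm_succ (fun w : Fin (k + 1) → E =>
    L (w 0) (fun a => w (Fin.cast h (Fin.castAdd j a)).succ) *
      R (w 0) (fun b => w (Fin.cast h (Fin.natAdd i b)).succ)) v
  simp only [Fin.cons_zero, Fin.cons_succ, Function.comp_apply] at h1
  refine mul_left_cancel₀ (Nat.cast_ne_zero.2 k.factorial_ne_zero) (Eq.trans ?_ h1)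
  rw [mul_left_comm, factorial_mul_alternatizeUncurryFin, Finset.mul_sum]
  refine Finset.sum_congr rfl fun σ _ => ?_
  rw [hM, mul_left_comm, wedgeAlt_eq_sum_perm]

theorem alternatizeUncurryFin_wedgeLeft {i j k : ℕ} (h : i + j = k) (h' : i + 1 + j = k + 1)
    (L : E →L[ℝ] E [⋀^Fin i]→L[ℝ] ℂ) (β : E [⋀^Fin j]→L[ℝ] ℂ) :
    ContinuousAlternatingMap.alternatizeUncurryFin (wedgeLeftCLM h L β) =
      wedgeAlt h' (ContinuousAlternatingMap.alternatizeUncurryFin L) β := by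
  ext v
  refine mul_left_cancel₀ (b := ContinuousAlternatingMap.alternatizeUncurryFin _ v)
    (Nat.cast_ne_zero.2 (mul_ne_zero (i + 1).factorial_ne_zero j.factorial_ne_zero)) ?_
  rw [wedgeAlt_eq_sum_perm, Nat.factorial_succ, mul_assoc, Nat.cast_mul, mul_assoc,
    alternatizeUncurryFin_wedge_sum h _ (fun w => L w) (fun _ => β) fun w => rfl]
  simp only [ContinuousAlternatingMap.alternatizeUncurryFin_apply, Finset.mul_sum, Finset.sum_mul]
  rw [Finset.sum_comm]
  have := fun a : Fin (i + 1) => sum_perm_cons_removeNth (fun w : Fin (k + 1) → E =>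
    L (w 0) (fun a => w (Fin.cast h (Fin.castAdd j a)).succ) *
      β (fun b => w (Fin.cast h (Fin.natAdd i b)).succ)) v (Fin.cast h' (Fin.castAdd j a))
  simp only [Fin.cons_zero, Fin.cons_succ, Function.comp_apply] at this
  rw [← Finset.mul_sum]
  -- The slot `a` that receives the derivative may be any of the first `i + 1`; each choice yields
  -- the same sum, which turns `i!` into `(i + 1)!`.
  trans ∑ a : Fin (i + 1), ∑ σ : Equiv.Perm (Fin (k + 1)), (Equiv.Perm.sign σ : ℂ) *
        (L (v (σ 0)) (fun a => v (σ (Fin.cast h (Fin.castAdd j a)).succ)) *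
          β (fun b => v (σ (Fin.cast h (Fin.natAdd i b)).succ)))
  · simp
  · refine Finset.sum_congr rfl fun a _ => ?_
    rw [← this a]
    refine Finset.sum_congr rfl fun σ _ => ?_
    have e1 : (fun c : Fin i => (Fin.cast h' (Fin.castAdd j a)).removeNth (v ∘ σ)
        (Fin.cast h (Fin.castAdd j c))) =
        a.removeNth fun a => v (σ (Fin.cast h' (Fin.castAdd j a))) := by
      funext c
      simp only [Fin.removeNth_apply, Function.comp_apply]
      congr 2
      ext
      simp [Fin.succAbove, Fin.lt_def]
      split_ifs <;> rfl
    have e2 : (fun b : Fin j => (Fin.cast h' (Fin.castAdd j a)).removeNth (v ∘ σ)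
        (Fin.cast h (Fin.natAdd i b))) =
        fun b => v (σ (Fin.cast h' (Fin.natAdd (i + 1) b))) := by
      funext c
      simp only [Fin.removeNth_apply, Function.comp_apply]
      congr 2
      ext
      simp [Fin.succAbove, Fin.lt_def]
      split_ifs <;> simp <;> omega
    rw [e1, e2]
    simp [mul_assoc]

theorem alternatizeUncurryFin_wedgeRight {i j k : ℕ} (h : i + j = k) (h' : i + (j + 1) = k + 1)
    (α : E [⋀^Fin i]→L[ℝ] ℂ) (R : E →L[ℝ] E [⋀^Fin j]→L[ℝ] ℂ) :
    ContinuousAlternatingMap.alternatizeUncurryFin (wedgeRightCLM h α R) =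
      (-1 : ℂ) ^ i • wedgeAlt h' α (ContinuousAlternatingMap.alternatizeUncurryFin R) := by
  ext v
  refine mul_left_cancel₀ (b := ContinuousAlternatingMap.alternatizeUncurryFin _ v)
    (Nat.cast_ne_zero.2 (mul_ne_zero i.factorial_ne_zero (j + 1).factorial_ne_zero)) ?_
  rw [ContinuousAlternatingMap.smul_apply, smul_eq_mul, mul_left_comm,
    wedgeAlt_eq_sum_perm, Nat.factorial_succ, mul_left_comm, Nat.cast_mul, mul_assoc,
    alternatizeUncurryFin_wedge_sum h _ (fun _ => α) (fun w => R w) fun w => rfl]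
  simp only [ContinuousAlternatingMap.alternatizeUncurryFin_apply, Finset.mul_sum]
  rw [Finset.sum_comm]
  -- The slot now lies in the second block, at position `i + a`. Its sign is `(-1) ^ (i + a)`,
  -- whereas the alternatization of `R` supplies only `(-1) ^ a`; this is the source of the factor
  -- `(-1) ^ i`.
  have := fun a : Fin (j + 1) => sum_perm_cons_removeNth (fun w : Fin (k + 1) → E =>
    α (fun a => w (Fin.cast h (Fin.castAdd j a)).succ) *
      R (w 0) (fun b => w (Fin.cast h (Fin.natAdd i b)).succ)) v (Fin.cast h' (Fin.natAdd i a))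
  simp only [Fin.cons_zero, Fin.cons_succ, Function.comp_apply] at this
  rw [← Finset.mul_sum]
  trans ∑ a : Fin (j + 1), ∑ σ : Equiv.Perm (Fin (k + 1)), (Equiv.Perm.sign σ : ℂ) *
        (α (fun a => v (σ (Fin.cast h (Fin.castAdd j a)).succ)) *
          R (v (σ 0)) (fun b => v (σ (Fin.cast h (Fin.natAdd i b)).succ)))
  · simp
  · refine Finset.sum_congr rfl fun a _ => ?_
    rw [← this a]
    refine Finset.sum_congr rfl fun σ _ => ?_
    have e1 : (fun c : Fin i => (Fin.cast h' (Fin.natAdd i a)).removeNth (v ∘ σ)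
        (Fin.cast h (Fin.castAdd j c))) =
        fun a => v (σ (Fin.cast h' (Fin.castAdd (j + 1) a))) := by
      funext c
      simp only [Fin.removeNth_apply, Function.comp_apply]
      congr 2
      ext
      simp only [Fin.succAbove, Fin.lt_def, Fin.val_castSucc, Fin.val_cast, Fin.val_castAdd,
        Fin.val_natAdd]
      rw [if_pos (by omega)]
      rfl
    have e2 : (fun b : Fin j => (Fin.cast h' (Fin.natAdd i a)).removeNth (v ∘ σ)
        (Fin.cast h (Fin.natAdd i b))) =
        a.removeNth fun b => v (σ (Fin.cast h' (Fin.natAdd i b))) := by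
      funext c
      simp only [Fin.removeNth_apply, Function.comp_apply]
      congr 2
      ext
      simp [Fin.succAbove, Fin.lt_def]
      split_ifs <;> simp <;> omega
    rw [e1, e2]
    simp [pow_add]
    ring
end FibreLeibniz

/-! ### The calculus of `d`, `∂`, `∂̄`, exterior products and restriction. -/

section FormCalculus
variable {E : Type*} [NormedAddCommGroup E] [NormedSpace ℂ E]

theorem fderiv_wedgeAlt {i j k : ℕ} (h : i + j = k) {f : E → E [⋀^Fin i]→L[ℝ] ℂ}
    {g : E → E [⋀^Fin j]→L[ℝ] ℂ} {y : E} (hf : DifferentiableAt ℝ f y)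
    (hg : DifferentiableAt ℝ g y) :
    HasFDerivAt (fun y => wedgeAlt h (f y) (g y))
      (wedgeRightCLM h (f y) (fderiv ℝ g y) + wedgeLeftCLM h (fderiv ℝ f y) (g y)) y := by
  have h1 := ((isBoundedBilinearMap_wedgeAlt (E := E) h).hasFDerivAt (f y, g y)).comp y
    (hf.hasFDerivAt.prodMk hg.hasFDerivAt)
  exact h1

theorem extDeriv_wedgeAlt {i j k : ℕ} (h : i + j = k) {f : E → E [⋀^Fin i]→L[ℝ] ℂ}
    {g : E → E [⋀^Fin j]→L[ℝ] ℂ} {y : E} (hf : DifferentiableAt ℝ f y)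
    (hg : DifferentiableAt ℝ g y) (h₁ : i + 1 + j = k + 1) (h₂ : i + (j + 1) = k + 1) :
    extDeriv (fun y => wedgeAlt h (f y) (g y)) y =
      wedgeAlt h₁ (extDeriv f y) (g y) + (-1 : ℂ) ^ i • wedgeAlt h₂ (f y) (extDeriv g y) := by
  rw [extDeriv, (fderiv_wedgeAlt h hf hg).fderiv,
    ContinuousAlternatingMap.alternatizeUncurryFin_add, alternatizeUncurryFin_wedgeLeft h h₁,
    alternatizeUncurryFin_wedgeRight h h₂]
  exact add_comm _ _

/-- `wedgeAlt` for degrees that need not add up, with value `0` if they do not. -/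
def wedgeDeg (i j k : ℕ) (α : E [⋀^Fin i]→L[ℝ] ℂ) (β : E [⋀^Fin j]→L[ℝ] ℂ) : E [⋀^Fin k]→L[ℝ] ℂ :=
  if h : i + j = k then wedgeAlt h α β else 0

theorem wedgeAlt_zero_left {i j k : ℕ} (h : i + j = k) (β : E [⋀^Fin j]→L[ℝ] ℂ) :
    wedgeAlt h (0 : E [⋀^Fin i]→L[ℝ] ℂ) β = 0 := by
  simpa using wedgeAlt_add_left h 0 0 β

theorem wedgeAlt_zero_right {i j k : ℕ} (h : i + j = k) (α : E [⋀^Fin i]→L[ℝ] ℂ) :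
    wedgeAlt h α (0 : E [⋀^Fin j]→L[ℝ] ℂ) = 0 := by
  simpa using wedgeAlt_add_right h α 0 0

/-- With the proof of `i + j = k` moved into `wedgeDeg`, the sum runs over a plain `Finset`, to
which the recursion formulas for antidiagonals apply. -/
theorem Cov.wedge_eq_sum (a b : Cov E) (k : ℕ) :
    a.wedge b k = ∑ ij ∈ Finset.HasAntidiagonal.antidiagonal k, wedgeDeg ij.1 ij.2 k (a ij.1) (b ij.2) := by
  rw [Cov.wedge, ← Finset.sum_coe_sort (Finset.HasAntidiagonal.antidiagonal k)
    (fun ij => wedgeDeg ij.1 ij.2 k (a ij.1) (b ij.2))]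
  refine Finset.sum_congr rfl fun ij _ => ?_
  rw [wedgeDeg, dif_pos (Finset.HasAntidiagonal.mem_antidiagonal.1 ij.2)]

theorem Cov.wedge_zero_of_left {a b : Cov E} (h : a 0 = 0) : a.wedge b 0 = 0 := by
  simp [Cov.wedge_eq_sum, h, wedgeDeg, wedgeAlt_zero_left]

theorem Cov.wedge_zero_of_right {a b : Cov E} (h : b 0 = 0) : a.wedge b 0 = 0 := by
  simp [Cov.wedge_eq_sum, h, wedgeDeg, wedgeAlt_zero_right]

/-- Meant for `a = dα`, which has no part of degree `0`: the sum is then indexed like the one for `α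
∧ β` in degree `k`. -/
theorem Cov.wedge_zero_succ_sum {a b : Cov E} (h : a 0 = 0) (k : ℕ) :
    a.wedge b (k + 1) = ∑ ij : Finset.HasAntidiagonal.antidiagonal k,
      wedgeAlt (by have := Finset.HasAntidiagonal.mem_antidiagonal.1 ij.2; omega : ij.1.1 + 1 + ij.1.2 = k + 1)
        (a (ij.1.1 + 1)) (b ij.1.2) := by
  rw [Cov.wedge_eq_sum, Finset.Nat.sum_antidiagonal_succ, ← Finset.sum_coe_sort, h]
  simp only [wedgeDeg, wedgeAlt_zero_left, dite_eq_ite, ite_self, zero_add]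
  refine Finset.sum_congr rfl fun ij _ => ?_
  have := Finset.HasAntidiagonal.mem_antidiagonal.1 ij.2
  exact dif_pos (by omega)

theorem Cov.wedge_succ_zero_sum {a b : Cov E} (h : b 0 = 0) (k : ℕ) :
    a.wedge b (k + 1) = ∑ ij : Finset.HasAntidiagonal.antidiagonal k,
      wedgeAlt (by have := Finset.HasAntidiagonal.mem_antidiagonal.1 ij.2; omega : ij.1.1 + (ij.1.2 + 1) = k + 1)
        (a ij.1.1) (b (ij.1.2 + 1)) := by
  rw [Cov.wedge_eq_sum, Finset.Nat.sum_antidiagonal_succ', ← Finset.sum_coe_sort, h]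
  simp only [wedgeDeg, wedgeAlt_zero_right, dite_eq_ite, ite_self, zero_add]
  refine Finset.sum_congr rfl fun ij _ => ?_
  have := Finset.HasAntidiagonal.mem_antidiagonal.1 ij.2
  exact dif_pos (by omega)

variable {M : Type*} [TopologicalSpace M] [ChartedSpace E M] {U : Opens M}

theorem localForm_wedge (α β : U → Cov E) (x : M) (k : ℕ) :
    Set.EqOn (localForm (fun x => (α x).wedge (β x)) x k)
      (fun y => ∑ ij : Finset.HasAntidiagonal.antidiagonal k,
        wedgeAlt (Finset.HasAntidiagonal.mem_antidiagonal.1 ij.2) (localForm α x ij.1.1 y)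
          (localForm β x ij.1.2 y)) (chartDomain U x) := by
  intro y hy
  simp only [localForm_of_mem _ x _ hy.2, ← wedgeAlt_comp]
  ext v
  simp [Cov.wedge]

theorem localForm_self (α : U → Cov E) (x : U) (k : ℕ) :
    localForm α (x : M) k (chartAt E (x : M) x) = α x k := by
  have hx := chart_mem_chartDomain (E := E) x
  have e : (chartAt E (x : M)).symm (chartAt E (x : M) x) = x :=
    (chartAt E (x : M)).left_inv (mem_chart_source E _)
  -- The point produced by going through the chart and back is only propositionally equal to `x`,
  -- and the chart used in the derivative depends on it; hence the statement for a general `z`.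
  have key : ∀ z (hz : z ∈ U), z = (x : M) → (α ⟨z, hz⟩ k).compContinuousLinearMap
      (fderiv ℝ (chartAt E z ∘ (chartAt E (x : M)).symm) (chartAt E (x : M) x)) = α x k := by
    rintro z hz rfl
    have : fderiv ℝ (chartAt E (x : M) ∘ (chartAt E (x : M)).symm) (chartAt E (x : M) x) =
        ContinuousLinearMap.id ℝ E := by
      rw [← fderiv_id (𝕜 := ℝ) (x := chartAt E (x : M) x)]
      refine Filter.EventuallyEq.fderiv_eq ?_
      filter_upwards [(chartAt E (x : M)).open_target.mem_nhds (mem_chart_target E _)] with y hy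
      exact (chartAt E (x : M)).right_inv hy
    rw [this]
    ext v
    simp
  rw [localForm_of_mem _ _ _ hx.2]
  exact key _ _ e

theorem Forms.ext {α β : Forms E U} (h : ∀ x k, α.1 x k = β.1 x k) : α = β :=
  Subtype.ext (funext fun x => funext fun k => h x k)

theorem extDeriv_localForm_congr {α : U → Cov E} {V : Opens M} {γ : V → Cov E} (x : V)
    (k : ℕ) (h : Set.EqOn (localForm γ (x : M) k) (localForm α (x : M) k) (chartDomain V (x : M))) :
    extDeriv (localForm γ (x : M) k) (chartAt E (x : M) x) =
      extDeriv (localForm α (x : M) k) (chartAt E (x : M) x) :=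
  Filter.EventuallyEq.extDeriv_eq (Filter.eventuallyEq_of_mem
    ((isOpen_chartDomain (x : M)).mem_nhds (chart_mem_chartDomain x)) h)

variable {V W : Opens M}

theorem localForm_res (h : V ≤ U) (α : Forms E U) (x : M) (k : ℕ) :
    Set.EqOn (localForm (res h α).1 x k) (localForm α.1 x k) (chartDomain V x) := fun z hz => by
  rw [localForm_of_mem _ x k hz.2, localForm_of_mem _ x k (h hz.2)]
  rfl

theorem wedge_res (h : V ≤ U) (α β : Forms E U) :
    wedge (res h α) (res h β) = res h (wedge α β) := rfl

theorem res_res (h : V ≤ U) (h' : W ≤ V) (α : Forms E U) :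
    res h' (res h α) = res (h'.trans h) α := rfl

theorem res_mem {p q : ℤ} (h : V ≤ U) {α : Forms E U} (hα : α ∈ formsOfType E p q U) :
    res h α ∈ formsOfType E p q V := fun x k c hc v => hα ⟨x, h x.2⟩ k c hc v

variable [IsManifold 𝓘(ℂ, E) ω M]

/-- Pullback by `-1` multiplies the degree `k` component by `(-1) ^ k`, so `rot (-1)` expresses the
Leibniz sign for inhomogeneous forms without reference to a degree. -/
theorem d_wedge (α β : Forms E U) :
    d (wedge α β) = wedge (d α) β + wedge (rot (-1) α) (d β) := by
  refine Forms.ext fun x k => ?_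
  rcases k with _ | k
  · change (0 : E [⋀^Fin 0]→L[ℝ] ℂ) = ((d α).1 x).wedge (β.1 x) 0 +
      ((rot (-1) α).1 x).wedge ((d β).1 x) 0
    rw [Cov.wedge_zero_of_left rfl, Cov.wedge_zero_of_right rfl, add_zero]
  · have hx := chart_mem_chartDomain (E := E) x
    change extDeriv (localForm (fun x => (α.1 x).wedge (β.1 x)) (x : M) k)
      (chartAt E (x : M) x) = ((d α).1 x).wedge (β.1 x) (k + 1) +
      ((rot (-1) α).1 x).wedge ((d β).1 x) (k + 1)
    rw [Cov.wedge_zero_succ_sum rfl, Cov.wedge_succ_zero_sum rfl,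
      (Filter.EventuallyEq.extDeriv_eq (Filter.eventuallyEq_of_mem
      ((isOpen_chartDomain (x : M)).mem_nhds hx) (localForm_wedge α.1 β.1 x k)))]
    have hd : ∀ ij : Finset.HasAntidiagonal.antidiagonal k, DifferentiableAt ℝ (fun y =>
        wedgeAlt (Finset.HasAntidiagonal.mem_antidiagonal.1 ij.2) (localForm α.1 (x : M) ij.1.1 y)
          (localForm β.1 (x : M) ij.1.2 y)) (chartAt E (x : M) x) := fun ij =>
      (fderiv_wedgeAlt _ (α.2.differentiableAt _ _ hx)
        (β.2.differentiableAt _ _ hx)).differentiableAt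
    rw [extDeriv, fderiv_fun_sum fun ij _ => hd ij]
    rw [show ∀ f, ContinuousAlternatingMap.alternatizeUncurryFin (𝕜 := ℝ) (E := E) (F := ℂ)
      (n := k) f = ContinuousAlternatingMap.alternatizeUncurryFinCLM ℝ E ℂ f from fun _ => rfl,
      map_sum, ← Finset.sum_add_distrib]
    refine Finset.sum_congr rfl fun ij _ => ?_
    have hij := Finset.HasAntidiagonal.mem_antidiagonal.1 ij.2
    refine (extDeriv_wedgeAlt hij (α.2.differentiableAt _ _ hx) (β.2.differentiableAt _ _ hx)
      (by omega) (by omega)).trans ?_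
    rw [localForm_self, localForm_self, ← wedgeAlt_smul_left]
    congr 2
    ext v
    change _ = α.1 x ij.1.1 (fun i => (-1 : ℂ) • v i)
    have := (α.1 x ij.1.1).toMultilinearMap.map_smul_univ (fun _ => (-1 : ℝ)) v
    simp at this
    simp [this]

theorem rot_wedge (c : ℂ) (α β : Forms E U) : rot c (wedge α β) = wedge (rot c α) (rot c β) := by
  refine Forms.ext fun x k => ?_
  change ((α.1 x).wedge (β.1 x) k).compContinuousLinearMap (smulCLM E c) = Cov.wedge _ _ k
  have h : ∀ ij : Finset.HasAntidiagonal.antidiagonal k, _ := fun ij => wedgeAlt_comp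
    (Finset.HasAntidiagonal.mem_antidiagonal.1 ij.2) (α.1 x ij.1.1) (β.1 x ij.1.2) (smulCLM E c)
  ext v
  have h' := Finset.sum_congr rfl fun ij (_ : ij ∈ Finset.univ) => DFunLike.congr_fun (h ij) v
  simp only [ContinuousAlternatingMap.compContinuousLinearMap_apply] at h'
  simp only [Cov.wedge, ContinuousAlternatingMap.compContinuousLinearMap_apply,
    ContinuousAlternatingMap.sum_apply]
  exact h'

theorem rot_rot (b c : ℂ) (α : Forms E U) : rot b (rot c α) = rot (c * b) α := by
  refine Forms.ext fun x k => ?_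
  ext v
  change α.1 x k (fun i => c • b • v i) = α.1 x k (fun i => (c * b) • v i)
  simp only [mul_smul]

theorem rot_one (α : Forms E U) : rot 1 α = α := by
  refine Forms.ext fun x k => ?_
  ext v
  change α.1 x k (fun i => (1 : ℂ) • v i) = α.1 x k v
  simp only [one_smul]

/-- `dᶜ = C⁻¹ d C`. -/
def dc : Forms E U →ₗ[ℂ] Forms E U := rot (-Complex.I) ∘ₗ d ∘ₗ rot Complex.I

/-- `rot` is multiplicative and `rot (-1)` commutes with `rot I`, so the conjugate of the
antiderivation `d` is again an antiderivation with the same sign operator. -/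
theorem dc_wedge (α β : Forms E U) :
    dc (wedge α β) = wedge (dc α) β + wedge (rot (-1) α) (dc β) := by
  change rot _ (d (rot _ (wedge α β))) = wedge (rot _ (d (rot _ α))) β +
    wedge _ (rot _ (d (rot _ β)))
  have h : ∀ γ : Forms E U, rot (-Complex.I) (rot Complex.I γ) = γ := fun γ => by
    rw [rot_rot]; simp [rot_one]
  rw [rot_wedge, d_wedge, map_add, rot_wedge, rot_wedge, h, rot_rot, rot_rot]
  simp

theorem del_eq (α : Forms E U) : del α = (1 / 2 : ℂ) • (d α + Complex.I • dc α) := rfl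

theorem delbar_eq (α : Forms E U) : delbar α = (1 / 2 : ℂ) • (d α - Complex.I • dc α) := rfl

theorem rot_of_mem {p q : ℤ} {α : Forms E U} (hα : α ∈ formsOfType E p q U) {c : ℂ}
    (hc : c ≠ 0) : rot c α = weight p q c • α :=
  Subtype.ext (rotForm_of_mem hα hc)

theorem weight_neg_one (p q : ℤ) : weight p q (-1) = (-1) ^ (p + q) := by
  rw [weight, zpow_add₀ (by norm_num)]
  simp

theorem del_wedge {p q : ℤ} {α : Forms E U} (hα : α ∈ formsOfType E p q U) (β : Forms E U) :
    del (wedge α β) = wedge (del α) β + (-1 : ℂ) ^ (p + q) • wedge α (del β) := by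
  simp only [del_eq, d_wedge, dc_wedge, rot_of_mem hα (neg_ne_zero.2 one_ne_zero), weight_neg_one,
    map_smul, map_add, LinearMap.smul_apply, LinearMap.add_apply]
  module

theorem delbar_wedge {p q : ℤ} {α : Forms E U} (hα : α ∈ formsOfType E p q U) (β : Forms E U) :
    delbar (wedge α β) = wedge (delbar α) β + (-1 : ℂ) ^ (p + q) • wedge α (delbar β) := by
  simp only [delbar_eq, d_wedge, dc_wedge, rot_of_mem hα (neg_ne_zero.2 one_ne_zero),
    weight_neg_one, map_smul, map_sub, LinearMap.smul_apply, LinearMap.sub_apply]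
  module

theorem wedge_mem {p q r s : ℤ} {α β : Forms E U} (hα : α ∈ formsOfType E p q U)
    (hβ : β ∈ formsOfType E r s U) : wedge α β ∈ formsOfType E (p + r) (q + s) U := by
  intro x k c hc v
  have h := rot_wedge c α β
  rw [rot_of_mem hα hc, rot_of_mem hβ hc, map_smul, map_smul, LinearMap.smul_apply,
    smul_smul] at h
  have h' : (wedge α β).1 x k (fun i => c • v i) =
      (weight r s c * weight p q c) * (wedge α β).1 x k v :=
    DFunLike.congr_fun (congrFun (congrFun (congrArg Subtype.val h) x) k) v
  rw [h', zpow_add₀ hc, zpow_add₀ ((map_ne_zero _).2 hc), weight, weight]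
  ring

theorem d_d (α : Forms E U) : d (d α) = 0 := by
  refine Forms.ext fun x k => ?_
  have hx := chart_mem_chartDomain (E := E) x
  have hn := (isOpen_chartDomain (E := E) (U := U) (x : M)).mem_nhds hx
  rcases k with _ | _ | k
  · rfl
  -- In degree `1` the claim is about the differential of the degree `0` component of `dα`, which is
  -- `0` by definition and not itself an exterior derivative.
  · change extDeriv (localForm (dForm α.1) (x : M) 0) (chartAt E (x : M) x) = 0
    rw [Filter.EventuallyEq.extDeriv_eq (Filter.eventuallyEq_of_mem hn
      (localForm_zero_comp (dForm α.1) (fun _ => rfl) (x : M)))]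
    simp only [extDeriv, fderiv_zero, Pi.zero_apply]
    exact map_zero (ContinuousAlternatingMap.alternatizeUncurryFinCLM ℝ E ℂ)
  · change extDeriv (localForm (dForm α.1) (x : M) (k + 1)) (chartAt E (x : M) x) = 0
    rw [Filter.EventuallyEq.extDeriv_eq (Filter.eventuallyEq_of_mem hn
      fun y hy => localForm_dForm α.2 (x : M) k hy)]
    exact extDeriv_extDeriv_apply ((α.2 (x : M) k).contDiffAt hn) (by
      rw [minSmoothness_of_isRCLikeNormedField]; exact WithTop.coe_le_coe.2 le_top)

/-- Forms of different types `(p + 2, q)`, `(p + 1, q + 1)`, `(p, q + 2)` are independent. -/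
theorem eq_zero_of_add_types {p q : ℤ} {a b c : Forms E U}
    (ha : a ∈ formsOfType E (p + 1 + 1) q U) (hb : b ∈ formsOfType E (p + 1) (q + 1) U)
    (hc : c ∈ formsOfType E p (q + 1 + 1) U) (h : a + b + c = 0) : a = 0 ∧ b = 0 ∧ c = 0 := by
  -- Pullback by `z` acts on the three summands through the common factor `z ^ p · z̄ ^ q` times
  -- `z²`, `z z̄` and `z̄²`. The values at `1`, `i` and `1 + i` suffice to separate them: `i` gives
  -- `-a + b - c = 0` and `1 + i` gives `2i a + 2b - 2i c = 0`.
  have key : ∀ z : ℂ, z ≠ 0 → (z * z) • a + (z * starRingEnd ℂ z) • b +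
      (starRingEnd ℂ z * starRingEnd ℂ z) • c = 0 := fun z hz => by
    have hz' : starRingEnd ℂ z ≠ 0 := (map_ne_zero _).2 hz
    have h1 := congrArg (rot z) h
    rw [map_add, map_add, rot_of_mem ha hz, rot_of_mem hb hz, rot_of_mem hc hz, map_zero] at h1
    have hw : weight p q z ≠ 0 := mul_ne_zero (zpow_ne_zero _ hz) (zpow_ne_zero _ hz')
    have h2 : weight p q z • ((z * z) • a + (z * starRingEnd ℂ z) • b +
        (starRingEnd ℂ z * starRingEnd ℂ z) • c) = 0 := by
      rw [← h1]
      simp only [weight, zpow_add_one₀ hz, zpow_add_one₀ hz']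
      module
    exact (smul_eq_zero.1 h2).resolve_left hw
  have h1 := key Complex.I Complex.I_ne_zero
  have hne : (1 + Complex.I) ≠ 0 := fun h => by simpa using congrArg Complex.re h
  have h2 := key (1 + Complex.I) hne
  simp only [Complex.conj_I, mul_neg, neg_mul, neg_neg, Complex.I_mul_I] at h1
  have hI := Complex.I_mul_I
  have e1 : (1 + Complex.I) * (1 + Complex.I) = 2 * Complex.I := by linear_combination hI
  have e2 : (1 + Complex.I) * (1 + -Complex.I) = 2 := by linear_combination -hI
  have e3 : (1 + -Complex.I) * (1 + -Complex.I) = -2 * Complex.I := by linear_combination hI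
  simp only [map_add, map_one, Complex.conj_I, e1, e2, e3] at h2
  have hb0 : b = 0 := by
    have : (2 : ℂ) • b = 0 := by
      linear_combination (norm := module) h + h1
    exact (smul_eq_zero.1 this).resolve_left two_ne_zero
  subst hb0
  have hac : (2 * Complex.I) • (a - c) = 0 := by
    linear_combination (norm := module) h2
  have hac' := sub_eq_zero.1 ((smul_eq_zero.1 hac).resolve_left
    (mul_ne_zero two_ne_zero Complex.I_ne_zero))
  subst hac'
  have : (2 : ℂ) • a = 0 := by linear_combination (norm := module) h
  have := (smul_eq_zero.1 this).resolve_left two_ne_zero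
  exact ⟨this, rfl, this⟩

theorem del_delbar_relations {p q : ℤ} {α : Forms E U} (hα : α ∈ formsOfType E p q U) :
    del (del α) = 0 ∧ delbar (del α) + del (delbar α) = 0 ∧ delbar (delbar α) = 0 := by
  refine eq_zero_of_add_types (del_mem (del_mem hα))
    (add_mem (delbar_mem (del_mem hα)) (del_mem (delbar_mem hα)))
    (delbar_mem (delbar_mem hα)) ?_
  have h := d_d α
  rw [d_eq_del_add_delbar (d α), d_eq_del_add_delbar α, map_add, map_add] at h
  rw [← h]
  abel

theorem del_del {p q : ℤ} {α : Forms E U} (hα : α ∈ formsOfType E p q U) : del (del α) = 0 :=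
  (del_delbar_relations hα).1

theorem delbar_delbar {p q : ℤ} {α : Forms E U} (hα : α ∈ formsOfType E p q U) :
    delbar (delbar α) = 0 :=
  (del_delbar_relations hα).2.2

theorem del_delbar {p q : ℤ} {α : Forms E U} (hα : α ∈ formsOfType E p q U) :
    del (delbar α) = -delbar (del α) :=
  eq_neg_of_add_eq_zero_right (del_delbar_relations hα).2.1

/-- On a form of pure type `rot I` is a scalar, so a closed form stays closed under it. Thus `dσ =
0` gives both `∂σ = 0` and `∂̄σ = 0`. -/
theorem dc_eq_zero_of_d_eq_zero {p q : ℤ} {α : Forms E U} (hα : α ∈ formsOfType E p q U)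
    (h : d α = 0) : dc α = 0 := by
  change rot _ (d (rot _ α)) = 0
  rw [rot_of_mem hα Complex.I_ne_zero, map_smul, h, smul_zero, map_zero]

theorem del_eq_zero_of_d_eq_zero {p q : ℤ} {α : Forms E U} (hα : α ∈ formsOfType E p q U)
    (h : d α = 0) : del α = 0 := by
  rw [del_eq, h, dc_eq_zero_of_d_eq_zero hα h]; simp

theorem delbar_eq_zero_of_d_eq_zero {p q : ℤ} {α : Forms E U} (hα : α ∈ formsOfType E p q U)
    (h : d α = 0) : delbar α = 0 := by
  rw [delbar_eq, h, dc_eq_zero_of_d_eq_zero hα h]; simp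

theorem d_delbar_del {p q : ℤ} {α : Forms E U} (hα : α ∈ formsOfType E p q U) :
    d (delbar (del α)) = 0 := by
  rw [d_eq_del_add_delbar, delbar_delbar (del_mem hα), del_delbar (del_mem hα), del_del hα]
  simp

/-! ### Restriction -/

theorem d_res (h : V ≤ U) (α : Forms E U) : d (res h α) = res h (d α) := by
  refine Forms.ext fun x k => ?_
  rcases k with _ | k
  · rfl
  · exact extDeriv_localForm_congr (U := U) x k (localForm_res h α x k)

theorem rot_res (h : V ≤ U) (c : ℂ) (α : Forms E U) : rot c (res h α) = res h (rot c α) := rfl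

theorem dc_res (h : V ≤ U) (α : Forms E U) : dc (res h α) = res h (dc α) := by
  change rot _ (d (rot _ (res h α))) = _
  rw [rot_res, d_res, rot_res]
  rfl

theorem del_res (h : V ≤ U) (α : Forms E U) : del (res h α) = res h (del α) := by
  simp only [del_eq, d_res, dc_res, map_smul, map_add]

theorem delbar_res (h : V ≤ U) (α : Forms E U) : delbar (res h α) = res h (delbar α) := by
  simp only [delbar_eq, d_res, dc_res, map_smul, map_sub]

end FormCalculus

/-! ### Gluing, cutting off and splitting of forms. -/

section Gluing
variable {E : Type*} [NormedAddCommGroup E] [NormedSpace ℂ E]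
  {M : Type*} [TopologicalSpace M] [ChartedSpace E M] {U V W U₀ U₁ : Opens M}

theorem isSmoothForm_of_locally {α : U → Cov E}
    (h : ∀ x : U, ∃ (V : Opens M) (hV : V ≤ U), (x : M) ∈ V ∧
      IsSmoothForm fun z : V => α ⟨z, hV z.2⟩) : IsSmoothForm α := by
  intro x k y hy
  obtain ⟨V, hV, hxV, hs⟩ := h ⟨_, hy.2⟩
  have hy' : y ∈ chartDomain V x := ⟨hy.1, hxV⟩
  have hn := (isOpen_chartDomain (E := E) (U := V) x).mem_nhds hy'
  refine (((hs x k).contDiffAt hn).congr_of_eventuallyEq ?_).contDiffWithinAt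
  refine Filter.eventuallyEq_of_mem hn fun z hz => ?_
  rw [localForm_of_mem _ x k hz.2, localForm_of_mem _ x k (hV hz.2)]

theorem isSmoothForm_zero : IsSmoothForm (E := E) (0 : U → Cov E) :=
  (smoothForms E U).zero_mem

theorem mem_or_mem_of_sup_eq_top {X : Type*} [TopologicalSpace X] {U₀ U₁ : Opens X}
    (hU : U₀ ⊔ U₁ = ⊤) (z : X) : z ∈ U₀ ∨ z ∈ U₁ :=
  (hU ▸ Opens.mem_top z : z ∈ U₀ ⊔ U₁)

theorem Forms.ext_of_res {α β : Forms E (⊤ : Opens M)} (hU : U₀ ⊔ U₁ = ⊤)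
    (h₀ : res (le_top : U₀ ≤ ⊤) α = res le_top β) (h₁ : res (le_top : U₁ ≤ ⊤) α = res le_top β) :
    α = β := by
  refine Forms.ext fun x k => ?_
  rcases mem_or_mem_of_sup_eq_top hU x with hx | hx
  · exact congrFun (congrFun (congrArg Subtype.val h₀) ⟨x, hx⟩) k
  · exact congrFun (congrFun (congrArg Subtype.val h₁) ⟨x, hx⟩) k

theorem mem_formsOfType_of_res {p q : ℤ} {α : Forms E (⊤ : Opens M)} (hU : U₀ ⊔ U₁ = ⊤)
    (h₀ : res (le_top : U₀ ≤ ⊤) α ∈ formsOfType E p q U₀)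
    (h₁ : res (le_top : U₁ ≤ ⊤) α ∈ formsOfType E p q U₁) : α ∈ formsOfType E p q ⊤ := by
  intro x k c hc v
  rcases mem_or_mem_of_sup_eq_top hU x with hx | hx
  · exact h₀ ⟨x, hx⟩ k c hc v
  · exact h₁ ⟨x, hx⟩ k c hc v

open Classical in
/-- Two forms that agree on the intersection glue. -/
theorem exists_glue (hU : U₀ ⊔ U₁ = ⊤) (α₀ : Forms E U₀) (α₁ : Forms E U₁)
    (h : (res₀ α₀ : Forms E (U₀ ⊓ U₁)) = res₁ α₁) :
    ∃ α : Forms E (⊤ : Opens M), res le_top α = α₀ ∧ res le_top α = α₁ := by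
  have hmem : ∀ z : M, z ∉ U₀ → z ∈ U₁ := fun z hz =>
    (mem_or_mem_of_sup_eq_top hU z).resolve_left hz
  set a : (⊤ : Opens M) → Cov E := fun z =>
    if hz : (z : M) ∈ U₀ then α₀.1 ⟨z, hz⟩ else α₁.1 ⟨z, hmem z hz⟩ with ha
  have e₀ : (fun z : U₀ => a ⟨z, Opens.mem_top _⟩) = α₀.1 := by
    funext z
    simp only [ha, z.2, dif_pos]
  have e₁ : (fun z : U₁ => a ⟨z, Opens.mem_top _⟩) = α₁.1 := by
    funext z
    by_cases hz : (z : M) ∈ U₀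
    · simp only [ha, hz, dif_pos]
      exact congrFun (congrArg Subtype.val h) ⟨z, hz, z.2⟩
    · simp only [ha, hz, dif_neg, not_false_eq_true]
  refine ⟨⟨a, isSmoothForm_of_locally fun x => ?_⟩, Subtype.ext e₀, Subtype.ext e₁⟩
  by_cases hx : (x : M) ∈ U₀
  · refine ⟨U₀, le_top, hx, ?_⟩
    rw [e₀]
    exact α₀.2
  · refine ⟨U₁, le_top, hmem x hx, ?_⟩
    rw [e₁]
    exact α₁.2

variable [IsManifold 𝓘(ℂ, E) ω M]

/-- The cut-off functions are only real-smooth, so the underlying real manifold is needed. -/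
theorem isManifold_real : IsManifold 𝓘(ℝ, E) ∞ M := by
  refine isManifold_of_contDiffOn _ _ _ fun e e' he he' => ?_
  have h := (contDiffGroupoid ω 𝓘(ℂ, E)).compatible he he'
  rw [contDiffGroupoid, mem_groupoid_of_pregroupoid] at h
  have h1 := h.1
  simp only [contDiffPregroupoid, modelWithCornersSelf_coe, modelWithCornersSelf_coe_symm,
    Function.comp_id, Function.id_comp, Set.range_id, Set.inter_univ, Set.preimage_id] at h1 ⊢
  exact (h1.restrict_scalars ℝ).of_le le_top

theorem IsSmoothForm.smul {α : U → Cov E} (hα : IsSmoothForm α) {f : M → ℝ}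
    (hf : ContMDiff 𝓘(ℝ, E) 𝓘(ℝ) ∞ f) : IsSmoothForm fun z : U => (f z : ℂ) • α z := by
  intro x k
  have := isManifold_real (E := E) (M := M)
  have h1 : ContDiffOn ℝ ∞ (f ∘ (chartAt E x).symm) (chartAt E x).target :=
    (hf.comp_contMDiffOn (contMDiffOn_chart_symm (I := 𝓘(ℝ, E)) (x := x))).contDiffOn
  refine ((h1.mono fun z hz => hz.1).smul (hα x k)).congr fun y hy => ?_
  rw [localForm_of_mem _ x k hy.2, Pi.smul_apply', localForm_of_mem _ x k hy.2]
  ext v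
  simp

open Classical in
/-- The product of a form on `W ⊆ U` with a function that vanishes near `U \ W` extends to `U`. -/
theorem exists_extension (h : W ≤ U) (u : Forms E W) {f : M → ℝ}
    (hf : ContMDiff 𝓘(ℝ, E) 𝓘(ℝ) ∞ f) (hf0 : ∀ z ∈ U, z ∉ W → f =ᶠ[𝓝 z] 0) :
    ∃ a : Forms E U, (∀ z : W, (res h a).1 z = (f z : ℂ) • u.1 z) ∧
      ∀ p q, u ∈ formsOfType E p q W → a ∈ formsOfType E p q U := by
  set a : U → Cov E := fun z => if hz : (z : M) ∈ W then (f z : ℂ) • u.1 ⟨z, hz⟩ else 0 with ha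
  have e : ∀ (z : M) (hz : z ∈ U) (hz' : z ∈ W), a ⟨z, hz⟩ = (f z : ℂ) • u.1 ⟨z, hz'⟩ :=
    fun z hz hz' => by simp only [ha, hz', dif_pos]
  refine ⟨⟨a, isSmoothForm_of_locally fun x => ?_⟩, fun z => e z (h z.2) z.2, ?_⟩
  · by_cases hx : (x : M) ∈ W
    · refine ⟨W, h, hx, ?_⟩
      convert IsSmoothForm.smul u.2 hf using 2 with z
      exact e z (h z.2) z.2
    -- Near a point outside `W` the function vanishes identically, so the extension by zero is the
    -- zero form there, also at the points that lie in `W`.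
    · obtain ⟨N, hN, hNo, hxN⟩ := eventually_nhds_iff.1 (hf0 x x.2 hx)
      refine ⟨⟨N, hNo⟩ ⊓ U, inf_le_right, ⟨hxN, x.2⟩, ?_⟩
      convert isSmoothForm_zero (E := E) (U := (⟨N, hNo⟩ : Opens M) ⊓ U) using 2 with z
      simp only [ha]
      split_ifs
      · have : f z = 0 := hN z z.2.1
        rw [this, Complex.ofReal_zero]
        exact zero_smul ℂ (show Cov E from u.1 ⟨z, ‹_›⟩)
      · rfl
  · intro p q hu x k c hc v
    change a x k _ = _ * a x k v
    simp only [ha]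
    split_ifs with hz
    · change (f x : ℂ) * u.1 ⟨x, hz⟩ k _ = _ * ((f x : ℂ) * u.1 ⟨x, hz⟩ k v)
      rw [hu ⟨x, hz⟩ k c hc v]
      ring
    · simp

/-- The complements of `U₀` and `U₁` are disjoint closed sets because `U₀` and `U₁` cover `M`; `f`
and `1 - f` form a partition of unity subordinate to the covering. -/
theorem exists_partition [FiniteDimensional ℂ E] [T2Space M] [SecondCountableTopology M]
    (hU : U₀ ⊔ U₁ = ⊤) :
    ∃ f : M → ℝ, ContMDiff 𝓘(ℝ, E) 𝓘(ℝ) ∞ f ∧ (∀ z ∉ U₀, f =ᶠ[𝓝 z] 0) ∧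
      ∀ z ∉ U₁, f =ᶠ[𝓝 z] 1 := by
  have := isManifold_real (E := E) (M := M)
  have : FiniteDimensional ℝ E := FiniteDimensional.complexToReal E
  have : LocallyCompactSpace M := ChartedSpace.locallyCompactSpace E M
  have hd : Disjoint (U₀ : Set M)ᶜ (U₁ : Set M)ᶜ := by
    rw [Set.disjoint_compl_left_iff_subset]
    intro z hz
    exact (mem_or_mem_of_sup_eq_top hU z).resolve_right hz
  obtain ⟨f, h0, h1, -⟩ := exists_contMDiffMap_zero_one_nhds_of_isClosed (n := (⊤ : ℕ∞)) 𝓘(ℝ, E)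
    U₀.isOpen.isClosed_compl U₁.isOpen.isClosed_compl hd
  refine ⟨f, f.contMDiff, fun z hz => ?_, fun z hz => ?_⟩
  · exact Filter.Eventually.filter_mono (nhds_le_nhdsSet hz) h0
  · exact Filter.Eventually.filter_mono (nhds_le_nhdsSet hz) h1

/-- Every form on `U₀ ∩ U₁` is a difference of forms on `U₁` and on `U₀`. -/
theorem exists_split [FiniteDimensional ℂ E] [T2Space M] [SecondCountableTopology M]
    (hU : U₀ ⊔ U₁ = ⊤) (u : Forms E (U₀ ⊓ U₁)) :
    ∃ (a₀ : Forms E U₀) (a₁ : Forms E U₁), u = res₁ a₁ - res₀ a₀ ∧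
      ∀ p q, u ∈ formsOfType E p q (U₀ ⊓ U₁) → a₀ ∈ formsOfType E p q U₀ ∧
        a₁ ∈ formsOfType E p q U₁ := by
  obtain ⟨f, hf, h0, h1⟩ := exists_partition (E := E) hU
  -- The splitting is `u = f u - (f - 1) u`: the first term extends by zero to `U₁`, because `f`
  -- vanishes near the complement of `U₀`, and the second to `U₀`, because `f - 1` vanishes near the
  -- complement of `U₁`.
  obtain ⟨a₁, e₁, t₁⟩ := exists_extension (inf_le_right : U₀ ⊓ U₁ ≤ U₁) u hf
    fun z hz hz' => h0 z fun h => hz' ⟨h, hz⟩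
  obtain ⟨a₀, e₀, t₀⟩ := exists_extension (inf_le_left : U₀ ⊓ U₁ ≤ U₀) u
    (f := fun z => f z - 1) (hf.sub contMDiff_const) fun z hz hz' => by
      filter_upwards [h1 z fun h => hz' ⟨hz, h⟩] with y hy
      simp [hy]
  refine ⟨a₀, a₁, ?_, fun p q hu => ⟨t₀ p q hu, t₁ p q hu⟩⟩
  refine Subtype.ext (funext fun z => ?_)
  change u.1 z = (res₁ a₁).1 z - (res₀ a₀).1 z
  rw [e₁, e₀]
  refine Eq.trans ?_ (sub_smul (f z : ℂ) ((f z - 1 : ℝ) : ℂ) (show Cov E from u.1 z))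
  rw [Complex.ofReal_sub, Complex.ofReal_one, sub_sub_cancel]
  exact (one_smul ℂ (show Cov E from u.1 z)).symm
end Gluing

/-! ### Maps between quotients of cocycles by coboundaries. -/

section Quotients
variable {C₁ C₂ C₃ : Type*} [AddCommGroup C₁] [Module ℂ C₁] [AddCommGroup C₂] [Module ℂ C₂]
  [AddCommGroup C₃] [Module ℂ C₃]

theorem cls_eq_cls_iff {Z B : Submodule ℂ C₁} {x y : Z} :
    (cls x : Z ⧸ B.submoduleOf Z) = cls y ↔ x.1 - y.1 ∈ B :=
  Submodule.Quotient.eq _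

theorem cls_eq_zero_iff {Z B : Submodule ℂ C₁} {x : Z} :
    (cls x : Z ⧸ B.submoduleOf Z) = 0 ↔ x.1 ∈ B :=
  Submodule.Quotient.mk_eq_zero _

theorem exists_bilinear_quotient {Z₁ B₁ : Submodule ℂ C₁} {Z₂ B₂ : Submodule ℂ C₂}
    {Z₃ B₃ : Submodule ℂ C₃} (f : C₁ →ₗ[ℂ] C₂ →ₗ[ℂ] C₃)
    (hZ : ∀ x ∈ Z₁, ∀ y ∈ Z₂, f x y ∈ Z₃) (h₁ : ∀ x ∈ B₁, ∀ y ∈ Z₂, f x y ∈ B₃)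
    (h₂ : ∀ x ∈ Z₁, ∀ y ∈ B₂, f x y ∈ B₃) :
    ∃ Φ : (Z₁ ⧸ B₁.submoduleOf Z₁) →ₗ[ℂ] (Z₂ ⧸ B₂.submoduleOf Z₂) →ₗ[ℂ]
        (Z₃ ⧸ B₃.submoduleOf Z₃),
      ∀ (x : Z₁) (y : Z₂), ∃ h : f x.1 y.1 ∈ Z₃, Φ (cls x) (cls y) = cls ⟨f x.1 y.1, h⟩ := by
  let g : Z₁ →ₗ[ℂ] Z₂ →ₗ[ℂ] (Z₃ ⧸ B₃.submoduleOf Z₃) := LinearMap.mk₂ ℂ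
    (fun x y => (B₃.submoduleOf Z₃).mkQ ⟨f x.1 y.1, hZ _ x.2 _ y.2⟩)
    (fun x x' y => by rw [← map_add]; congr 1; ext; simp)
    (fun c x y => by rw [← map_smul]; congr 1; ext; simp)
    (fun x y y' => by rw [← map_add]; congr 1; ext; simp)
    (fun c x y => by rw [← map_smul]; congr 1; ext; simp)
  let Φ₁ := (B₁.submoduleOf Z₁).liftQ g fun x hx => by
    refine LinearMap.ext fun y => ?_
    exact cls_eq_zero_iff.2 (h₁ _ hx _ y.2)
  -- The bilinear map is descended one variable at a time; flipping makes the second variable the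
  -- one to be lifted.
  let Φ₂ := (B₂.submoduleOf Z₂).liftQ Φ₁.flip fun y hy => by
    refine LinearMap.ext fun x => ?_
    induction x using Submodule.Quotient.induction_on with | _ x
    exact cls_eq_zero_iff.2 (h₂ _ x.2 _ hy)
  exact ⟨Φ₂.flip, fun x y => ⟨hZ _ x.2 _ y.2, rfl⟩⟩

theorem exists_equiv_quotient {Z₁ B₁ : Submodule ℂ C₁} {Z₂ B₂ : Submodule ℂ C₂}
    (f : C₁ →ₗ[ℂ] C₂) (hZ : ∀ x ∈ Z₁, f x ∈ Z₂) (hB : ∀ x ∈ B₁, f x ∈ B₂)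
    (hinj : ∀ x ∈ Z₁, f x ∈ B₂ → x ∈ B₁) (hsurj : ∀ y ∈ Z₂, ∃ x ∈ Z₁, f x - y ∈ B₂) :
    ∃ e : (Z₁ ⧸ B₁.submoduleOf Z₁) ≃ₗ[ℂ] (Z₂ ⧸ B₂.submoduleOf Z₂),
      ∀ x : Z₁, ∃ h : f x.1 ∈ Z₂, e (cls x) = cls ⟨f x.1, h⟩ := by
  let g : (Z₁ ⧸ B₁.submoduleOf Z₁) →ₗ[ℂ] (Z₂ ⧸ B₂.submoduleOf Z₂) :=
    (B₁.submoduleOf Z₁).liftQ ((B₂.submoduleOf Z₂).mkQ ∘ₗ f.restrict hZ)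
      fun x hx => cls_eq_zero_iff.2 (hB _ hx)
  refine ⟨LinearEquiv.ofBijective g ⟨?_, fun y => ?_⟩, fun x => ⟨hZ _ x.2, rfl⟩⟩
  · rw [← LinearMap.ker_eq_bot, LinearMap.ker_eq_bot']
    intro x hx
    induction x using Submodule.Quotient.induction_on with | _ x
    exact cls_eq_zero_iff.2 (hinj _ x.2 (cls_eq_zero_iff.1 hx))
  · induction y using Submodule.Quotient.induction_on with | _ y
    obtain ⟨x, hx, h⟩ := hsurj _ y.2
    exact ⟨cls ⟨x, hx⟩, cls_eq_cls_iff.2 h⟩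
end Quotients

/-! ### Identities between forms on a single open set, later applied on the overlap. -/

section CupIdentities
variable {E : Type*} [NormedAddCommGroup E] [NormedSpace ℂ E]
  {M : Type*} [TopologicalSpace M] [ChartedSpace E M]
  {U : Opens M} {m n p q r s : ℤ}

theorem mem_formsOfType_congr {p' q' : ℤ} {α : Forms E U} (h : α ∈ formsOfType E p q U)
    (hp : p = p') (hq : q = q') : α ∈ formsOfType E p' q' U := hp ▸ hq ▸ h

variable [IsManifold 𝓘(ℂ, E) ω M]

/-- With the sign as a parameter `ε`, a case split on its value turns every sign in the identities
below into `1` or `-1`, and they become linear relations that `module` decides. -/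
theorem del_wedge_of_sign {ε : ℂ} {α : Forms E U} (hα : α ∈ formsOfType E p q U)
    (hε : (-1 : ℂ) ^ (p + q) = ε) (β : Forms E U) :
    del (wedge α β) = wedge (del α) β + ε • wedge α (del β) := hε ▸ del_wedge hα β

theorem delbar_wedge_of_sign {ε : ℂ} {α : Forms E U} (hα : α ∈ formsOfType E p q U)
    (hε : (-1 : ℂ) ^ (p + q) = ε) (β : Forms E U) :
    delbar (wedge α β) = wedge (delbar α) β + ε • wedge α (delbar β) := hε ▸ delbar_wedge hα β

theorem neg_one_zpow_eq (k : ℤ) : (-1 : ℂ) ^ k = 1 ∨ (-1 : ℂ) ^ k = -1 := by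
  rcases Int.even_or_odd k with h | h
  · exact Or.inl h.neg_one_zpow
  · exact Or.inr h.neg_one_zpow

theorem neg_one_zpow_of_odd_sub {k l : ℤ} (h : Odd (k - l)) :
    (-1 : ℂ) ^ k = -(-1 : ℂ) ^ l := by
  rw [← sub_add_cancel k l, zpow_add₀ (by norm_num), h.neg_one_zpow, neg_one_mul]

theorem neg_one_zpow_of_even_sub {k l : ℤ} (h : Even (k - l)) :
    (-1 : ℂ) ^ k = (-1 : ℂ) ^ l := by
  rw [← sub_add_cancel k l, zpow_add₀ (by norm_num), h.neg_one_zpow, one_mul]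

theorem wedge_delbar_of_closed {σ : Forms E U} (hσ : σ ∈ formsOfType E p q U) (h : d σ = 0)
    (x : Forms E U) : wedge σ (delbar x) = delbar ((-1 : ℂ) ^ (p + q) • wedge σ x) := by
  rw [map_smul, delbar_wedge hσ, delbar_eq_zero_of_d_eq_zero hσ h]
  rcases neg_one_zpow_eq (p + q) with e | e <;> simp [e]

theorem wedge_del_of_closed {σ : Forms E U} (hσ : σ ∈ formsOfType E p q U) (h : d σ = 0)
    (x : Forms E U) : wedge σ (del x) = del ((-1 : ℂ) ^ (p + q) • wedge σ x) := by
  rw [map_smul, del_wedge hσ, del_eq_zero_of_d_eq_zero hσ h]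
  rcases neg_one_zpow_eq (p + q) with e | e <;> simp [e]

theorem delbar_del_wedge_of_closed {σ : Forms E U} (hσ : σ ∈ formsOfType E p q U) (h : d σ = 0)
    {ξ : Forms E U} (hξ : delbar (del ξ) = 0) : delbar (del (wedge σ ξ)) = 0 := by
  rw [del_wedge hσ, del_eq_zero_of_d_eq_zero hσ h, map_zero, LinearMap.zero_apply, zero_add,
    map_smul, delbar_wedge hσ, hξ, delbar_eq_zero_of_d_eq_zero hσ h]
  simp

/-- If `ξ` is `∂̄∂`-closed then `∂̄∂τ ∧ ξ` is the Aeppli coboundary of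
`(∂τ ∧ ξ - ∂(τ ∧ ξ) / 2, -∂̄τ ∧ ξ + ∂̄(τ ∧ ξ) / 2)`. -/
theorem delbar_del_wedge_eq {τ ξ : Forms E U} (hτ : τ ∈ formsOfType E m n U)
    (hξt : ξ ∈ formsOfType E r s U) (hξ : delbar (del ξ) = 0) :
    wedge (delbar (del τ)) ξ =
      delbar (wedge (del τ) ξ - (1 / 2 : ℂ) • del (wedge τ ξ)) +
        del (-wedge (delbar τ) ξ + (1 / 2 : ℂ) • delbar (wedge τ ξ)) := by
  have hξ' := del_delbar hξt
  rw [hξ, neg_zero] at hξ'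
  have e1 := neg_one_zpow_of_odd_sub (k := m + 1 + n) (l := m + n) ⟨0, by ring⟩
  have e2 := neg_one_zpow_of_odd_sub (k := m + (n + 1)) (l := m + n) ⟨0, by ring⟩
  -- Write `ε` for the sign. The terms without `1/2` give `2 ∂̄∂τ ∧ ξ - ε ∂τ ∧ ∂̄ξ + ε ∂̄τ ∧ ∂ξ`.
  -- The two halves add up to `-∂̄∂(τ ∧ ξ)`, which removes the mixed terms and one copy of `∂̄∂τ ∧
  -- ξ`; its last term `τ ∧ ∂̄∂ξ` is `0`.
  rcases neg_one_zpow_eq (m + n) with e | e <;>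
  · rw [e] at e1 e2
    simp only [map_add, map_sub, map_neg, map_smul, del_wedge_of_sign hτ e,
      delbar_wedge_of_sign hτ e, delbar_wedge_of_sign (del_mem hτ) e1,
      del_wedge_of_sign (delbar_mem hτ) e2, hξ, hξ', map_zero, del_delbar hτ,
      LinearMap.neg_apply]
    module

variable {t₀ t₁ T₁ T₂ S X₀ X₁ x₁ x₂ : Forms E U}

/-- By linearity in `S` and `X₀` the defect splits into four parts. `∂̄∂t₀ ∧ x₁` combines with the
terms in `t₀, ∂̄x₁` into `∂̄(∂t₀ ∧ x₁)`, up to sign and a half of `∂(t₀ ∧ ∂̄x₁)`; the terms in `t₀,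
∂x₂` and in `∂T₂` are `∂`-exact; those in `∂̄T₁` use `∂̄T₁ ∧ ∂X₁ = ∂̄(T₁ ∧ ∂X₁)`, which needs `∂̄∂X₁
= 0`. -/
theorem cup_coboundaryBC_fst (ht₀ : t₀ ∈ formsOfType E m n U) (ht₁ : t₁ ∈ formsOfType E m n U)
    (hT₁ : T₁ ∈ formsOfType E m (n - 1) U) (hT₂ : T₂ ∈ formsOfType E (m - 1) n U)
    (hx₁ : x₁ ∈ formsOfType E r (s - 1) U) (hx₂ : x₂ ∈ formsOfType E (r - 1) s U)
    (hX : delbar (del X₁) = 0) (hS : S = t₁ - t₀ - delbar T₁ - del T₂)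
    (hXX : X₁ - X₀ - delbar x₁ - del x₂ = 0) :
    (-1 : ℂ) ^ (m + n) • wedge (delbar (del t₀)) x₁ + wedge (del S) X₁ -
        (1 / 2 : ℂ) • del (wedge S X₁) =
      (wedge (del t₁) X₁ - (1 / 2 : ℂ) • del (wedge t₁ X₁)) -
        (wedge (del t₀) X₀ - (1 / 2 : ℂ) • del (wedge t₀ X₀)) -
        delbar (-((-1 : ℂ) ^ (m + n) • (wedge (del t₀) x₁ + wedge T₁ (del X₁)))) -
        del ((1 / 2 : ℂ) • (wedge t₀ (del x₂) - wedge t₀ (delbar x₁) + wedge (delbar T₁) X₁ -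
          wedge (del T₂) X₁)) := by
  obtain rfl : X₀ = X₁ - delbar x₁ - del x₂ := by
    rw [← sub_eq_zero, ← neg_eq_zero, ← hXX]; abel
  subst hS
  have e1 := neg_one_zpow_of_odd_sub (k := m + 1 + n) (l := m + n) ⟨0, by ring⟩
  have e2 := neg_one_zpow_of_odd_sub (k := m + (n - 1)) (l := m + n) ⟨-1, by ring⟩
  have e3 := neg_one_zpow_of_odd_sub (k := m - 1 + n) (l := m + n) ⟨-1, by ring⟩
  have e4 := neg_one_zpow_of_even_sub (k := m + (n - 1 + 1)) (l := m + n) ⟨0, by ring⟩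
  have e5 := neg_one_zpow_of_even_sub (k := m - 1 + 1 + n) (l := m + n) ⟨0, by ring⟩
  rcases neg_one_zpow_eq (m + n) with e | e <;>
  · rw [e] at e1 e2 e3 e4 e5
    simp only [e, map_add, map_sub, map_neg, map_smul, del_wedge_of_sign ht₀ e, del_wedge_of_sign ht₁ e, delbar_wedge_of_sign (del_mem ht₀) e1,
      delbar_wedge_of_sign hT₁ e2, del_wedge_of_sign (delbar_mem hT₁) e4,
      del_wedge_of_sign (del_mem hT₂) e5, hX, map_zero, del_delbar hT₁, del_delbar hx₁,
      del_del hx₂, del_del hT₂, LinearMap.sub_apply, LinearMap.neg_apply, LinearMap.zero_apply]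
    module

/-- The counterpart with the roles of `∂` and `∂̄` exchanged. The form with coefficient `1/2` is the
same as in `cup_coboundaryBC_fst`, as the definition of Aeppli coboundaries requires. -/
theorem cup_coboundaryBC_snd (ht₀ : t₀ ∈ formsOfType E m n U) (ht₁ : t₁ ∈ formsOfType E m n U)
    (hT₁ : T₁ ∈ formsOfType E m (n - 1) U) (hT₂ : T₂ ∈ formsOfType E (m - 1) n U)
    (hx₁ : x₁ ∈ formsOfType E r (s - 1) U)
    (hXt : X₁ ∈ formsOfType E r s U)
    (hX : delbar (del X₁) = 0) (hS : S = t₁ - t₀ - delbar T₁ - del T₂)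
    (hXX : X₁ - X₀ - delbar x₁ - del x₂ = 0) :
    (-1 : ℂ) ^ (m + n) • wedge (delbar (del t₀)) x₂ - wedge (delbar S) X₁ +
        (1 / 2 : ℂ) • delbar (wedge S X₁) =
      (-wedge (delbar t₁) X₁ + (1 / 2 : ℂ) • delbar (wedge t₁ X₁)) -
        (-wedge (delbar t₀) X₀ + (1 / 2 : ℂ) • delbar (wedge t₀ X₀)) -
        delbar ((1 / 2 : ℂ) • (wedge t₀ (del x₂) - wedge t₀ (delbar x₁) + wedge (delbar T₁) X₁ -
          wedge (del T₂) X₁)) -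
        del ((-1 : ℂ) ^ (m + n) • (wedge (delbar t₀) x₂ + wedge T₂ (delbar X₁))) := by
  have hX' := del_delbar hXt
  rw [hX, neg_zero] at hX'
  obtain rfl : X₀ = X₁ - delbar x₁ - del x₂ := by
    rw [← sub_eq_zero, ← neg_eq_zero, ← hXX]; abel
  subst hS
  have e1 := neg_one_zpow_of_odd_sub (k := m + (n + 1)) (l := m + n) ⟨0, by ring⟩
  have e2 := neg_one_zpow_of_odd_sub (k := m + (n - 1)) (l := m + n) ⟨-1, by ring⟩
  have e3 := neg_one_zpow_of_odd_sub (k := m - 1 + n) (l := m + n) ⟨-1, by ring⟩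
  have e4 := neg_one_zpow_of_even_sub (k := m + (n - 1 + 1)) (l := m + n) ⟨0, by ring⟩
  have e5 := neg_one_zpow_of_even_sub (k := m - 1 + 1 + n) (l := m + n) ⟨0, by ring⟩
  rcases neg_one_zpow_eq (m + n) with e | e <;>
  · rw [e] at e1 e2 e3 e4 e5
    simp only [e, map_add, map_sub, map_neg, map_smul,
      delbar_wedge_of_sign ht₀ e, delbar_wedge_of_sign ht₁ e,
      del_wedge_of_sign (delbar_mem ht₀) e1,
      del_wedge_of_sign hT₂ e3, delbar_wedge_of_sign (delbar_mem hT₁) e4,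
      delbar_wedge_of_sign (del_mem hT₂) e5, hX', map_zero, del_delbar ht₀,
      delbar_delbar hx₁, delbar_delbar hT₁, LinearMap.sub_apply, LinearMap.neg_apply,
      LinearMap.zero_apply]
    module

variable {σ₀ σ₁ a₀ a₁ b₀ b₁ η : Forms E U}

/-- Substituting the cocycle conditions for `σ₁` and `X₀` leaves `∂̄∂S ∧ X₁` and `σ₀ ∧ (∂̄x₁ +
∂x₂)`, treated by `delbar_del_wedge_eq` and by closedness of `σ₀`. -/
theorem cup_cocycle (hS : S ∈ formsOfType E m n U) (hσ₀ : σ₀ ∈ formsOfType E p q U)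
    (hσ₀' : d σ₀ = 0) (hσ : σ₁ - σ₀ - delbar (del S) = 0) (hXt : X₁ ∈ formsOfType E r s U)
    (hX : delbar (del X₁) = 0) (hXX : X₁ - X₀ - delbar x₁ - del x₂ = 0) :
    wedge σ₁ X₁ - wedge σ₀ X₀ -
      delbar ((-1 : ℂ) ^ (p + q) • wedge σ₀ x₁ + wedge (del S) X₁ -
        (1 / 2 : ℂ) • del (wedge S X₁)) -
      del ((-1 : ℂ) ^ (p + q) • wedge σ₀ x₂ - wedge (delbar S) X₁ +
        (1 / 2 : ℂ) • delbar (wedge S X₁)) = 0 := by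
  obtain rfl : σ₁ = σ₀ + delbar (del S) := by rw [← sub_eq_zero, ← hσ]; abel
  obtain rfl : X₀ = X₁ - delbar x₁ - del x₂ := by
    rw [← sub_eq_zero, ← neg_eq_zero, ← hXX]; abel
  have i1 := wedge_delbar_of_closed hσ₀ hσ₀' x₁
  have i2 := wedge_del_of_closed hσ₀ hσ₀' x₂
  have i3 := delbar_del_wedge_eq hS hXt hX
  simp only [map_add, map_sub, map_neg, LinearMap.add_apply] at i3 ⊢
  rw [← i1, ← i2, i3]
  abel

/-- The primitives are `± σᵢ ∧ aᵢ`. Replacing `σ₀` by `σ₁` in front of `a₁` costs `∂̄∂S ∧ a₁`, which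
together with `∂S ∧ ∂̄a₁` is `∂̄(∂S ∧ a₁)` up to sign. Everything else is `∂`-exact. In the
applications `S` has degree two less than `σ₀`, whence the equality `hε` of signs. -/
theorem cup_coboundaryA_fst (hS : S ∈ formsOfType E m n U) (hσ₀ : σ₀ ∈ formsOfType E p q U)
    (hε : (-1 : ℂ) ^ (m + n) = (-1) ^ (p + q)) (hσ₀' : d σ₀ = 0)
    (hσ : σ₁ - σ₀ - delbar (del S) = 0)
    (ha₁ : a₁ ∈ formsOfType E r (s - 1) U) (hb₁ : b₁ ∈ formsOfType E (r - 1) s U) :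
    (-1 : ℂ) ^ (p + q) • wedge σ₀ (a₁ - a₀ - del η) + wedge (del S) (delbar a₁ + del b₁) -
        (1 / 2 : ℂ) • del (wedge S (delbar a₁ + del b₁)) =
      (-1 : ℂ) ^ (p + q) • wedge σ₁ a₁ - (-1 : ℂ) ^ (p + q) • wedge σ₀ a₀ -
        delbar ((-1 : ℂ) ^ (p + q) • wedge (del S) a₁) -
        del (wedge σ₀ η + (1 / 2 : ℂ) • (wedge S (delbar a₁) - wedge S (del b₁))) := by
  obtain rfl : σ₁ = σ₀ + delbar (del S) := by rw [← sub_eq_zero, ← hσ]; abel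
  have h1 := del_eq_zero_of_d_eq_zero hσ₀ hσ₀'
  have e1 := neg_one_zpow_of_odd_sub (k := m + 1 + n) (l := m + n) ⟨0, by ring⟩
  rcases neg_one_zpow_eq (p + q) with e | e <;>
  · rw [e] at hε
    rw [hε] at e1
    simp only [e, map_add, map_sub, map_smul, del_wedge_of_sign hS hε,
      delbar_wedge_of_sign (del_mem hS) e1, del_wedge_of_sign hσ₀ e, h1, map_zero,
      del_delbar ha₁, del_del hb₁, LinearMap.add_apply, LinearMap.zero_apply, map_neg]
    module

theorem cup_coboundaryA_snd (hS : S ∈ formsOfType E m n U) (hσ₀ : σ₀ ∈ formsOfType E p q U)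
    (hε : (-1 : ℂ) ^ (m + n) = (-1) ^ (p + q)) (hσ₀' : d σ₀ = 0)
    (hσ : σ₁ - σ₀ - delbar (del S) = 0)
    (ha₁ : a₁ ∈ formsOfType E r (s - 1) U) :
    (-1 : ℂ) ^ (p + q) • wedge σ₀ (b₁ - b₀ - delbar η) - wedge (delbar S) (delbar a₁ + del b₁) +
        (1 / 2 : ℂ) • delbar (wedge S (delbar a₁ + del b₁)) =
      (-1 : ℂ) ^ (p + q) • wedge σ₁ b₁ - (-1 : ℂ) ^ (p + q) • wedge σ₀ b₀ -
        delbar (wedge σ₀ η + (1 / 2 : ℂ) • (wedge S (delbar a₁) - wedge S (del b₁))) -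
        del (-((-1 : ℂ) ^ (p + q) • wedge (delbar S) b₁)) := by
  obtain rfl : σ₁ = σ₀ + delbar (del S) := by rw [← sub_eq_zero, ← hσ]; abel
  have h1 := delbar_eq_zero_of_d_eq_zero hσ₀ hσ₀'
  have e1 := neg_one_zpow_of_odd_sub (k := m + (n + 1)) (l := m + n) ⟨0, by ring⟩
  rcases neg_one_zpow_eq (p + q) with e | e <;>
  · rw [e] at hε
    rw [hε] at e1
    simp only [e, map_add, map_sub, map_smul, delbar_wedge_of_sign hS hε,
      del_wedge_of_sign (delbar_mem hS) e1, delbar_wedge_of_sign hσ₀ e, h1, map_zero,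
      del_delbar hS, delbar_delbar ha₁, LinearMap.add_apply, LinearMap.zero_apply, map_neg,
      LinearMap.neg_apply]
    module
end CupIdentities

/-! ### The products on cochains and classes, and the comparison of global with Čech classes. -/

section CupProduct
variable {E : Type*} [NormedAddCommGroup E] [NormedSpace ℂ E]
  {M : Type*} [TopologicalSpace M] [ChartedSpace E M] [IsManifold 𝓘(ℂ, E) ω M]
  {U U₀ U₁ : Opens M} {p q r s : ℤ}

/-- Types such as `q - 1 + 1` and `q` are equal only propositionally; this variant and the next two
absorb the rewriting. -/
theorem delbar_mem_of_eq {q' : ℤ} {α : Forms E U} (h : α ∈ formsOfType E p q U)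
    (hq : q + 1 = q') : delbar α ∈ formsOfType E p q' U := hq ▸ delbar_mem h

theorem del_mem_of_eq {p' : ℤ} {α : Forms E U} (h : α ∈ formsOfType E p q U)
    (hp : p + 1 = p') : del α ∈ formsOfType E p' q U := hp ▸ del_mem h

theorem wedge_mem_of_eq {p' q' : ℤ} {α β : Forms E U} (hα : α ∈ formsOfType E p q U)
    (hβ : β ∈ formsOfType E r s U) (hp : p + r = p') (hq : q + s = q') :
    wedge α β ∈ formsOfType E p' q' U :=
  mem_formsOfType_congr (wedge_mem hα hβ) hp hq

/-! ### Products of global classes -/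

theorem wedge_mem_cocyclesA {σ ξ : Forms E U} (hσ : σ ∈ cocyclesBC E p q U)
    (hξ : ξ ∈ cocyclesA E r s U) : wedge σ ξ ∈ cocyclesA E (p + r) (q + s) U :=
  ⟨wedge_mem hσ.1 hξ.1, delbar_del_wedge_of_closed hσ.1 hσ.2 hξ.2⟩

/-- The `∂̄`-primitive part of `∂̄∂τ ∧ ξ` for a `∂̄∂`-closed form `ξ`. -/
def primFst (τ ξ : Forms E U) : Forms E U :=
  wedge (del τ) ξ - (1 / 2 : ℂ) • del (wedge τ ξ)

/-- The `∂`-primitive part of `∂̄∂τ ∧ ξ` for a `∂̄∂`-closed form `ξ`. -/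
def primSnd (τ ξ : Forms E U) : Forms E U :=
  -wedge (delbar τ) ξ + (1 / 2 : ℂ) • delbar (wedge τ ξ)

theorem primFst_mem {τ ξ : Forms E U} (hτ : τ ∈ formsOfType E (p - 1) (q - 1) U)
    (hξ : ξ ∈ formsOfType E r s U) : primFst τ ξ ∈ formsOfType E (p + r) (q + s - 1) U :=
  sub_mem (wedge_mem_of_eq (del_mem hτ) hξ (by ring) (by ring))
    (Submodule.smul_mem _ _ (mem_formsOfType_congr (del_mem (wedge_mem hτ hξ)) (by ring) (by ring)))

theorem primSnd_mem {τ ξ : Forms E U} (hτ : τ ∈ formsOfType E (p - 1) (q - 1) U)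
    (hξ : ξ ∈ formsOfType E r s U) : primSnd τ ξ ∈ formsOfType E (p + r - 1) (q + s) U :=
  add_mem (neg_mem (wedge_mem_of_eq (delbar_mem hτ) hξ (by ring) (by ring)))
    (Submodule.smul_mem _ _
      (mem_formsOfType_congr (delbar_mem (wedge_mem hτ hξ)) (by ring) (by ring)))

theorem res_primFst {V : Opens M} (h : V ≤ U) (τ ξ : Forms E U) :
    res h (primFst τ ξ) = primFst (res h τ) (res h ξ) := by
  simp only [primFst, map_sub, map_smul, ← del_res, ← wedge_res]

theorem res_primSnd {V : Opens M} (h : V ≤ U) (τ ξ : Forms E U) :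
    res h (primSnd τ ξ) = primSnd (res h τ) (res h ξ) := by
  simp only [primSnd, map_add, map_neg, map_smul, ← delbar_res, ← wedge_res]

theorem wedge_mem_coboundariesA_of_left {σ ξ : Forms E U} (hσ : σ ∈ coboundariesBC E p q U)
    (hξ : ξ ∈ cocyclesA E r s U) : wedge σ ξ ∈ coboundariesA E (p + r) (q + s) U := by
  obtain ⟨τ, hτ, rfl⟩ := hσ
  exact ⟨primFst τ ξ, primFst_mem hτ hξ.1, primSnd τ ξ, primSnd_mem hτ hξ.1,
    delbar_del_wedge_eq hτ hξ.1 hξ.2⟩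

theorem wedge_mem_coboundariesA_of_right {σ ξ : Forms E U} (hσ : σ ∈ cocyclesBC E p q U)
    (hξ : ξ ∈ coboundariesA E r s U) : wedge σ ξ ∈ coboundariesA E (p + r) (q + s) U := by
  obtain ⟨a, ha, b, hb, rfl⟩ := hξ
  refine ⟨(-1 : ℂ) ^ (p + q) • wedge σ a, Submodule.smul_mem _ _
    (wedge_mem_of_eq hσ.1 ha (by ring) (by ring)), (-1 : ℂ) ^ (p + q) • wedge σ b,
    Submodule.smul_mem _ _ (wedge_mem_of_eq hσ.1 hb (by ring) (by ring)), ?_⟩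
  rw [map_add, wedge_delbar_of_closed hσ.1 hσ.2, wedge_del_of_closed hσ.1 hσ.2]

/-! ### The cup product -/

/-- The cup product as a bilinear map. -/
def cupBilin (p q : ℤ) (U₀ U₁ : Opens M) :
    Triple E U₀ U₁ →ₗ[ℂ] Quadruple E U₀ U₁ →ₗ[ℂ] Quadruple E U₀ U₁ :=
  LinearMap.mk₂ ℂ (cup p q)
    (fun σ σ' ξ => by
      ext1
      · simp [cup]
      ext1
      · simp [cup]
      ext1 <;>
      · simp only [cup, Prod.fst_add, Prod.snd_add, map_add, LinearMap.add_apply]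
        module)
    (fun c σ ξ => by
      ext1
      · simp [cup]
      ext1
      · simp [cup]
      ext1 <;>
      · simp only [cup, Prod.smul_fst, Prod.smul_snd, map_smul, LinearMap.smul_apply]
        module)
    (fun σ ξ ξ' => by
      ext1
      · simp [cup]
      ext1
      · simp [cup]
      ext1 <;>
      · simp only [cup, Prod.fst_add, Prod.snd_add, map_add]
        module)
    (fun c σ ξ => by
      ext1
      · simp [cup]
      ext1
      · simp [cup]
      ext1 <;>
      · simp only [cup, Prod.smul_fst, Prod.smul_snd, map_smul]
        module)

theorem cup_mem_cochainsA {σ : Triple E U₀ U₁} (hσ : σ ∈ cochainsBC E p q U₀ U₁)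
    {ξ : Quadruple E U₀ U₁} (hξ : ξ ∈ cochainsA E r s U₀ U₁) :
    cup p q σ ξ ∈ cochainsA E (p + r) (q + s) U₀ U₁ := by
  obtain ⟨σ₀, σ₁, S⟩ := σ
  obtain ⟨ξ₀, ξ₁, x₁, x₂⟩ := ξ
  obtain ⟨h0, h1, h2⟩ := hσ
  obtain ⟨k0, k1, k2, k3⟩ := hξ
  have h := primFst_mem h2 (res_mem inf_le_right k1)
  have h' := primSnd_mem h2 (res_mem inf_le_right k1)
  refine ⟨wedge_mem h0 k0, wedge_mem h1 k1, ?_, ?_⟩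
  · have e : (cup p q (σ₀, σ₁, S) (ξ₀, ξ₁, x₁, x₂)).2.2.1 =
      (-1 : ℂ) ^ (p + q) • wedge (res₀ σ₀) x₁ + primFst S (res₁ ξ₁) := add_sub_assoc _ _ _
    rw [SetLike.mem_coe, e]
    exact add_mem (Submodule.smul_mem _ _
      (wedge_mem_of_eq (res_mem inf_le_left h0) k2 rfl (by ring))) h
  · have e : (cup p q (σ₀, σ₁, S) (ξ₀, ξ₁, x₁, x₂)).2.2.2 =
      (-1 : ℂ) ^ (p + q) • wedge (res₀ σ₀) x₂ + primSnd S (res₁ ξ₁) := by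
      simp only [cup, primSnd]; abel
    rw [SetLike.mem_coe, e]
    exact add_mem (Submodule.smul_mem _ _
      (wedge_mem_of_eq (res_mem inf_le_left h0) k3 (by ring) rfl)) h'

theorem cup_mem_cechCocyclesA {σ : Triple E U₀ U₁} (hσ : σ ∈ cechCocyclesBC E p q U₀ U₁)
    {ξ : Quadruple E U₀ U₁} (hξ : ξ ∈ cechCocyclesA E r s U₀ U₁) :
    cup p q σ ξ ∈ cechCocyclesA E (p + r) (q + s) U₀ U₁ := by
  refine ⟨cup_mem_cochainsA hσ.1 hξ.1, ?_⟩
  obtain ⟨σ₀, σ₁, S⟩ := σ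
  obtain ⟨ξ₀, ξ₁, x₁, x₂⟩ := ξ
  obtain ⟨⟨h0, h1, h2⟩, d0, d1, hs⟩ := hσ
  obtain ⟨⟨k0, k1, k2, k3⟩, c0, c1, hx⟩ := hξ
  dsimp only at h0 h1 h2 d0 d1 hs k0 k1 k2 k3 c0 c1 hx
  refine ⟨delbar_del_wedge_of_closed h0 d0 c0, delbar_del_wedge_of_closed h1 d1 c1, ?_⟩
  have d0' : d (res₀ σ₀ : Forms E (U₀ ⊓ U₁)) = 0 := by rw [d_res, d0, map_zero]
  have c1' : delbar (del (res₁ ξ₁ : Forms E (U₀ ⊓ U₁))) = 0 := by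
    rw [del_res, delbar_res, c1, map_zero]
  have h := cup_cocycle h2 (res_mem inf_le_left h0) d0' hs (res_mem inf_le_right k1) c1' hx
  rw [wedge_res, wedge_res] at h
  exact h

section Partition
variable [FiniteDimensional ℂ E] [T2Space M] [SecondCountableTopology M]

/-- Čech–Aeppli coboundaries may be modified by `∂̄η₀₁⁽¹¹⁾` and `∂η₀₁⁽²²⁾`, as in the relative
case: a partition of unity absorbs these terms into the components on `U₀` and `U₁`. -/
theorem mem_cechCoboundariesA_of (hU : U₀ ⊔ U₁ = ⊤) {ξ : Quadruple E U₀ U₁}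
    {a₀ b₀ : Forms E U₀} {a₁ b₁ : Forms E U₁} {u v w : Forms E (U₀ ⊓ U₁)}
    (ha₀ : a₀ ∈ formsOfType E p (q - 1) U₀) (hb₀ : b₀ ∈ formsOfType E (p - 1) q U₀)
    (ha₁ : a₁ ∈ formsOfType E p (q - 1) U₁) (hb₁ : b₁ ∈ formsOfType E (p - 1) q U₁)
    (hu : u ∈ formsOfType E p (q - 2) (U₀ ⊓ U₁))
    (hv : v ∈ formsOfType E (p - 1) (q - 1) (U₀ ⊓ U₁))
    (hw : w ∈ formsOfType E (p - 2) q (U₀ ⊓ U₁))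
    (e₀ : ξ.1 = delbar a₀ + del b₀) (e₁ : ξ.2.1 = delbar a₁ + del b₁)
    (e₂ : ξ.2.2.1 = res₁ a₁ - res₀ a₀ - delbar u - del v)
    (e₃ : ξ.2.2.2 = res₁ b₁ - res₀ b₀ - delbar v - del w) :
    ξ ∈ cechCoboundariesA E p q U₀ U₁ := by
  -- Once `u = u₁ - u₀` and `w = w₁ - w₀`, the primitives `aᵢ - ∂̄uᵢ` and `bᵢ - ∂wᵢ` produce the
  -- same forms on `Uᵢ`, as `∂̄² = ∂² = 0`, and account for `∂̄u` and `∂w` on the overlap.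
  obtain ⟨u₀, u₁, rfl, hu'⟩ := exists_split hU u
  obtain ⟨w₀, w₁, rfl, hw'⟩ := exists_split hU w
  obtain ⟨hu₀, hu₁⟩ := hu' _ _ hu
  obtain ⟨hw₀, hw₁⟩ := hw' _ _ hw
  refine ⟨a₀ - delbar u₀, sub_mem ha₀ (delbar_mem_of_eq hu₀ (by ring)),
    b₀ - del w₀, sub_mem hb₀ (del_mem_of_eq hw₀ (by ring)),
    a₁ - delbar u₁, sub_mem ha₁ (delbar_mem_of_eq hu₁ (by ring)),
    b₁ - del w₁, sub_mem hb₁ (del_mem_of_eq hw₁ (by ring)), v, hv, ?_, ?_, ?_, ?_⟩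
  · rw [e₀, map_sub, map_sub, delbar_delbar hu₀, del_del hw₀, sub_zero, sub_zero]
  · rw [e₁, map_sub, map_sub, delbar_delbar hu₁, del_del hw₁, sub_zero, sub_zero]
  · rw [e₂]
    simp only [map_sub, delbar_res]
    abel
  · rw [e₃]
    simp only [map_sub, del_res]
    abel

theorem cup_mem_cechCoboundariesA_of_left (hU : U₀ ⊔ U₁ = ⊤) {σ : Triple E U₀ U₁}
    (hσ : σ ∈ cechCoboundariesBC E p q U₀ U₁) {ξ : Quadruple E U₀ U₁}
    (hξ : ξ ∈ cechCocyclesA E r s U₀ U₁) :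
    cup p q σ ξ ∈ cechCoboundariesA E (p + r) (q + s) U₀ U₁ := by
  obtain ⟨σ₀, σ₁, S⟩ := σ
  obtain ⟨ξ₀, ξ₁, x₁, x₂⟩ := ξ
  obtain ⟨⟨t₀, t₁, T₁, T₂⟩, ⟨ht₀, ht₁, hT₁, hT₂⟩, h0, h1, hS⟩ := hσ
  obtain ⟨⟨k0, k1, k2, k3⟩, c0, c1, hx⟩ := hξ
  dsimp only at ht₀ ht₁ hT₁ hT₂ h0 h1 hS k0 k1 k2 k3 c0 c1 hx
  subst h0 h1
  have c1' : delbar (del (res₁ ξ₁ : Forms E (U₀ ⊓ U₁))) = 0 := by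
    rw [del_res, delbar_res, c1, map_zero]
  have ht₀' := res_mem (inf_le_left : U₀ ⊓ U₁ ≤ U₀) ht₀
  have ht₁' := res_mem (inf_le_right : U₀ ⊓ U₁ ≤ U₁) ht₁
  have k1' := res_mem (inf_le_right : U₀ ⊓ U₁ ≤ U₁) k1
  have hε : (-1 : ℂ) ^ (p + q) = (-1) ^ (p - 1 + (q - 1)) :=
    neg_one_zpow_of_even_sub ⟨1, by ring⟩
  refine mem_cechCoboundariesA_of hU (primFst_mem ht₀ k0) (primSnd_mem ht₀ k0)
    (primFst_mem ht₁ k1) (primSnd_mem ht₁ k1) ?_ ?_ ?_ (delbar_del_wedge_eq ht₀ k0 c0)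
    (delbar_del_wedge_eq ht₁ k1 c1)
    -- The three overlap corrections are read off from `cup_coboundaryBC_fst` and
    -- `cup_coboundaryBC_snd`, with `m = p - 1` and `n = q - 1`.
    (u := -((-1 : ℂ) ^ (p - 1 + (q - 1)) •
      (wedge (del (res₀ t₀)) x₁ + wedge T₁ (del (res₁ ξ₁)))))
    (v := (1 / 2 : ℂ) • (wedge (res₀ t₀) (del x₂) - wedge (res₀ t₀) (delbar x₁) +
      wedge (delbar T₁) (res₁ ξ₁) - wedge (del T₂) (res₁ ξ₁)))
    (w := (-1 : ℂ) ^ (p - 1 + (q - 1)) •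
      (wedge (delbar (res₀ t₀)) x₂ + wedge T₂ (delbar (res₁ ξ₁)))) ?_ ?_
  · exact neg_mem (Submodule.smul_mem _ _ (add_mem
      (wedge_mem_of_eq (del_mem ht₀') k2 (by ring) (by ring))
      (wedge_mem_of_eq hT₁ (del_mem k1') (by ring) (by ring))))
  · exact Submodule.smul_mem _ _ (sub_mem (add_mem (sub_mem
      (wedge_mem_of_eq ht₀' (del_mem k3) (by ring) (by ring))
      (wedge_mem_of_eq ht₀' (delbar_mem k2) (by ring) (by ring)))
      (wedge_mem_of_eq (delbar_mem hT₁) k1' (by ring) (by ring)))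
      (wedge_mem_of_eq (del_mem hT₂) k1' (by ring) (by ring)))
  · exact Submodule.smul_mem _ _ (add_mem
      (wedge_mem_of_eq (delbar_mem ht₀') k3 (by ring) (by ring))
      (wedge_mem_of_eq hT₂ (delbar_mem k1') (by ring) (by ring)))
  · rw [res_primFst, res_primFst]
    dsimp only [cup]
    rw [hε, ← delbar_res, ← del_res]
    exact cup_coboundaryBC_fst ht₀' ht₁' hT₁ hT₂ k2 k3 c1' hS hx
  · rw [res_primSnd, res_primSnd]
    dsimp only [cup]
    rw [hε, ← delbar_res, ← del_res]
    exact cup_coboundaryBC_snd ht₀' ht₁' hT₁ hT₂ k2 k1' c1' hS hx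

theorem cup_mem_cechCoboundariesA_of_right (hU : U₀ ⊔ U₁ = ⊤) {σ : Triple E U₀ U₁}
    (hσ : σ ∈ cechCocyclesBC E p q U₀ U₁) {ξ : Quadruple E U₀ U₁}
    (hξ : ξ ∈ cechCoboundariesA E r s U₀ U₁) :
    cup p q σ ξ ∈ cechCoboundariesA E (p + r) (q + s) U₀ U₁ := by
  obtain ⟨σ₀, σ₁, S⟩ := σ
  obtain ⟨ξ₀, ξ₁, x₁, x₂⟩ := ξ
  obtain ⟨⟨h0, h1, h2⟩, d0, d1, hs⟩ := hσ
  obtain ⟨a₀, ha₀, b₀, hb₀, a₁, ha₁, b₁, hb₁, η, hη, e₀, e₁, e₂, e₃⟩ := hξ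
  dsimp only at h0 h1 h2 d0 d1 hs e₀ e₁ e₂ e₃
  subst e₀ e₁ e₂ e₃
  have d0' : d (res₀ σ₀ : Forms E (U₀ ⊓ U₁)) = 0 := by rw [d_res, d0, map_zero]
  have h0' := res_mem (inf_le_left : U₀ ⊓ U₁ ≤ U₀) h0
  have ha₁' := res_mem (inf_le_right : U₀ ⊓ U₁ ≤ U₁) ha₁
  have hb₁' := res_mem (inf_le_right : U₀ ⊓ U₁ ≤ U₁) hb₁
  have hε : (-1 : ℂ) ^ (p - 1 + (q - 1)) = (-1) ^ (p + q) :=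
    neg_one_zpow_of_even_sub ⟨-1, by ring⟩
  refine mem_cechCoboundariesA_of hU
    -- As `σᵢ` is closed, `σᵢ ∧ ∂̄aᵢ` and `σᵢ ∧ ∂bᵢ` have these primitives; the overlap corrections
    -- are those of `cup_coboundaryA_fst` and `cup_coboundaryA_snd`.
    (a₀ := (-1 : ℂ) ^ (p + q) • wedge σ₀ a₀) (b₀ := (-1 : ℂ) ^ (p + q) • wedge σ₀ b₀)
    (a₁ := (-1 : ℂ) ^ (p + q) • wedge σ₁ a₁) (b₁ := (-1 : ℂ) ^ (p + q) • wedge σ₁ b₁)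
    (u := (-1 : ℂ) ^ (p + q) • wedge (del S) (res₁ a₁))
    (v := wedge (res₀ σ₀) η + (1 / 2 : ℂ) • (wedge S (delbar (res₁ a₁)) -
      wedge S (del (res₁ b₁))))
    (w := -((-1 : ℂ) ^ (p + q) • wedge (delbar S) (res₁ b₁)))
    (Submodule.smul_mem _ _ (wedge_mem_of_eq h0 ha₀ (by ring) (by ring)))
    (Submodule.smul_mem _ _ (wedge_mem_of_eq h0 hb₀ (by ring) (by ring)))
    (Submodule.smul_mem _ _ (wedge_mem_of_eq h1 ha₁ (by ring) (by ring)))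
    (Submodule.smul_mem _ _ (wedge_mem_of_eq h1 hb₁ (by ring) (by ring)))
    (Submodule.smul_mem _ _ (wedge_mem_of_eq (del_mem h2) ha₁' (by ring) (by ring)))
    (add_mem (wedge_mem_of_eq h0' hη (by ring) (by ring)) (Submodule.smul_mem _ _ (sub_mem
      (wedge_mem_of_eq h2 (delbar_mem ha₁') (by ring) (by ring))
      (wedge_mem_of_eq h2 (del_mem hb₁') (by ring) (by ring)))))
    (neg_mem (Submodule.smul_mem _ _
      (wedge_mem_of_eq (delbar_mem h2) hb₁' (by ring) (by ring)))) ?_ ?_ ?_ ?_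
  · dsimp only [cup]
    rw [map_add, wedge_delbar_of_closed h0 d0, wedge_del_of_closed h0 d0]
  · dsimp only [cup]
    rw [map_add, wedge_delbar_of_closed h1 d1, wedge_del_of_closed h1 d1]
  · dsimp only [cup]
    rw [map_smul, map_smul, ← wedge_res, ← wedge_res, map_add, ← delbar_res, ← del_res]
    exact cup_coboundaryA_fst h2 h0' hε d0' hs ha₁' hb₁'
  · dsimp only [cup]
    rw [map_smul, map_smul, ← wedge_res, ← wedge_res, map_add, ← delbar_res, ← del_res]
    exact cup_coboundaryA_snd h2 h0' hε d0' hs ha₁'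

/-! ### Comparison of global and Čech classes -/

/-- `ω ↦ (ω|U₀, ω|U₁, 0)`. -/
def toTriple (U₀ U₁ : Opens M) : Forms E (⊤ : Opens M) →ₗ[ℂ] Triple E U₀ U₁ :=
  (res le_top).prod ((res le_top).prod 0)

/-- `ω ↦ (ω|U₀, ω|U₁, 0, 0)`. -/
def toQuadruple (U₀ U₁ : Opens M) : Forms E (⊤ : Opens M) →ₗ[ℂ] Quadruple E U₀ U₁ :=
  (res le_top).prod ((res le_top).prod 0)

theorem exists_equiv_CechHBC (hU : U₀ ⊔ U₁ = ⊤) (p q : ℤ) :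
    ∃ e : HBC E p q (⊤ : Opens M) ≃ₗ[ℂ] CechHBC E p q U₀ U₁,
      ∀ α : cocyclesBC E p q (⊤ : Opens M),
        ∃ h : toTriple U₀ U₁ α.1 ∈ cechCocyclesBC E p q U₀ U₁,
          e (cls α) = cls ⟨toTriple U₀ U₁ α.1, h⟩ := by
  refine exists_equiv_quotient (toTriple U₀ U₁) ?_ ?_ ?_ ?_
  · rintro α ⟨hα, h⟩
    refine ⟨⟨res_mem _ hα, res_mem _ hα, zero_mem _⟩, ?_, ?_, ?_⟩
    · exact (d_res _ _).trans (by rw [h, map_zero])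
    · exact (d_res _ _).trans (by rw [h, map_zero])
    · change res inf_le_right (res le_top α) - res inf_le_left (res le_top α) - delbar (del 0) = 0
      rw [res_res, res_res]
      simp
  · rintro _ ⟨τ, hτ, rfl⟩
    refine ⟨toQuadruple U₀ U₁ τ, ⟨res_mem _ hτ, res_mem _ hτ, zero_mem _, zero_mem _⟩, ?_, ?_, ?_⟩
    · change res _ _ = delbar (del (res _ _))
      rw [del_res, delbar_res]
    · change res _ _ = delbar (del (res _ _))
      rw [del_res, delbar_res]
    · change 0 = res inf_le_right (res le_top τ) - res inf_le_left (res le_top τ) -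
        delbar 0 - del 0
      rw [res_res, res_res]
      simp
  · rintro α ⟨hα, -⟩ ⟨⟨t₀, t₁, T₁, T₂⟩, ⟨ht₀, ht₁, hT₁, hT₂⟩, h0, h1, hS⟩
    dsimp only at ht₀ ht₁ hT₁ hT₂ h0 h1 hS
    obtain ⟨u₀, u₁, rfl, hu⟩ := exists_split hU T₁
    obtain ⟨w₀, w₁, rfl, hw⟩ := exists_split hU T₂
    obtain ⟨hu₀, hu₁⟩ := hu _ _ hT₁
    obtain ⟨hw₀, hw₁⟩ := hw _ _ hT₂
    -- Injectivity. The overlap component is `0`, so `t₁ - t₀ = ∂̄T₁ + ∂T₂`. After `T₁` and `T₂` are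
    -- split, the corrected forms agree on the overlap and glue to a global `τ`; the corrections are
    -- killed by `∂̄∂`.
    obtain ⟨τ, hτ₀, hτ₁⟩ := exists_glue hU (t₀ - delbar u₀ - del w₀) (t₁ - delbar u₁ - del w₁) (by
      have hS' : (0 : Forms E (U₀ ⊓ U₁)) = _ := hS
      rw [eq_comm, ← sub_eq_zero, hS']
      simp only [map_sub, delbar_res, del_res]
      abel)
    refine ⟨τ, mem_formsOfType_of_res hU ?_ ?_, Forms.ext_of_res hU ?_ ?_⟩
    · rw [hτ₀]
      exact sub_mem (sub_mem ht₀ (delbar_mem_of_eq hu₀ (by ring))) (del_mem_of_eq hw₀ (by ring))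
    · rw [hτ₁]
      exact sub_mem (sub_mem ht₁ (delbar_mem_of_eq hu₁ (by ring))) (del_mem_of_eq hw₁ (by ring))
    · rw [← delbar_res, ← del_res, hτ₀]
      refine h0.trans ?_
      simp [del_delbar hu₀, del_del hw₀, delbar_delbar (del_mem hu₀)]
    · rw [← delbar_res, ← del_res, hτ₁]
      refine h1.trans ?_
      simp [del_delbar hu₁, del_del hw₁, delbar_delbar (del_mem hu₁)]
  · rintro ⟨σ₀, σ₁, S⟩ ⟨⟨h0, h1, h2⟩, d0, d1, hs⟩
    dsimp only at h0 h1 h2 d0 d1 hs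
    obtain ⟨t₀, t₁, rfl, ht⟩ := exists_split hU S
    obtain ⟨ht₀, ht₁⟩ := ht _ _ h2
    -- Surjectivity. With `S = t₁ - t₀`, the cocycle condition says that the forms `σᵢ - ∂̄∂tᵢ`
    -- agree on the overlap. The glued form differs from the given cocycle by the coboundary of
    -- `(-t₀, -t₁, 0, 0)`.
    obtain ⟨α, hα₀, hα₁⟩ := exists_glue hU (σ₀ - delbar (del t₀)) (σ₁ - delbar (del t₁)) (by
      rw [eq_comm, ← sub_eq_zero, ← hs]
      simp only [map_sub, delbar_res, del_res]
      abel)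
    refine ⟨α, ⟨mem_formsOfType_of_res hU ?_ ?_, Forms.ext_of_res hU ?_ ?_⟩, ?_⟩
    · rw [hα₀]
      exact sub_mem h0 (mem_formsOfType_congr (delbar_mem (del_mem ht₀)) (by ring) (by ring))
    · rw [hα₁]
      exact sub_mem h1 (mem_formsOfType_congr (delbar_mem (del_mem ht₁)) (by ring) (by ring))
    · rw [← d_res, hα₀, map_sub, d0, d_delbar_del ht₀, sub_zero, map_zero]
    · rw [← d_res, hα₁, map_sub, d1, d_delbar_del ht₁, sub_zero, map_zero]
    · refine ⟨(-t₀, -t₁, 0, 0), ⟨neg_mem ht₀, neg_mem ht₁, zero_mem _, zero_mem _⟩, ?_, ?_, ?_⟩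
      · change res _ α - σ₀ = _
        rw [hα₀]; simp
      · change res _ α - σ₁ = _
        rw [hα₁]; simp
      · change 0 - (res₁ t₁ - res₀ t₀) = _
        simp only [map_neg, map_zero]
        abel

theorem exists_equiv_CechHA (hU : U₀ ⊔ U₁ = ⊤) (p q : ℤ) :
    ∃ e : HA E p q (⊤ : Opens M) ≃ₗ[ℂ] CechHA E p q U₀ U₁,
      ∀ α : cocyclesA E p q (⊤ : Opens M),
        ∃ h : toQuadruple U₀ U₁ α.1 ∈ cechCocyclesA E p q U₀ U₁,
          e (cls α) = cls ⟨toQuadruple U₀ U₁ α.1, h⟩ := by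
  refine exists_equiv_quotient (toQuadruple U₀ U₁) ?_ ?_ ?_ ?_
  · rintro α ⟨hα, h⟩
    refine ⟨⟨res_mem _ hα, res_mem _ hα, zero_mem _, zero_mem _⟩, ?_, ?_, ?_⟩
    · change delbar (del (res _ _)) = 0
      rw [del_res, delbar_res, h, map_zero]
    · change delbar (del (res _ _)) = 0
      rw [del_res, delbar_res, h, map_zero]
    · change res inf_le_right (res le_top α) - res inf_le_left (res le_top α) - delbar 0 - del 0 = 0
      rw [res_res, res_res]
      simp
  · rintro _ ⟨a, ha, b, hb, rfl⟩
    refine ⟨res le_top a, res_mem _ ha, res le_top b, res_mem _ hb, res le_top a, res_mem _ ha,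
      res le_top b, res_mem _ hb, 0, zero_mem _, ?_, ?_, ?_, ?_⟩
    · rw [delbar_res, del_res, ← map_add]; rfl
    · rw [delbar_res, del_res, ← map_add]; rfl
    · rw [res_res, res_res]
      simp [toQuadruple]
    · rw [res_res, res_res]
      simp [toQuadruple]
  · rintro α ⟨hα, -⟩ ⟨a₀, ha₀, b₀, hb₀, a₁, ha₁, b₁, hb₁, η, hη, e₀, e₁, e₂, e₃⟩
    obtain ⟨η₀, η₁, rfl, hη'⟩ := exists_split hU η
    obtain ⟨hη₀, hη₁⟩ := hη' _ _ hη
    -- Injectivity. Splitting `η` makes `aᵢ - ∂ηᵢ` and `bᵢ - ∂̄ηᵢ` glue; the sum of primitives still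
    -- gives `α` because `∂̄∂ηᵢ + ∂∂̄ηᵢ = 0`.
    obtain ⟨a, haU₀, haU₁⟩ := exists_glue hU (a₀ - del η₀) (a₁ - del η₁) (by
      have h : (0 : Forms E (U₀ ⊓ U₁)) = _ := e₂
      rw [eq_comm, ← sub_eq_zero, h]
      simp only [map_sub, del_res]
      abel)
    obtain ⟨b, hbU₀, hbU₁⟩ := exists_glue hU (b₀ - delbar η₀) (b₁ - delbar η₁) (by
      have h : (0 : Forms E (U₀ ⊓ U₁)) = _ := e₃
      rw [eq_comm, ← sub_eq_zero, h]
      simp only [map_sub, delbar_res]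
      abel)
    refine ⟨a, mem_formsOfType_of_res hU ?_ ?_, b, mem_formsOfType_of_res hU ?_ ?_,
      Forms.ext_of_res hU ?_ ?_⟩
    · rw [haU₀]; exact sub_mem ha₀ (del_mem_of_eq hη₀ (by ring))
    · rw [haU₁]; exact sub_mem ha₁ (del_mem_of_eq hη₁ (by ring))
    · rw [hbU₀]; exact sub_mem hb₀ (delbar_mem_of_eq hη₀ (by ring))
    · rw [hbU₁]; exact sub_mem hb₁ (delbar_mem_of_eq hη₁ (by ring))
    · rw [map_add, ← delbar_res, ← del_res, haU₀, hbU₀]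
      refine e₀.trans ?_
      rw [map_sub, map_sub, del_delbar hη₀]
      abel
    · rw [map_add, ← delbar_res, ← del_res, haU₁, hbU₁]
      refine e₁.trans ?_
      rw [map_sub, map_sub, del_delbar hη₁]
      abel
  · rintro ⟨ξ₀, ξ₁, x₁, x₂⟩ ⟨⟨k0, k1, k2, k3⟩, c0, c1, hx⟩
    dsimp only at k0 k1 k2 k3 c0 c1 hx
    obtain ⟨a₀, a₁, rfl, ha⟩ := exists_split hU x₁
    obtain ⟨b₀, b₁, rfl, hb⟩ := exists_split hU x₂
    obtain ⟨ha₀, ha₁⟩ := ha _ _ k2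
    obtain ⟨hb₀, hb₁⟩ := hb _ _ k3
    -- Surjectivity. Both overlap components are split and moved into the components on `Uᵢ`, which
    -- changes the cocycle by the coboundary of `(-aᵢ, -bᵢ)`.
    obtain ⟨α, hα₀, hα₁⟩ := exists_glue hU (ξ₀ - delbar a₀ - del b₀) (ξ₁ - delbar a₁ - del b₁) (by
      rw [eq_comm, ← sub_eq_zero, ← hx]
      simp only [map_sub, delbar_res, del_res]
      abel)
    refine ⟨α, ⟨mem_formsOfType_of_res hU ?_ ?_, Forms.ext_of_res hU ?_ ?_⟩, ?_⟩
    · rw [hα₀]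
      exact sub_mem (sub_mem k0 (delbar_mem_of_eq ha₀ (by ring))) (del_mem_of_eq hb₀ (by ring))
    · rw [hα₁]
      exact sub_mem (sub_mem k1 (delbar_mem_of_eq ha₁ (by ring))) (del_mem_of_eq hb₁ (by ring))
    · rw [← delbar_res, ← del_res, hα₀]
      simp [c0, del_delbar ha₀, del_del hb₀, delbar_delbar (del_mem ha₀)]
    · rw [← delbar_res, ← del_res, hα₁]
      simp [c1, del_delbar ha₁, del_del hb₁, delbar_delbar (del_mem ha₁)]
    · refine ⟨-a₀, neg_mem ha₀, -b₀, neg_mem hb₀, -a₁, neg_mem ha₁, -b₁, neg_mem hb₁, 0,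
        zero_mem _, ?_, ?_, ?_, ?_⟩
      · change res _ α - ξ₀ = _
        rw [hα₀, map_neg, map_neg]; abel
      · change res _ α - ξ₁ = _
        rw [hα₁, map_neg, map_neg]; abel
      · change 0 - (res₁ a₁ - res₀ a₀) = _
        simp only [map_neg, map_zero]
        abel
      · change 0 - (res₁ b₁ - res₀ b₀) = _
        simp only [map_neg, map_zero]
        abel
end Partition

theorem cup_toTriple_toQuadruple (α β : Forms E (⊤ : Opens M)) :
    cup p q (toTriple U₀ U₁ α) (toQuadruple U₀ U₁ β) = toQuadruple U₀ U₁ (wedge α β) := by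
  refine Prod.ext rfl (Prod.ext rfl (Prod.ext ?_ ?_))
  · change _ • wedge _ 0 + wedge (del 0) _ - _ • del (wedge 0 _) = 0
    simp
  · change _ • wedge _ 0 - wedge (delbar 0) _ + _ • delbar (wedge 0 _) = 0
    simp

/-! ### The relative cup product -/

/-- The relative cup product as a bilinear map. -/
def relCupBilin (U₀ U₁ : Opens M) :
    RelPair E U₀ U₁ →ₗ[ℂ] Forms E U₁ →ₗ[ℂ] RelTriple E U₀ U₁ :=
  LinearMap.mk₂ ℂ relCup
    (fun σ σ' ξ => by
      ext1
      · simp [relCup]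
      ext1 <;>
      · simp only [relCup, Prod.fst_add, Prod.snd_add, map_add, LinearMap.add_apply]
        module)
    (fun c σ ξ => by
      ext1
      · simp [relCup]
      ext1 <;>
      · simp only [relCup, Prod.smul_fst, Prod.smul_snd, map_smul, LinearMap.smul_apply]
        module)
    (fun σ ξ ξ' => by
      ext1
      · simp [relCup]
      ext1 <;>
      · simp only [relCup, Prod.fst_add, Prod.snd_add, map_add]
        module)
    (fun c σ ξ => by
      ext1
      · simp [relCup]
      ext1 <;>
      · simp only [relCup, Prod.smul_fst, Prod.smul_snd, map_smul]
        module)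

theorem relCup_mem_relCochainsA {σ : RelPair E U₀ U₁} (hσ : σ ∈ relCochainsBC E p q U₀ U₁)
    {ξ : Forms E U₁} (hξ : ξ ∈ formsOfType E r s U₁) :
    relCup σ ξ ∈ relCochainsA E (p + r) (q + s) U₀ U₁ :=
  ⟨wedge_mem hσ.1 hξ, primFst_mem hσ.2 (res_mem inf_le_right hξ),
    primSnd_mem hσ.2 (res_mem inf_le_right hξ)⟩

theorem relCup_mem_relCocyclesA {σ : RelPair E U₀ U₁} (hσ : σ ∈ relCocyclesBC E p q U₀ U₁)
    {ξ : Forms E U₁} (hξ : ξ ∈ cocyclesA E r s U₁) :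
    relCup σ ξ ∈ relCocyclesA E (p + r) (q + s) U₀ U₁ := by
  refine ⟨relCup_mem_relCochainsA hσ.1 hξ.1, ?_⟩
  obtain ⟨σ₁, S⟩ := σ
  obtain ⟨⟨h1, h2⟩, d1, hs⟩ := hσ
  dsimp only at h1 h2 d1 hs
  refine ⟨delbar_del_wedge_of_closed h1 d1 hξ.2, ?_⟩
  have c : delbar (del (res₁ ξ : Forms E (U₀ ⊓ U₁))) = 0 := by
    rw [del_res, delbar_res, hξ.2, map_zero]
  -- On the overlap `σ₁ = ∂̄∂S`, so the relative cocycle condition for the product is exactly the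
  -- key identity.
  have e := delbar_del_wedge_eq h2 (res_mem inf_le_right hξ.1) c
  rw [← sub_eq_zero.1 hs, wedge_res] at e
  rw [sub_sub, sub_eq_zero]
  exact e

theorem relCup_mem_relCoboundariesA_of_left {σ : RelPair E U₀ U₁}
    (hσ : σ ∈ relCoboundariesBC E p q U₀ U₁) {ξ : Forms E U₁} (hξ : ξ ∈ cocyclesA E r s U₁) :
    relCup σ ξ ∈ relCoboundariesA E (p + r) (q + s) U₀ U₁ := by
  obtain ⟨σ₁, S⟩ := σ
  obtain ⟨⟨t, T₁, T₂⟩, ⟨ht, hT₁, hT₂⟩, h1, hS⟩ := hσ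
  obtain ⟨k, c⟩ := hξ
  dsimp only at ht hT₁ hT₂ h1 hS
  subst h1
  have c' : delbar (del (res₁ ξ : Forms E (U₀ ⊓ U₁))) = 0 := by
    rw [del_res, delbar_res, c, map_zero]
  have ht' := res_mem (inf_le_right : U₀ ⊓ U₁ ≤ U₁) ht
  have k' := res_mem (inf_le_right : U₀ ⊓ U₁ ≤ U₁) k
  have hS' : S = res₁ t - 0 - delbar T₁ - del T₂ := by rw [hS, sub_zero]
  have hX : (res₁ ξ : Forms E (U₀ ⊓ U₁)) - res₁ ξ - delbar 0 - del 0 = 0 := by simp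
  have i1 := cup_coboundaryBC_fst (zero_mem _) ht' hT₁ hT₂ (zero_mem (formsOfType E r (s - 1) _))
    (zero_mem (formsOfType E (r - 1) s _)) c' hS' hX
  have i2 := cup_coboundaryBC_snd (zero_mem _) ht' hT₁ hT₂ (zero_mem (formsOfType E r (s - 1) _))
    k' c' hS' hX
  simp only [map_zero, LinearMap.zero_apply, smul_zero, zero_add, zero_sub, sub_zero, sub_self,
    neg_zero] at i1 i2
  refine ⟨primFst t ξ, primFst_mem ht k, primSnd t ξ, primSnd_mem ht k,
    -((-1 : ℂ) ^ (p - 1 + (q - 1)) • wedge T₁ (del (res₁ ξ))), ?_,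
    (1 / 2 : ℂ) • (wedge (delbar T₁) (res₁ ξ) - wedge (del T₂) (res₁ ξ)), ?_,
    (-1 : ℂ) ^ (p - 1 + (q - 1)) • wedge T₂ (delbar (res₁ ξ)), ?_,
    delbar_del_wedge_eq ht k c, ?_, ?_⟩
  rotate_left 3
  · rw [res_primFst]
    exact i1
  · rw [res_primSnd]
    exact i2
  · exact neg_mem (Submodule.smul_mem _ _
      (wedge_mem_of_eq hT₁ (del_mem k') (by ring) (by ring)))
  · exact Submodule.smul_mem _ _ (sub_mem
      (wedge_mem_of_eq (delbar_mem hT₁) k' (by ring) (by ring))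
      (wedge_mem_of_eq (del_mem hT₂) k' (by ring) (by ring)))
  · exact Submodule.smul_mem _ _
      (wedge_mem_of_eq hT₂ (delbar_mem k') (by ring) (by ring))

theorem relCup_mem_relCoboundariesA_of_right {σ : RelPair E U₀ U₁}
    (hσ : σ ∈ relCocyclesBC E p q U₀ U₁) {ξ : Forms E U₁} (hξ : ξ ∈ coboundariesA E r s U₁) :
    relCup σ ξ ∈ relCoboundariesA E (p + r) (q + s) U₀ U₁ := by
  obtain ⟨σ₁, S⟩ := σ
  obtain ⟨⟨h1, h2⟩, d1, hs⟩ := hσ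
  obtain ⟨a, ha, b, hb, rfl⟩ := hξ
  dsimp only at h1 h2 d1 hs
  have ha' := res_mem (inf_le_right : U₀ ⊓ U₁ ≤ U₁) ha
  have hb' := res_mem (inf_le_right : U₀ ⊓ U₁ ≤ U₁) hb
  have hε : (-1 : ℂ) ^ (p - 1 + (q - 1)) = (-1) ^ (p + q) :=
    neg_one_zpow_of_even_sub ⟨-1, by ring⟩
  have hs' : res₁ σ₁ - 0 - delbar (del S) = 0 := by rw [sub_zero, hs]
  -- The absolute identity with `σ₀ = 0`, `a₀ = 0` and `η = 0`.
  have i1 := cup_coboundaryA_fst (a₀ := 0) (η := 0) h2 (zero_mem _) hε (map_zero _) hs' ha' hb'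
  have i2 := cup_coboundaryA_snd (b₀ := 0) (b₁ := res₁ b) (η := 0) h2 (zero_mem _) hε
    (map_zero _) hs' ha'
  simp only [map_zero, LinearMap.zero_apply, smul_zero, zero_add, zero_sub, sub_zero] at i1 i2
  refine ⟨(-1 : ℂ) ^ (p + q) • wedge σ₁ a,
    Submodule.smul_mem _ _ (wedge_mem_of_eq h1 ha (by ring) (by ring)),
    (-1 : ℂ) ^ (p + q) • wedge σ₁ b,
    Submodule.smul_mem _ _ (wedge_mem_of_eq h1 hb (by ring) (by ring)),
    (-1 : ℂ) ^ (p + q) • wedge (del S) (res₁ a), ?_,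
    (1 / 2 : ℂ) • (wedge S (delbar (res₁ a)) - wedge S (del (res₁ b))), ?_,
    -((-1 : ℂ) ^ (p + q) • wedge (delbar S) (res₁ b)), ?_, ?_, ?_, ?_⟩
  rotate_left 4
  · dsimp only [relCup]
    rw [map_smul, ← wedge_res, map_add, ← delbar_res, ← del_res]
    exact i1
  · dsimp only [relCup]
    rw [map_smul, ← wedge_res, map_add, ← delbar_res, ← del_res]
    exact i2
  · exact Submodule.smul_mem _ _ (wedge_mem_of_eq (del_mem h2) ha' (by ring) (by ring))
  · exact Submodule.smul_mem _ _ (sub_mem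
      (wedge_mem_of_eq h2 (delbar_mem ha') (by ring) (by ring))
      (wedge_mem_of_eq h2 (del_mem hb') (by ring) (by ring)))
  · exact neg_mem (Submodule.smul_mem _ _
      (wedge_mem_of_eq (delbar_mem h2) hb' (by ring) (by ring)))
  · dsimp only [relCup]
    rw [map_add, wedge_delbar_of_closed h1 d1, wedge_del_of_closed h1 d1]
end CupProduct

end CechBottChern
end

/-! ### The proposition. -/

theorem proposition4p1 {E : Type*} [NormedAddCommGroup E] [NormedSpace ℂ E]
    [FiniteDimensional ℂ E] {M : Type*} [TopologicalSpace M] [T2Space M]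
    [SecondCountableTopology M] [ChartedSpace E M] [IsManifold 𝓘(ℂ, E) ω M]
    (U₀ U₁ : Opens M) (hU : U₀ ⊔ U₁ = ⊤) (p q r s : ℤ) :
    -- the cup product of cochains, cocycles and coboundaries
    (∀ σ ∈ cochainsBC E p q U₀ U₁, ∀ ξ ∈ cochainsA E r s U₀ U₁,
      cup p q σ ξ ∈ cochainsA E (p + r) (q + s) U₀ U₁) ∧
    (∀ σ ∈ cechCocyclesBC E p q U₀ U₁, ∀ ξ ∈ cechCocyclesA E r s U₀ U₁,
      cup p q σ ξ ∈ cechCocyclesA E (p + r) (q + s) U₀ U₁) ∧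
    (∀ σ ∈ cechCoboundariesBC E p q U₀ U₁, ∀ ξ ∈ cechCocyclesA E r s U₀ U₁,
      cup p q σ ξ ∈ cechCoboundariesA E (p + r) (q + s) U₀ U₁) ∧
    (∀ σ ∈ cechCocyclesBC E p q U₀ U₁, ∀ ξ ∈ cechCoboundariesA E r s U₀ U₁,
      cup p q σ ξ ∈ cechCoboundariesA E (p + r) (q + s) U₀ U₁) ∧
    -- the induced bilinear map `Φ`, and its compatibility with the exterior product `W` of
    -- global classes via the isomorphisms `ιBC`, `ιA`, `ιA'`
    (∃ Φ : CechHBC E p q U₀ U₁ →ₗ[ℂ] CechHA E r s U₀ U₁ →ₗ[ℂ] CechHA E (p + r) (q + s) U₀ U₁,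
      (∀ (σ : cechCocyclesBC E p q U₀ U₁) (ξ : cechCocyclesA E r s U₀ U₁),
        ∃ h : cup p q σ.1 ξ.1 ∈ cechCocyclesA E (p + r) (q + s) U₀ U₁,
          Φ (cls σ) (cls ξ) = cls ⟨cup p q σ.1 ξ.1, h⟩) ∧
      ∃ (W : HBC E p q (⊤ : Opens M) →ₗ[ℂ] HA E r s (⊤ : Opens M) →ₗ[ℂ]
          HA E (p + r) (q + s) (⊤ : Opens M))
        (ιBC : HBC E p q (⊤ : Opens M) ≃ₗ[ℂ] CechHBC E p q U₀ U₁)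
        (ιA : HA E r s (⊤ : Opens M) ≃ₗ[ℂ] CechHA E r s U₀ U₁)
        (ιA' : HA E (p + r) (q + s) (⊤ : Opens M) ≃ₗ[ℂ] CechHA E (p + r) (q + s) U₀ U₁),
        (∀ (α : cocyclesBC E p q (⊤ : Opens M)) (β : cocyclesA E r s (⊤ : Opens M)),
          ∃ h : wedge α.1 β.1 ∈ cocyclesA E (p + r) (q + s) (⊤ : Opens M),
            W (cls α) (cls β) = cls ⟨wedge α.1 β.1, h⟩) ∧
        (∀ α : cocyclesBC E p q (⊤ : Opens M),
          ∃ h : (res le_top α.1, res le_top α.1, 0) ∈ cechCocyclesBC E p q U₀ U₁,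
            ιBC (cls α) = cls ⟨(res le_top α.1, res le_top α.1, 0), h⟩) ∧
        (∀ β : cocyclesA E r s (⊤ : Opens M),
          ∃ h : (res le_top β.1, res le_top β.1, 0, 0) ∈ cechCocyclesA E r s U₀ U₁,
            ιA (cls β) = cls ⟨(res le_top β.1, res le_top β.1, 0, 0), h⟩) ∧
        (∀ β : cocyclesA E (p + r) (q + s) (⊤ : Opens M),
          ∃ h : (res le_top β.1, res le_top β.1, 0, 0) ∈
              cechCocyclesA E (p + r) (q + s) U₀ U₁,
            ιA' (cls β) = cls ⟨(res le_top β.1, res le_top β.1, 0, 0), h⟩) ∧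
        ∀ a b, Φ (ιBC a) (ιA b) = ιA' (W a b)) ∧
    -- the relative cup product
    (∀ σ ∈ relCochainsBC E p q U₀ U₁, ∀ ξ ∈ formsOfType E r s U₁,
      relCup σ ξ ∈ relCochainsA E (p + r) (q + s) U₀ U₁) ∧
    (∀ σ ∈ relCocyclesBC E p q U₀ U₁, ∀ ξ ∈ cocyclesA E r s U₁,
      relCup σ ξ ∈ relCocyclesA E (p + r) (q + s) U₀ U₁) ∧
    (∀ σ ∈ relCoboundariesBC E p q U₀ U₁, ∀ ξ ∈ cocyclesA E r s U₁,
      relCup σ ξ ∈ relCoboundariesA E (p + r) (q + s) U₀ U₁) ∧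
    (∀ σ ∈ relCocyclesBC E p q U₀ U₁, ∀ ξ ∈ coboundariesA E r s U₁,
      relCup σ ξ ∈ relCoboundariesA E (p + r) (q + s) U₀ U₁) ∧
    ∃ Ψ : RelHBC E p q U₀ U₁ →ₗ[ℂ] HA E r s U₁ →ₗ[ℂ] RelHA E (p + r) (q + s) U₀ U₁,
      ∀ (σ : relCocyclesBC E p q U₀ U₁) (ξ : cocyclesA E r s U₁),
        ∃ h : relCup σ.1 ξ.1 ∈ relCocyclesA E (p + r) (q + s) U₀ U₁,
          Ψ (cls σ) (cls ξ) = cls ⟨relCup σ.1 ξ.1, h⟩ := by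
  refine ⟨fun σ hσ ξ hξ => cup_mem_cochainsA hσ hξ, fun σ hσ ξ hξ => cup_mem_cechCocyclesA hσ hξ,
    fun σ hσ ξ hξ => cup_mem_cechCoboundariesA_of_left hU hσ hξ,
    fun σ hσ ξ hξ => cup_mem_cechCoboundariesA_of_right hU hσ hξ, ?_,
    fun σ hσ ξ hξ => relCup_mem_relCochainsA hσ hξ, fun σ hσ ξ hξ => relCup_mem_relCocyclesA hσ hξ,
    fun σ hσ ξ hξ => relCup_mem_relCoboundariesA_of_left hσ hξ,
    fun σ hσ ξ hξ => relCup_mem_relCoboundariesA_of_right hσ hξ, ?_⟩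
  · obtain ⟨Φ, hΦ⟩ := exists_bilinear_quotient (cupBilin (E := E) p q U₀ U₁)
      (fun σ hσ ξ hξ => cup_mem_cechCocyclesA (r := r) (s := s) hσ hξ)
      (fun σ hσ ξ hξ => cup_mem_cechCoboundariesA_of_left hU hσ hξ)
      (fun σ hσ ξ hξ => cup_mem_cechCoboundariesA_of_right hU hσ hξ)
    obtain ⟨W, hW⟩ := exists_bilinear_quotient (wedge (E := E) (U := (⊤ : Opens M)))
      (fun σ hσ ξ hξ => wedge_mem_cocyclesA (p := p) (q := q) (r := r) (s := s) hσ hξ)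
      (fun σ hσ ξ hξ => wedge_mem_coboundariesA_of_left hσ hξ)
      (fun σ hσ ξ hξ => wedge_mem_coboundariesA_of_right hσ hξ)
    obtain ⟨ιBC, hBC⟩ := exists_equiv_CechHBC (E := E) hU p q
    obtain ⟨ιA, hA⟩ := exists_equiv_CechHA (E := E) hU r s
    obtain ⟨ιA', hA'⟩ := exists_equiv_CechHA (E := E) hU (p + r) (q + s)
    refine ⟨Φ, hΦ, W, ιBC, ιA, ιA', hW, hBC, hA, hA', fun a b => ?_⟩
    -- On representatives the compatibility holds already for cochains: with vanishing overlap
    -- components the cup product is the restriction of the exterior product.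
    induction a using Submodule.Quotient.induction_on with | _ α
    induction b using Submodule.Quotient.induction_on with | _ β
    obtain ⟨h₁, e₁⟩ := hBC α
    obtain ⟨h₂, e₂⟩ := hA β
    obtain ⟨h₃, e₃⟩ := hW α β
    obtain ⟨h₄, e₄⟩ := hA' ⟨_, h₃⟩
    obtain ⟨h₅, e₅⟩ := hΦ ⟨_, h₁⟩ ⟨_, h₂⟩
    rw [e₁, e₂, e₃, e₄, e₅]
    congr 2
    exact cup_toTriple_toQuadruple α.1 β.1
  · exact exists_bilinear_quotient (relCupBilin (E := E) U₀ U₁)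
      (fun σ hσ ξ hξ => relCup_mem_relCocyclesA (r := r) (s := s) hσ hξ)
      (fun σ hσ ξ hξ => relCup_mem_relCoboundariesA_of_left hσ hξ)
      (fun σ hσ ξ hξ => relCup_mem_relCoboundariesA_of_right hσ hξ)
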